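/- **Setting.** Let $M$ be a smooth connected manifold and let $m_1=\dim M$. For $j=1,2$ let $G_j$ be a complex Lie subgroup of $\mathrm{GL}(m_j,\mathbb C)$ (that is, a complex Lie group with an injective homomorphism to $\mathrm{GL}(m_j,\mathbb C)$ which is a holomorphic immersion), and let $F_j\neq\emptyset$ be a complex submanifold of the Grassmannian $\mathrm{Gr}_{r_j}(m_j,\mathbb C)$ of $r_j$-dimensional subspaces of $\mathbb C^{m_j}$ (that is, a complex manifold injectively and holomorphically immersed in it), such that the canonical action of $G_j$ on the Grassmannian induces a transitive holomorphic action of $G_j$ on $F_j$. Let $P_j\to M$ be a smooth principal bundle with structure group $G_j$, endowed with a connection $\nabla_j$, where $P_1$ is a subbundle of the bundle of complex frames of $T^{\mathbb C}M$. Let $T$ be the torsion of $\nabla_1$ and $R_j$ the curvature form of $\nabla_j$, all extended complex-multilinearly, where $R_1$ takes values in the endomorphisms of $T^{\mathbb C}M$ and $R_2$ in those of $P_2\times_{G_2}\mathbb C^{m_2}$. Let $Q_j=P_j\times_{G_j}F_j$ and let $\pi:Q\to M$ be the fibre product of $Q_1$ and $Q_2$ over $M$. A point of $Q$ over $x\in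 M$ is a pair $(p,q)$, where $p$ is a subspace of $T_x^{\mathbb C}M$ and $q$ is a subspace of the fibre of $P_2\times_{G_2}\mathbb C^{m_2}$ at $x$. The fibres of $\pi$ are complex manifolds, locally identified with $F_1\times F_2$, so that $\ker d\pi$ is a complex vector bundle and $(\ker d\pi)^{\mathbb C}=(\ker d\pi)^{1,0}\oplus(\ker d\pi)^{0,1}$. Let $\mathscr H\subseteq TQ$ be the horizontal distribution induced on $Q$ by $\nabla_1$ and $\nabla_2$, and let $\mathscr G_0\subseteq\mathscr H^{\mathbb C}$ be the subbundle characterised by $d\pi\bigl((\mathscr G_0)_{(p,q)}\bigr)=p$ for all $(p,q)\in Q$. Put $$\mathscr G=\mathscr G_0\oplus(\ker d\pi)^{0,1},\qquad \mathscr G'=\mathscr G_0\oplus(\ker d\pi)^{1,0}.$$ A complex distribution is called integrable if the Lie bracket of any two of its smooth (local) sections is again a section of it. **Theorem.** If $\dim_{\mathbb C}F_1\ge1$, then $\mathscr G'$ is not integrable. Furthermore, the following assertions are equivalent: (i) $\mathscr G$ is integrable; (ii) for all $(p,q)\in Q$ we have $T(X,Y)\in p$, $R_1(X,Y)Z\in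 p$ and $R_2(X,Y)\zeta\in q$ for all $X,Y,Z\in p$ and $\zeta\in q$; that is, $T(\Lambda^2p)\subseteq p$, $R_1(\Lambda^2p)(p)\subseteq p$ and $R_2(\Lambda^2p)(q)\subseteq q$. -/

import Mathlib

open scoped Manifold ContDiff TensorProduct
open Set

/-! ### Linear algebra of complexifications -/

noncomputable section Complexification

/-- The real part `1 ⊗ a + i ⊗ b ↦ a` of an element of a complexified real vector space. -/
def reC (E : Type*) [AddCommGroup E] [Module ℝ E] : ℂ ⊗[ℝ] E →ₗ[ℝ] E :=
  (TensorProduct.lid ℝ E).toLinearMap ∘ₗ LinearMap.rTensor E Complex.reLm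

/-- The imaginary part `1 ⊗ a + i ⊗ b ↦ b` of an element of a complexified real vector space. -/
def imC (E : Type*) [AddCommGroup E] [Module ℝ E] : ℂ ⊗[ℝ] E →ₗ[ℝ] E :=
  (TensorProduct.lid ℝ E).toLinearMap ∘ₗ LinearMap.rTensor E Complex.imLm

/-- The complex-bilinear extension to the complexification of `E` of a real-bilinear map `β` on `E`
with values in a complex vector space. -/
def complexBilin {E W : Type*} [AddCommGroup E] [Module ℝ E] [AddCommGroup W] [Module ℂ W]
    (β : E → E → W) (X Y : ℂ ⊗[ℝ] E) : W :=
  (β (reC E X) (reC E Y) - β (imC E X) (imC E Y)) +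
    Complex.I • (β (reC E X) (imC E Y) + β (imC E X) (reC E Y))

/-- Multiplication by `i`, as a real-linear map of a complex vector space. -/
def mulI (E : Type*) [AddCommGroup E] [Module ℂ E] [Module ℝ E] [IsScalarTower ℝ ℂ E] :
    E →ₗ[ℝ] E :=
  (LinearMap.lsmul ℂ E Complex.I).restrictScalars ℝ

/-- The space of `(1,0)`-vectors in the complexification of (the real vector space underlying) a
complex vector space: the `i`-eigenspace of the complexified complex structure. -/
def vectors10 (E : Type*) [AddCommGroup E] [Module ℂ E] [Module ℝ E] [IsScalarTower ℝ ℂ E] :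
    Submodule ℂ (ℂ ⊗[ℝ] E) :=
  Module.End.eigenspace ((mulI E).baseChange ℂ) Complex.I

/-- The space of `(0,1)`-vectors: the `-i`-eigenspace of the complexified complex structure. -/
def vectors01 (E : Type*) [AddCommGroup E] [Module ℂ E] [Module ℝ E] [IsScalarTower ℝ ℂ E] :
    Submodule ℂ (ℂ ⊗[ℝ] E) :=
  Module.End.eigenspace ((mulI E).baseChange ℂ) (-Complex.I)

end Complexification

/-! ### Calculus on manifolds -/

noncomputable section Calculus

variable {E : Type*} [NormedAddCommGroup E] [NormedSpace ℝ E]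
  {H : Type*} [TopologicalSpace H] (I : ModelWithCorners ℝ E H)
  {N : Type*} [TopologicalSpace N] [ChartedSpace H N]

/-- The complexified tangent space. -/
abbrev TangentSpaceC (x : N) : Type _ := ℂ ⊗[ℝ] TangentSpace I x

/-- The exterior derivative `dα (v, w)` at `x` of a vector-valued 1-form `α`, computed in the
preferred chart at `x` (which identifies `TangentSpace I x` with the model space `E`), as
`∂_v (α w) - ∂_w (α v)` for the constant coordinate fields `v`, `w`. -/
def extDerivOneForm {W : Type*} [NormedAddCommGroup W] [NormedSpace ℝ W]
    (α : (x : N) → TangentSpace I x → W) (x : N) (v w : TangentSpace I x) : W :=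
  let α' (y : E) (e : E) : W :=
    α ((extChartAt I x).symm y) (mfderiv 𝓘(ℝ, E) I (extChartAt I x).symm y e)
  fderiv ℝ (fun y ↦ α' y w) (extChartAt I x x) v - fderiv ℝ (fun y ↦ α' y v) (extChartAt I x x) w

/-- The real part of a complex vector field. -/
def reField (X : (x : N) → TangentSpaceC I x) (x : N) : TangentSpace I x := reC _ (X x)

/-- The imaginary part of a complex vector field. -/
def imField (X : (x : N) → TangentSpaceC I x) (x : N) : TangentSpace I x := imC _ (X x)

/-- The Lie bracket of complex vector fields: the complex-bilinear extension of the bracket of real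
vector fields. -/
def lieBracketC (X Y : (x : N) → TangentSpaceC I x) (x : N) : TangentSpaceC I x :=
  (1 : ℂ) ⊗ₜ[ℝ] (VectorField.mlieBracket I (reField I X) (reField I Y) x
      - VectorField.mlieBracket I (imField I X) (imField I Y) x) +
    Complex.I ⊗ₜ[ℝ] (VectorField.mlieBracket I (reField I X) (imField I Y) x
      + VectorField.mlieBracket I (imField I X) (reField I Y) x)

/-- A complex vector field is smooth on a set if its real and imaginary parts are. -/
def SmoothFieldOn [IsManifold I 1 N] (X : (x : N) → TangentSpaceC I x) (W : Set N) : Prop :=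
  ContMDiffOn I I.tangent ∞ (fun x ↦ (⟨x, reField I X x⟩ : TangentBundle I N)) W ∧
    ContMDiffOn I I.tangent ∞ (fun x ↦ (⟨x, imField I X x⟩ : TangentBundle I N)) W

/-- A complex distribution `D` is integrable if the bracket of any two (local) smooth sections
of `D` is again a section of `D`. -/
def IsIntegrableDistribution [IsManifold I 1 N]
    (D : (x : N) → Submodule ℂ (TangentSpaceC I x)) : Prop :=
  ∀ W : Set N, IsOpen W → ∀ X Y : (x : N) → TangentSpaceC I x,
    SmoothFieldOn I X W → SmoothFieldOn I Y W →
    (∀ x ∈ W, X x ∈ D x) → (∀ x ∈ W, Y x ∈ D x) →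
    ∀ x ∈ W, lieBracketC I X Y x ∈ D x

end Calculus

/-! ### Complex manifolds as real manifolds -/

section RealStructure

variable {E : Type*} [NormedAddCommGroup E] [NormedSpace ℂ E]
  {E' : Type*} [NormedAddCommGroup E'] [NormedSpace ℂ E']
  {E'' : Type*} [NormedAddCommGroup E''] [NormedSpace ℂ E'']
  {N : Type*} [TopologicalSpace N] [ChartedSpace E N]
  {N' : Type*} [TopologicalSpace N'] [ChartedSpace E' N']
  {N'' : Type*} [TopologicalSpace N''] [ChartedSpace E'' N'']

/-- A complex manifold is a smooth real manifold. -/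
instance isManifold_real_of_complex [IsManifold 𝓘(ℂ, E) ω N] : IsManifold 𝓘(ℝ, E) ∞ N := by
  refine isManifold_of_contDiffOn _ _ _ fun e e' he he' ↦ ?_
  have h := (contDiffGroupoid ω 𝓘(ℂ, E)).compatible he he'
  have h1 := contMDiffOn_iff_contDiffOn.1 (contMDiffOn_of_mem_contDiffGroupoid h)
  have h2 := (h1.restrict_scalars ℝ).of_le (m := ∞) le_top
  simpa using h2

/-- A holomorphic map on a product is smooth for the underlying real structures. -/
theorem contMDiff_real_of_complex {f : N × N' → N''}
    (hf : ContMDiff (𝓘(ℂ, E).prod 𝓘(ℂ, E')) 𝓘(ℂ, E'') ω f) :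
    ContMDiff (𝓘(ℝ, E).prod 𝓘(ℝ, E')) 𝓘(ℝ, E'') ∞ f := by
  intro x
  have hx := hf x
  rw [contMDiffAt_iff] at hx ⊢
  refine ⟨hx.1, ?_⟩
  have h2 := (hx.2.restrict_scalars ℝ).of_le (m := ∞) le_top
  convert h2 using 1 <;> rfl

end RealStructure

/-! ### Smooth fibre bundles given by transition functions -/

noncomputable section Bundles

section SmoothBundles

variable {EM : Type*} [NormedAddCommGroup EM] [NormedSpace ℝ EM]
  {M : Type*} [TopologicalSpace M] [ChartedSpace EM M]
  {EF : Type*} [NormedAddCommGroup EF] [NormedSpace ℝ EF]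
  {HF : Type*} [TopologicalSpace HF] {IF : ModelWithCorners ℝ EF HF}
  {F : Type*} [TopologicalSpace F] [ChartedSpace HF F]
  {ι : Type*}

/-- The total space of a fibre bundle over `M` with fibre `F` is charted by the composites of the
local trivializations with the product charts of `M × F`. -/
instance coreChartedSpace (Z : FiberBundleCore ι M F) :
    ChartedSpace (ModelProd EM HF) (Bundle.TotalSpace F Z.Fiber) :=
  ChartedSpace.comp (ModelProd EM HF) (M × F) (Bundle.TotalSpace F Z.Fiber)

/-- The transition functions of the bundle are smooth. -/
class IsSmoothCore (EM : Type*) [NormedAddCommGroup EM] [NormedSpace ℝ EM]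
    [ChartedSpace EM M] (IF : ModelWithCorners ℝ EF HF) (Z : FiberBundleCore ι M F) : Prop where
  smooth : ∀ i j, ContMDiffOn (𝓘(ℝ, EM).prod IF) IF ∞
    (fun p : M × F ↦ Z.coordChange i j p.1 p.2) ((Z.baseSet i ∩ Z.baseSet j) ×ˢ univ)

instance isManifold_core [IsManifold 𝓘(ℝ, EM) ∞ M] [IsManifold IF ∞ F]
    (Z : FiberBundleCore ι M F) [hZ : IsSmoothCore EM IF Z] :
    IsManifold (𝓘(ℝ, EM).prod IF) ∞ (Bundle.TotalSpace F Z.Fiber) := by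
  refine isManifold_of_contDiffOn _ _ _ fun e e' he he' ↦ ?_
  obtain ⟨_, ⟨_, ⟨i, rfl⟩, rfl⟩, f, hf, rfl⟩ := he
  obtain ⟨_, ⟨_, ⟨j, rfl⟩, rfl⟩, f', hf', rfl⟩ := he'
  have hf1 := contMDiffOn_symm_of_mem_maximalAtlas (I := 𝓘(ℝ, EM).prod IF) (n := ∞)
    (StructureGroupoid.subset_maximalAtlas _ hf)
  have hf2 := contMDiffOn_of_mem_maximalAtlas (I := 𝓘(ℝ, EM).prod IF) (n := ∞)
    (StructureGroupoid.subset_maximalAtlas _ hf')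
  have hc : ContMDiffOn (𝓘(ℝ, EM).prod IF) (𝓘(ℝ, EM).prod IF) ∞
      ((Z.localTriv i).toOpenPartialHomeomorph.symm ≫ₕ (Z.localTriv j).toOpenPartialHomeomorph)
      ((Z.localTriv i).toOpenPartialHomeomorph.symm ≫ₕ
        (Z.localTriv j).toOpenPartialHomeomorph).source := by
    have hsrc : ∀ p ∈ ((Z.localTriv i).toOpenPartialHomeomorph.symm ≫ₕ
        (Z.localTriv j).toOpenPartialHomeomorph).source,
        p.1 ∈ Z.baseSet i ∧ p.1 ∈ Z.baseSet j := by
      intro p hp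
      exact ⟨(hp.1 : p ∈ Z.baseSet i ×ˢ univ).1, hp.2⟩
    refine contMDiffOn_fst.prodMk (((hZ.smooth i j).mono fun p hp ↦ ?_).congr fun p hp ↦ ?_)
    · exact ⟨hsrc p hp, mem_univ _⟩
    · exact Z.coordChange_comp i _ j p.1
        ⟨⟨(hsrc p hp).1, Z.mem_baseSet_at p.1⟩, (hsrc p hp).2⟩ p.2
  have h1 := hf2.comp (hc.comp (hf1.mono (t := (f.symm ≫ₕ
      ((Z.localTriv i).toOpenPartialHomeomorph.symm ≫ₕ
        (Z.localTriv j).toOpenPartialHomeomorph) ≫ₕ f').source) ?_) ?_) ?_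
  rotate_left
  · intro p hp
    exact hp.1
  · intro p hp
    exact hp.2.1
  · intro p hp
    exact hp.2.2
  have h2 := (𝓘(ℝ, EM).prod IF).contMDiff.comp_contMDiffOn
    (h1.comp ((𝓘(ℝ, EM).prod IF).contMDiffOn_symm.mono
      (t := (𝓘(ℝ, EM).prod IF).symm ⁻¹' _ ∩ range (𝓘(ℝ, EM).prod IF)) inter_subset_right)
      inter_subset_left)
  refine (contMDiffOn_iff_contDiffOn.1 h2).mono ?_
  rintro p ⟨hp, hp'⟩
  refine ⟨?_, hp'⟩
  simp only [OpenPartialHomeomorph.trans_assoc, OpenPartialHomeomorph.trans_symm_eq_symm_trans_symm,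
    mem_preimage] at hp ⊢
  exact hp

end SmoothBundles

section Product

variable {EM : Type*} [NormedAddCommGroup EM] [NormedSpace ℝ EM]
  {M : Type*} [TopologicalSpace M] [ChartedSpace EM M]
  {EF₁ : Type*} [NormedAddCommGroup EF₁] [NormedSpace ℝ EF₁]
  {HF₁ : Type*} [TopologicalSpace HF₁] {IF₁ : ModelWithCorners ℝ EF₁ HF₁}
  {F₁ : Type*} [TopologicalSpace F₁] [ChartedSpace HF₁ F₁]
  {EF₂ : Type*} [NormedAddCommGroup EF₂] [NormedSpace ℝ EF₂]
  {HF₂ : Type*} [TopologicalSpace HF₂] {IF₂ : ModelWithCorners ℝ EF₂ HF₂}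
  {F₂ : Type*} [TopologicalSpace F₂] [ChartedSpace HF₂ F₂]
  {ι₁ ι₂ : Type*}

/-- The fibre product over `M` of two fibre bundles. Its fibre at `x` is the product of the fibres
at `x`. -/
def prodCore (Z₁ : FiberBundleCore ι₁ M F₁) (Z₂ : FiberBundleCore ι₂ M F₂) :
    FiberBundleCore (ι₁ × ι₂) M (F₁ × F₂) where
  baseSet i := Z₁.baseSet i.1 ∩ Z₂.baseSet i.2
  isOpen_baseSet i := (Z₁.isOpen_baseSet i.1).inter (Z₂.isOpen_baseSet i.2)
  indexAt x := (Z₁.indexAt x, Z₂.indexAt x)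
  mem_baseSet_at x := ⟨Z₁.mem_baseSet_at x, Z₂.mem_baseSet_at x⟩
  coordChange i j x f := (Z₁.coordChange i.1 j.1 x f.1, Z₂.coordChange i.2 j.2 x f.2)
  coordChange_self i x hx f :=
    Prod.ext (Z₁.coordChange_self _ _ hx.1 _) (Z₂.coordChange_self _ _ hx.2 _)
  continuousOn_coordChange i j := by
    refine ContinuousOn.prodMk ?_ ?_
    · exact (Z₁.continuousOn_coordChange i.1 j.1).comp
        (f := fun p : M × F₁ × F₂ ↦ (p.1, p.2.1)) (by fun_prop)
        fun p hp ↦ ⟨⟨hp.1.1.1, hp.1.2.1⟩, mem_univ _⟩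
    · exact (Z₂.continuousOn_coordChange i.2 j.2).comp
        (f := fun p : M × F₁ × F₂ ↦ (p.1, p.2.2)) (by fun_prop)
        fun p hp ↦ ⟨⟨hp.1.1.2, hp.1.2.2⟩, mem_univ _⟩
  coordChange_comp i j k x hx f :=
    Prod.ext (Z₁.coordChange_comp _ _ _ _ ⟨⟨hx.1.1.1, hx.1.2.1⟩, hx.2.1⟩ _)
      (Z₂.coordChange_comp _ _ _ _ ⟨⟨hx.1.1.2, hx.1.2.2⟩, hx.2.2⟩ _)

instance isSmoothCore_prodCore (Z₁ : FiberBundleCore ι₁ M F₁) (Z₂ : FiberBundleCore ι₂ M F₂)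
    [h₁ : IsSmoothCore EM IF₁ Z₁] [h₂ : IsSmoothCore EM IF₂ Z₂] :
    IsSmoothCore EM (IF₁.prod IF₂) (prodCore Z₁ Z₂) where
  smooth i j := by
    refine ContMDiffOn.prodMk ?_ ?_
    · refine (h₁.smooth i.1 j.1).comp (f := fun p : M × F₁ × F₂ ↦ (p.1, p.2.1))
        (contMDiff_fst.prodMk (contMDiff_fst.comp contMDiff_snd)).contMDiffOn
        fun p hp ↦ ⟨⟨hp.1.1.1, hp.1.2.1⟩, mem_univ _⟩
    · refine (h₂.smooth i.2 j.2).comp (f := fun p : M × F₁ × F₂ ↦ (p.1, p.2.2))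
        (contMDiff_fst.prodMk (contMDiff_snd.comp contMDiff_snd)).contMDiffOn
        fun p hp ↦ ⟨⟨hp.1.1.2, hp.1.2.2⟩, mem_univ _⟩

end Product

/-! ### Principal bundles and connections -/

section Principal

variable (EM : Type*) [NormedAddCommGroup EM] [NormedSpace ℝ EM]
  (M : Type*) [TopologicalSpace M] [ChartedSpace EM M]
  (EP : Type*) [NormedAddCommGroup EP] [NormedSpace ℝ EP]
  (P : Type*) [TopologicalSpace P] [ChartedSpace EP P]
  (EG : Type*) [NormedAddCommGroup EG] [NormedSpace ℂ EG]
  (G : Type*) [TopologicalSpace G] [ChartedSpace EG G]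

/-- A smooth local trivialization of a principal bundle: a local section `sec` over an open set
`base` such that `(x, g) ↦ sec x · g` is a diffeomorphism from `base × G` onto the part of `P` over
`base`, with inverse `(proj, coord)`. -/
structure PrincipalTriv (proj : P → M) (act : P → G → P) where
  base : Set M
  isOpen_base : IsOpen base
  sec : M → P
  coord : P → G
  contMDiffOn_sec : ContMDiffOn 𝓘(ℝ, EM) 𝓘(ℝ, EP) ∞ sec base
  contMDiffOn_coord : ContMDiffOn 𝓘(ℝ, EP) 𝓘(ℝ, EG) ∞ coord (proj ⁻¹' base)
  proj_sec : ∀ x ∈ base, proj (sec x) = x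
  act_coord : ∀ u, proj u ∈ base → act (sec (proj u)) (coord u) = u
  coord_act : ∀ x ∈ base, ∀ g, coord (act (sec x) g) = g

/-- A smooth principal bundle with total space `P`, base `M` and structure group `G`. -/
structure PrincipalBundle [Group G] where
  proj : P → M
  /-- The right action of `G` on `P`. -/
  act : P → G → P
  act_one : ∀ u, act u 1 = u
  act_mul : ∀ u g h, act u (g * h) = act (act u g) h
  proj_act : ∀ u g, proj (act u g) = proj u
  contMDiff_proj : ContMDiff 𝓘(ℝ, EP) 𝓘(ℝ, EM) ∞ proj
  contMDiff_act : ContMDiff (𝓘(ℝ, EP).prod 𝓘(ℝ, EG)) 𝓘(ℝ, EP) ∞ (fun z : P × G ↦ act z.1 z.2)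
  exists_triv : ∀ x, ∃ σ : PrincipalTriv EM M EP P EG G proj act, x ∈ σ.base

variable {EM M EP P EG G} [Group G]

namespace PrincipalBundle

variable (B : PrincipalBundle EM M EP P EG G)

/-- The local trivializations of a principal bundle. -/
abbrev Triv : Type _ := PrincipalTriv EM M EP P EG G B.proj B.act

/-- A local trivialization around `x`. -/
def trivAt (x : M) : B.Triv := (B.exists_triv x).choose

theorem mem_trivAt (x : M) : x ∈ (B.trivAt x).base := (B.exists_triv x).choose_spec

/-- A reference point of the fibre of `P` over `x`. -/
def pt (x : M) : P := (B.trivAt x).sec x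

theorem proj_pt (x : M) : B.proj (B.pt x) = x := (B.trivAt x).proj_sec x (B.mem_trivAt x)

theorem coord_act' (σ : B.Triv) (u : P) (hu : B.proj u ∈ σ.base) (g : G) :
    σ.coord (B.act u g) = σ.coord u * g := by
  conv_lhs => rw [← σ.act_coord u hu, ← B.act_mul]
  exact σ.coord_act _ hu _

variable (F : Type*) [TopologicalSpace F] {EF : Type*} [NormedAddCommGroup EF] [NormedSpace ℂ EF]
  [ChartedSpace EF F] [MulAction G F]

theorem contMDiffOn_coordChange [ContMDiffSMul 𝓘(ℂ, EG) 𝓘(ℂ, EF) ω G F] (σ τ : B.Triv) :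
    ContMDiffOn (𝓘(ℝ, EM).prod 𝓘(ℝ, EF)) 𝓘(ℝ, EF) ∞
      (fun p : M × F ↦ τ.coord (σ.sec p.1) • p.2) ((σ.base ∩ τ.base) ×ˢ univ) := by
  have h := contMDiff_real_of_complex
    (ContMDiffSMul.contMDiff_smul (I := 𝓘(ℂ, EG)) (I' := 𝓘(ℂ, EF)) (n := ω) (G := G) (M := F))
  have h1 : ContMDiffOn 𝓘(ℝ, EM) 𝓘(ℝ, EG) ∞ (fun x ↦ τ.coord (σ.sec x)) (σ.base ∩ τ.base) :=
    τ.contMDiffOn_coord.comp (σ.contMDiffOn_sec.mono inter_subset_left) fun x hx ↦ by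
      simpa [σ.proj_sec x hx.1] using hx.2
  exact h.comp_contMDiffOn ((h1.comp contMDiffOn_fst fun p hp ↦ hp.1).prodMk contMDiffOn_snd)

variable (EF) in
/-- The associated bundle `P ×_G F`. The fibre at `x` is `F`, where `f` represents the class of
`(pt x, f)`; the trivialization given by `σ` sends the class of `(σ.sec x, f)` to `(x, f)`. -/
def assoc [ContMDiffSMul 𝓘(ℂ, EG) 𝓘(ℂ, EF) ω G F] : FiberBundleCore B.Triv M F where
  baseSet σ := σ.base
  isOpen_baseSet σ := σ.isOpen_base
  indexAt := B.trivAt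
  mem_baseSet_at := B.mem_trivAt
  coordChange σ τ x f := τ.coord (σ.sec x) • f
  coordChange_self σ x hx f := by
    have := σ.coord_act x hx 1
    rw [B.act_one] at this
    rw [this, one_smul]
  continuousOn_coordChange σ τ := (B.contMDiffOn_coordChange F (EF := EF) σ τ).continuousOn
  coordChange_comp σ τ υ x hx f := by
    have hσ : B.proj (σ.sec x) = x := σ.proj_sec x hx.1.1
    have hτ : B.proj (τ.sec x) = x := τ.proj_sec x hx.1.2
    have h := τ.act_coord (σ.sec x) (by rw [hσ]; exact hx.1.2)
    rw [hσ] at h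
    rw [smul_smul, ← B.coord_act' υ (τ.sec x) (by rw [hτ]; exact hx.2), h]

instance isSmoothCore_assoc [ContMDiffSMul 𝓘(ℂ, EG) 𝓘(ℂ, EF) ω G F] :
    IsSmoothCore EM 𝓘(ℝ, EF) (B.assoc F EF) where
  smooth σ τ := B.contMDiffOn_coordChange F σ τ

variable {F}

/-- The class of `(u, f)` in `P ×_G F`. -/
def cls [ContMDiffSMul 𝓘(ℂ, EG) 𝓘(ℂ, EF) ω G F] (u : P) (f : F) :
    Bundle.TotalSpace F (B.assoc F EF).Fiber :=
  ⟨B.proj u, (B.trivAt (B.proj u)).coord u • f⟩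

theorem cls_act [ContMDiffSMul 𝓘(ℂ, EG) 𝓘(ℂ, EF) ω G F] (u : P) (g : G) (f : F) :
    B.cls (EF := EF) (B.act u g) f = B.cls (EF := EF) u (g • f) := by
  have h : (B.trivAt (B.proj (B.act u g))).coord (B.act u g) • f =
      (B.trivAt (B.proj u)).coord u • g • f := by
    rw [B.proj_act, B.coord_act' _ u (B.mem_trivAt _), mul_smul]
  unfold cls
  rw [h, B.proj_act]

theorem cls_pt [ContMDiffSMul 𝓘(ℂ, EG) 𝓘(ℂ, EF) ω G F] (x : M) (f : F) :
    B.cls (EF := EF) (B.pt x) f = ⟨x, f⟩ := by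
  have h : (B.trivAt (B.proj (B.pt x))).coord (B.pt x) • f = f := by
    rw [B.proj_pt]
    have := (B.trivAt x).coord_act x (B.mem_trivAt x) 1
    rw [B.act_one] at this
    rw [pt, this, one_smul]
  unfold cls
  rw [h, B.proj_pt]

/-- Two pairs have the same class exactly when they are in the same orbit of `G`. -/
theorem exists_of_cls_eq [ContMDiffSMul 𝓘(ℂ, EG) 𝓘(ℂ, EF) ω G F] {u v : P} {f f' : F}
    (h : B.cls (EF := EF) u f = B.cls (EF := EF) v f') : ∃ g : G, v = B.act u g ∧ f = g • f' := by
  have h1 : B.proj u = B.proj v := congrArg Bundle.TotalSpace.proj h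
  have h2 : (B.trivAt (B.proj u)).coord u • f = (B.trivAt (B.proj u)).coord v • f' := by
    have h3 := ((Bundle.TotalSpace.mk.injEq _ _ _ _).mp h).2
    rw [h1]
    rw [h1] at h3
    exact eq_of_heq h3
  set σ := B.trivAt (B.proj u)
  have hσ := B.mem_trivAt (B.proj u)
  refine ⟨(σ.coord u)⁻¹ * σ.coord v, ?_, ?_⟩
  · have hu := σ.act_coord u hσ
    have hv := σ.act_coord v (h1 ▸ hσ)
    rw [← h1] at hv
    calc v = B.act (σ.sec (B.proj u)) (σ.coord u * ((σ.coord u)⁻¹ * σ.coord v)) := by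
          rw [mul_inv_cancel_left, hv]
      _ = B.act u ((σ.coord u)⁻¹ * σ.coord v) := by rw [B.act_mul, hu]
  · rw [mul_smul, ← h2, inv_smul_smul]

variable [IsManifold 𝓘(ℝ, EP) ∞ P]

/-- A connection on a principal bundle, given by its connection form. -/
structure Connection where
  /-- The connection form, with values in the Lie algebra of `G`. -/
  form : (u : P) → TangentSpace 𝓘(ℝ, EP) u →L[ℝ] GroupLieAlgebra 𝓘(ℂ, EG) G
  smooth : ContMDiff (M' := EG) 𝓘(ℝ, EP).tangent 𝓘(ℝ, EG) ∞
    (fun w : TangentBundle 𝓘(ℝ, EP) P ↦ form w.1 w.2)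
  /-- The form reproduces the generators of the fundamental vector fields. -/
  form_fundamental : ∀ (u : P) (a : GroupLieAlgebra 𝓘(ℂ, EG) G),
    form (B.act u 1) (mfderiv 𝓘(ℝ, EG) 𝓘(ℝ, EP) (B.act u) 1 a) = a
  /-- `R_g^* ω = Ad (g⁻¹) ω`. -/
  form_act : ∀ (u : P) (g : G) (w : TangentSpace 𝓘(ℝ, EP) u),
    form (B.act u g) (mfderiv 𝓘(ℝ, EP) 𝓘(ℝ, EP) (fun v ↦ B.act v g) u w) =
      mfderiv 𝓘(ℂ, EG) 𝓘(ℂ, EG) (fun h : G ↦ g⁻¹ * h * g) 1 (form u w)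

namespace Connection

variable {B} (c : B.Connection)

/-- The horizontal space at `u`. -/
def horizontal (u : P) : Submodule ℝ (TangentSpace 𝓘(ℝ, EP) u) := LinearMap.ker (c.form u).toLinearMap

/-- The horizontal lift to `u` of a tangent vector `X` of `M`: the horizontal vector over `X`. -/
def lift (u : P) (X : TangentSpace 𝓘(ℝ, EM) (B.proj u)) : TangentSpace 𝓘(ℝ, EP) u :=
  Classical.epsilon fun w ↦ w ∈ c.horizontal u ∧ mfderiv 𝓘(ℝ, EP) 𝓘(ℝ, EM) B.proj u w = X

/-- The curvature form `Ω = dω ∘ (hor × hor)` at `u`, as a 2-form on the tangent space of `M` with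
values in the Lie algebra of `G`. -/
def curvature (u : P) (X Y : TangentSpace 𝓘(ℝ, EM) (B.proj u)) : GroupLieAlgebra 𝓘(ℂ, EG) G :=
  extDerivOneForm 𝓘(ℝ, EP) (W := EG) (fun v w ↦ c.form v w) u (c.lift u X) (c.lift u Y)

variable (F) in
/-- The connection induced on `P ×_G F`: the horizontal space at the class of `(u, f)` is the image
of the horizontal space at `u` under the differential of `v ↦ [v, f]`. -/
def assocHorizontal [ContMDiffSMul 𝓘(ℂ, EG) 𝓘(ℂ, EF) ω G F]
    (z : Bundle.TotalSpace F (B.assoc F EF).Fiber) :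
    Submodule ℝ (TangentSpace (𝓘(ℝ, EM).prod 𝓘(ℝ, EF)) z) :=
  (c.horizontal (B.pt z.1)).map
    (mfderiv 𝓘(ℝ, EP) (𝓘(ℝ, EM).prod 𝓘(ℝ, EF)) (fun u ↦ B.cls (F := F) (EF := EF) u z.2)
      (B.pt z.1) : TangentSpace 𝓘(ℝ, EP) (B.pt z.1) →L[ℝ] EM × EF).toLinearMap

end Connection

end PrincipalBundle
end Principal

/-! ### Homogeneous complex submanifolds of Grassmannians -/

section Grassmannian

/-- The Grassmannian of `r`-dimensional subspaces of `ℂ^m`. -/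
abbrev Grassmannian (r m : ℕ) : Type :=
  {W : Submodule ℂ (Fin m → ℂ) // Module.finrank ℂ W = r}

variable (m r : ℕ)
  (EG : Type*) [NormedAddCommGroup EG] [NormedSpace ℂ EG]
  (G : Type*) [TopologicalSpace G] [ChartedSpace EG G] [Group G]
  (EF : Type*) [NormedAddCommGroup EF] [NormedSpace ℂ EF]
  (F : Type*) [TopologicalSpace F] [ChartedSpace EF F] [MulAction G F]

/-- `G` is a complex Lie subgroup of `GL(m, ℂ)`: its inclusion is an injective homomorphism which is
a holomorphic immersion. (Immersed at `1` means immersed everywhere, by translation.) -/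
structure LieSubgroupGL where
  /-- The inclusion of `G`; its values are automatically invertible. -/
  rep : G →* ((Fin m → ℂ) →L[ℂ] (Fin m → ℂ))
  injective : Function.Injective rep
  contMDiff_rep : ContMDiff 𝓘(ℂ, EG) 𝓘(ℂ, (Fin m → ℂ) →L[ℂ] (Fin m → ℂ)) ω rep
  injective_mfderiv : Function.Injective
    (mfderiv 𝓘(ℂ, EG) 𝓘(ℂ, (Fin m → ℂ) →L[ℂ] (Fin m → ℂ)) rep 1)

variable {m r EG G EF F}

variable (EF) in
/-- A map `s` from a complex manifold to the Grassmannian is a holomorphic immersion at `f₀`: for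
a complement `W` of `s f₀`, in the standard affine chart of the Grassmannian which sends the graph
of a linear map `s f₀ → W` to this linear map, `s` is a holomorphic immersion at `f₀`. -/
def IsHolomorphicImmersionAt (s : F → Grassmannian r m) (f₀ : F) : Prop :=
  ∃ W : Submodule ℂ (Fin m → ℂ), IsCompl (s f₀).1 W ∧
    ∃ A : F → ((s f₀).1 →L[ℂ] W),
      (∀ᶠ f in nhds f₀, (s f).1 =
        LinearMap.range ((s f₀).1.subtype + W.subtype ∘ₗ (A f).toLinearMap)) ∧
      ContMDiffAt 𝓘(ℂ, EF) 𝓘(ℂ, (s f₀).1 →L[ℂ] W) ω A f₀ ∧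
      Function.Injective (mfderiv 𝓘(ℂ, EF) 𝓘(ℂ, (s f₀).1 →L[ℂ] W) A f₀)

variable (EF F) in
/-- `F` is a complex submanifold of the Grassmannian on which the complex Lie subgroup `G` of
`GL(m, ℂ)` acts transitively, through the canonical action of `GL(m, ℂ)` on the Grassmannian. -/
structure HomogeneousSubmanifold (r : ℕ) (L : LieSubgroupGL m EG G) where
  /-- The inclusion of `F` in the Grassmannian. -/
  sub : F → Grassmannian r m
  injective : Function.Injective sub
  immersion : ∀ f, IsHolomorphicImmersionAt EF sub f
  sub_smul : ∀ (g : G) (f : F), (sub (g • f)).1 = (sub f).1.map (L.rep g).toLinearMap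
  transitive : ∀ f f' : F, ∃ g : G, g • f = f'

end Grassmannian

/-! ### Curvature and torsion -/

section Tensors

variable {EM : Type*} [NormedAddCommGroup EM] [NormedSpace ℝ EM]
  {M : Type*} [TopologicalSpace M] [ChartedSpace EM M] [IsManifold 𝓘(ℝ, EM) ∞ M]
  {EP : Type*} [NormedAddCommGroup EP] [NormedSpace ℝ EP]
  {P : Type*} [TopologicalSpace P] [ChartedSpace EP P] [IsManifold 𝓘(ℝ, EP) ∞ P]
  {EG : Type*} [NormedAddCommGroup EG] [NormedSpace ℂ EG]
  {G : Type*} [TopologicalSpace G] [ChartedSpace EG G] [Group G] {m : ℕ}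

/-- An inclusion of a principal bundle, whose structure group is a subgroup of `GL(m, ℂ)`, in the
bundle of complex frames of the complexified tangent bundle of `M`. -/
structure FrameInclusion (B : PrincipalBundle EM M EP P EG G) (L : LieSubgroupGL m EG G) where
  /-- The points of `P` are complex frames. -/
  frame : (u : P) → (Fin m → ℂ) ≃ₗ[ℂ] TangentSpaceC 𝓘(ℝ, EM) (B.proj u)
  frame_act : ∀ (u : P) (g : G) (ξ : Fin m → ℂ), frame (B.act u g) ξ = frame u (L.rep g ξ)
  smooth_re : ∀ ξ, ContMDiff 𝓘(ℝ, EP) 𝓘(ℝ, EM).tangent ∞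
    (fun u ↦ (⟨B.proj u, reC _ (frame u ξ)⟩ : TangentBundle 𝓘(ℝ, EM) M))
  smooth_im : ∀ ξ, ContMDiff 𝓘(ℝ, EP) 𝓘(ℝ, EM).tangent ∞
    (fun u ↦ (⟨B.proj u, imC _ (frame u ξ)⟩ : TangentBundle 𝓘(ℝ, EM) M))

variable {B : PrincipalBundle EM M EP P EG G} {L : LieSubgroupGL m EG G}

/-- The curvature of a connection at `x`, complex-bilinearly extended, as a 2-form whose values are
endomorphisms of the fibre at `x` of the associated vector bundle `P ×_G ℂ^m`, which is
identified with `ℂ^m` by means of the point `B.pt x` of `P`. -/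
def curvatureAt (L : LieSubgroupGL m EG G) (c : B.Connection) (x : M)
    (X Y : TangentSpaceC 𝓘(ℝ, EM) x) : (Fin m → ℂ) →L[ℂ] (Fin m → ℂ) :=
  complexBilin (W := (Fin m → ℂ) →L[ℂ] (Fin m → ℂ))
    (fun v w : TangentSpace 𝓘(ℝ, EM) x ↦
      mfderiv 𝓘(ℂ, EG) 𝓘(ℂ, (Fin m → ℂ) →L[ℂ] (Fin m → ℂ)) L.rep 1 (c.curvature (B.pt x) v w)) X Y

namespace FrameInclusion

variable (e : FrameInclusion B L)

/-- The frame of the complexified tangent space at `x` given by the point `B.pt x` of `P`. -/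
def frameAt (x : M) : (Fin m → ℂ) ≃ₗ[ℂ] TangentSpaceC 𝓘(ℝ, EM) x := e.frame (B.pt x)

/-- The canonical (soldering) form `θ`. -/
def canonicalForm (u : P) (w : TangentSpace 𝓘(ℝ, EP) u) : Fin m → ℂ :=
  (e.frame u).symm ((1 : ℂ) ⊗ₜ[ℝ] mfderiv 𝓘(ℝ, EP) 𝓘(ℝ, EM) B.proj u w)

/-- The torsion form `Θ = dθ ∘ (hor × hor)` at `u`, as a 2-form on the tangent space of `M`. -/
def torsionForm (c : B.Connection) (u : P) (X Y : TangentSpace 𝓘(ℝ, EM) (B.proj u)) : Fin m → ℂ :=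
  extDerivOneForm 𝓘(ℝ, EP) e.canonicalForm u (c.lift u X) (c.lift u Y)

/-- The torsion tensor of a connection, complex-bilinearly extended. -/
def torsion (c : B.Connection) (x : M) (X Y : TangentSpaceC 𝓘(ℝ, EM) x) :
    TangentSpaceC 𝓘(ℝ, EM) x :=
  e.frameAt x (complexBilin
    (fun v w : TangentSpace 𝓘(ℝ, EM) x ↦ e.torsionForm c (B.pt x) v w) X Y)

/-- The curvature of a connection as an endomorphism of the complexified tangent space. -/
def curvature (c : B.Connection) (x : M) (X Y Z : TangentSpaceC 𝓘(ℝ, EM) x) :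
    TangentSpaceC 𝓘(ℝ, EM) x :=
  e.frameAt x (curvatureAt L c x X Y ((e.frameAt x).symm Z))

end FrameInclusion

end Tensors

/-! ### The bundle `Q` and its complex distributions -/

section Twistor

variable {EM : Type*} [NormedAddCommGroup EM] [NormedSpace ℝ EM]
  {M : Type*} [TopologicalSpace M] [ChartedSpace EM M] [IsManifold 𝓘(ℝ, EM) ∞ M]
  {EP₁ : Type*} [NormedAddCommGroup EP₁] [NormedSpace ℝ EP₁]
  {P₁ : Type*} [TopologicalSpace P₁] [ChartedSpace EP₁ P₁] [IsManifold 𝓘(ℝ, EP₁) ∞ P₁]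
  {EG₁ : Type*} [NormedAddCommGroup EG₁] [NormedSpace ℂ EG₁]
  {G₁ : Type*} [TopologicalSpace G₁] [ChartedSpace EG₁ G₁] [Group G₁]
  {EF₁ : Type*} [NormedAddCommGroup EF₁] [NormedSpace ℂ EF₁]
  {F₁ : Type*} [TopologicalSpace F₁] [ChartedSpace EF₁ F₁] [MulAction G₁ F₁]
  [ContMDiffSMul 𝓘(ℂ, EG₁) 𝓘(ℂ, EF₁) ω G₁ F₁]
  {EP₂ : Type*} [NormedAddCommGroup EP₂] [NormedSpace ℝ EP₂]
  {P₂ : Type*} [TopologicalSpace P₂] [ChartedSpace EP₂ P₂] [IsManifold 𝓘(ℝ, EP₂) ∞ P₂]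
  {EG₂ : Type*} [NormedAddCommGroup EG₂] [NormedSpace ℂ EG₂]
  {G₂ : Type*} [TopologicalSpace G₂] [ChartedSpace EG₂ G₂] [Group G₂]
  {EF₂ : Type*} [NormedAddCommGroup EF₂] [NormedSpace ℂ EF₂]
  {F₂ : Type*} [TopologicalSpace F₂] [ChartedSpace EF₂ F₂] [MulAction G₂ F₂]
  [ContMDiffSMul 𝓘(ℂ, EG₂) 𝓘(ℂ, EF₂) ω G₂ F₂]
  {m₁ r₁ m₂ r₂ : ℕ}
  {B₁ : PrincipalBundle EM M EP₁ P₁ EG₁ G₁} {B₂ : PrincipalBundle EM M EP₂ P₂ EG₂ G₂}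
  {L₁ : LieSubgroupGL m₁ EG₁ G₁} {L₂ : LieSubgroupGL m₂ EG₂ G₂}

variable (EF₁ F₁ EF₂ F₂ B₁ B₂) in
/-- The fibre product `Q` over `M` of `Q₁ = P₁ ×_{G₁} F₁` and `Q₂ = P₂ ×_{G₂} F₂`. A point of `Q`
over `x` is a pair `(f₁, f₂)`, representing the pair of classes of `(B₁.pt x, f₁)` and
`(B₂.pt x, f₂)`. -/
abbrev TwistorBundle : Type _ :=
  Bundle.TotalSpace (F₁ × F₂) (prodCore (B₁.assoc F₁ EF₁) (B₂.assoc F₂ EF₂)).Fiber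

variable (EM EF₁ EF₂) in
/-- The real model of `Q`. -/
abbrev modelQ := 𝓘(ℝ, EM).prod (𝓘(ℝ, EF₁).prod 𝓘(ℝ, EF₂))

namespace TwistorBundle

/-- The projection `Q → M`. -/
def proj (z : TwistorBundle EF₁ F₁ EF₂ F₂ B₁ B₂) : M := z.1

/-- The projection `Q → Q₁`. -/
def toQ₁ (z : TwistorBundle EF₁ F₁ EF₂ F₂ B₁ B₂) :
    Bundle.TotalSpace F₁ (B₁.assoc F₁ EF₁).Fiber := ⟨z.1, z.2.1⟩

/-- The projection `Q → Q₂`. -/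
def toQ₂ (z : TwistorBundle EF₁ F₁ EF₂ F₂ B₁ B₂) :
    Bundle.TotalSpace F₂ (B₂.assoc F₂ EF₂).Fiber := ⟨z.1, z.2.2⟩

/-- The point of `F₁ × F₂` which represents `z` in the fibre over `z.proj`. -/
def fibrePoint (z : TwistorBundle EF₁ F₁ EF₂ F₂ B₁ B₂) : F₁ × F₂ := z.2

/-- The inclusion of the fibre of `Q` over `x`. -/
def fibreInclusion (x : M) (f : F₁ × F₂) : TwistorBundle EF₁ F₁ EF₂ F₂ B₁ B₂ := ⟨x, f⟩

/-- The first component of `(p, q) ∈ Q`, as a subspace of the complexified tangent space of `M`. -/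
def p (e : FrameInclusion B₁ L₁) (S₁ : HomogeneousSubmanifold EF₁ F₁ r₁ L₁)
    (z : TwistorBundle EF₁ F₁ EF₂ F₂ B₁ B₂) : Submodule ℂ (TangentSpaceC 𝓘(ℝ, EM) z.proj) :=
  (S₁.sub z.fibrePoint.1).1.map (e.frameAt z.proj).toLinearMap

/-- The second component of `(p, q) ∈ Q`, as a subspace of the fibre of `P₂ ×_{G₂} ℂ^m₂`, which is
identified with `ℂ^m₂` by means of the point `B₂.pt x` of `P₂`. -/
def q (S₂ : HomogeneousSubmanifold EF₂ F₂ r₂ L₂) (z : TwistorBundle EF₁ F₁ EF₂ F₂ B₁ B₂) :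
    Submodule ℂ (Fin m₂ → ℂ) :=
  (S₂.sub z.fibrePoint.2).1

/-- The horizontal space of the connection on `Q` induced by the two connections. -/
def horizontal (c₁ : B₁.Connection) (c₂ : B₂.Connection)
    (z : TwistorBundle EF₁ F₁ EF₂ F₂ B₁ B₂) :
    Submodule ℝ (TangentSpace (modelQ EM EF₁ EF₂) z) :=
  (c₁.assocHorizontal F₁ z.toQ₁).comap
      (mfderiv (modelQ EM EF₁ EF₂) (𝓘(ℝ, EM).prod 𝓘(ℝ, EF₁)) toQ₁ z).toLinearMap ⊓
    (c₂.assocHorizontal F₂ z.toQ₂).comap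
      (mfderiv (modelQ EM EF₁ EF₂) (𝓘(ℝ, EM).prod 𝓘(ℝ, EF₂)) toQ₂ z).toLinearMap

/-- The distribution `𝒢₀`: the complex horizontal vectors at `(p, q)` which are projected to `p`. -/
def G0 (c₁ : B₁.Connection) (c₂ : B₂.Connection) (e : FrameInclusion B₁ L₁)
    (S₁ : HomogeneousSubmanifold EF₁ F₁ r₁ L₁) (z : TwistorBundle EF₁ F₁ EF₂ F₂ B₁ B₂) :
    Submodule ℂ (TangentSpaceC (modelQ EM EF₁ EF₂) z) :=
  (z.horizontal c₁ c₂).baseChange ℂ ⊓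
    (z.p e S₁).comap
      ((mfderiv (modelQ EM EF₁ EF₂) 𝓘(ℝ, EM) proj z).toLinearMap.baseChange ℂ)

/-- The complexified differential of the inclusion of the fibre through `z`. -/
def verticalMap (z : TwistorBundle EF₁ F₁ EF₂ F₂ B₁ B₂) :
    ℂ ⊗[ℝ] (EF₁ × EF₂) →ₗ[ℂ] TangentSpaceC (modelQ EM EF₁ EF₂) z :=
  (mfderiv (𝓘(ℝ, EF₁).prod 𝓘(ℝ, EF₂)) (modelQ EM EF₁ EF₂) (fibreInclusion z.proj) z.fibrePoint :
    EF₁ × EF₂ →L[ℝ] TangentSpace (modelQ EM EF₁ EF₂) z).toLinearMap.baseChange ℂ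

/-- `(ker dπ)^{1,0}`, for the complex structure of the fibres of `Q`. -/
def vertical10 (z : TwistorBundle EF₁ F₁ EF₂ F₂ B₁ B₂) :
    Submodule ℂ (TangentSpaceC (modelQ EM EF₁ EF₂) z) :=
  (vectors10 (EF₁ × EF₂)).map z.verticalMap

/-- `(ker dπ)^{0,1}`, for the complex structure of the fibres of `Q`. -/
def vertical01 (z : TwistorBundle EF₁ F₁ EF₂ F₂ B₁ B₂) :
    Submodule ℂ (TangentSpaceC (modelQ EM EF₁ EF₂) z) :=
  (vectors01 (EF₁ × EF₂)).map z.verticalMap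

/-- The distribution `𝒢 = 𝒢₀ ⊕ (ker dπ)^{0,1}`. -/
def distG (c₁ : B₁.Connection) (c₂ : B₂.Connection) (e : FrameInclusion B₁ L₁)
    (S₁ : HomogeneousSubmanifold EF₁ F₁ r₁ L₁) (z : TwistorBundle EF₁ F₁ EF₂ F₂ B₁ B₂) :
    Submodule ℂ (TangentSpaceC (modelQ EM EF₁ EF₂) z) :=
  z.G0 c₁ c₂ e S₁ ⊔ z.vertical01

/-- The distribution `𝒢' = 𝒢₀ ⊕ (ker dπ)^{1,0}`. -/
def distG' (c₁ : B₁.Connection) (c₂ : B₂.Connection) (e : FrameInclusion B₁ L₁)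
    (S₁ : HomogeneousSubmanifold EF₁ F₁ r₁ L₁) (z : TwistorBundle EF₁ F₁ EF₂ F₂ B₁ B₂) :
    Submodule ℂ (TangentSpaceC (modelQ EM EF₁ EF₂) z) :=
  z.G0 c₁ c₂ e S₁ ⊔ z.vertical10

end TwistorBundle

end Twistor

end Bundles

/-! Both distributions are kernels of complexified 1-forms, and their integrability is tested by the
exterior derivative of such a form. Let `α` be a 1-form with values in a vector space `K` with
complex structure `J`, and let `D` be the space of complex vectors `a + i b` with `α a + J (α b) =
0`. Extending `α` and `dα` to complex vectors by means of `J`, sections `X`, `Y` of `D` satisfy `α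
[X, Y] = -dα (X, Y)` (`form_lieBracket`). Thus `D` is integrable if `dα` vanishes on pairs of
vectors of `D`. Conversely, at a point where the extended `α` is onto, every vector of `D` extends
to a local section (`exists_smooth_section`), so integrability forces `dα` to vanish on `D` there.

On `Q`, local sections of `P₁` and `P₂` and charts give coordinates `(x, y₁, y₂)`. Let `A₁`, `A₂` be
the pulled-back connection forms, `θ` the pulled-back canonical form, and `a₁`, `a₂` the
infinitesimal actions of the groups on `F₁`, `F₂`. An affine chart of the Grassmannian yields linear
maps `D (y₁)`, depending smoothly on `y₁`, whose kernels are the subspaces given by the points of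
`F₁` (`DefiningMap`). Then `α = (D (y₁) θ, dy₁ + a₁ A₁, dy₂ + a₂ A₂)` defines both distributions:
only `J = (i, ε, ε)` differs, with `ε = i` for `𝒢` and `ε = -i` for `𝒢'`
(`mem_sup_map_verticalMap_iff`).

The test is pointwise, so for each point of `Q` the sections may be chosen horizontal over its
projection, which makes `A₁` and `A₂` vanish there (`exists_triv_horizontal`). At that point `dθ`
and `dA₁`, `dA₂` are the torsion and curvature forms (`torsionForm_pt`, `curvature_pt`), and `dα =
(D dθ + dD ∧ θ, a₁ dA₁, a₂ dA₂)` (`dForm_modelForm`).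

For `ε = i`, vectors of the kernel have vertical parts of type `(0,1)`, which the complex linear
`dD` kills. What remains is `D (T (X, Y)) = 0`, that is `T (X, Y) ∈ p`, together with the vanishing
of the infinitesimal actions of the curvatures. Differentiating `D (g f) (g ξ) = 0` at `g = 1`, and
using that `F` is immersed in the Grassmannian, shows that `η` acts trivially at a point exactly
when it preserves the corresponding subspace (`infAct_eq_zero_iff`). This is condition (ii).

For `ε = -i`, a vertical vector `w` of type `(1,0)` paired with a horizontal `ξ ∈ p` leaves the term
`2 i dD (w) ξ`. If it vanishes for all `ξ ∈ p`, the immersion property gives `w = 0`; so `𝒢'` is not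
integrable when `F₁` has positive dimension. -/

/-! ### Kernels of complexified 1-forms on a vector space -/

section ComplexOneForms

variable {E K : Type*} [NormedAddCommGroup E] [NormedSpace ℝ E]
  [NormedAddCommGroup K] [NormedSpace ℝ K]

/-- The exterior derivative of a `K`-valued 1-form on a vector space. -/
noncomputable def dForm (α : E → E →L[ℝ] K) (y v w : E) : K := fderiv ℝ α y v w - fderiv ℝ α y w v

/-- If the complex fields `a + i b` and `c + i d` lie in the kernel of `α`, extended complex
linearly for the complex structure `J` of `K`, then `α` of their bracket is `- dα`. -/
theorem form_lieBracket {α : E → E →L[ℝ] K} {J : K →L[ℝ] K} (hJ : ∀ k, J (J k) = -k)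
    {a b c d : E → E} {y : E} (hα : DifferentiableAt ℝ α y)
    (ha : DifferentiableAt ℝ a y) (hb : DifferentiableAt ℝ b y)
    (hc : DifferentiableAt ℝ c y) (hd : DifferentiableAt ℝ d y)
    (hab : ∀ᶠ y' in nhds y, α y' (a y') + J (α y' (b y')) = 0)
    (hcd : ∀ᶠ y' in nhds y, α y' (c y') + J (α y' (d y')) = 0) :
    α y (VectorField.lieBracket ℝ a c y - VectorField.lieBracket ℝ b d y) +
        J (α y (VectorField.lieBracket ℝ a d y + VectorField.lieBracket ℝ b c y)) =
      -((dForm α y (a y) (c y) - dForm α y (b y) (d y)) +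
        J (dForm α y (a y) (d y) + dForm α y (b y) (c y))) := by
  -- The Leibniz rule applied to the identity `α a + J (α b) = 0`, which holds near `y`: derivatives
  -- of the field are traded for derivatives of `α`.
  have key : ∀ {a b : E → E}, DifferentiableAt ℝ a y → DifferentiableAt ℝ b y →
      (∀ᶠ y' in nhds y, α y' (a y') + J (α y' (b y')) = 0) → ∀ v,
      α y (fderiv ℝ a y v) + J (α y (fderiv ℝ b y v)) =
        -(fderiv ℝ α y v (a y) + J (fderiv ℝ α y v (b y))) := by
    intro a b ha hb hab v
    have h1 := (hα.hasFDerivAt.clm_apply ha.hasFDerivAt).add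
      (J.hasFDerivAt.comp y (hα.hasFDerivAt.clm_apply hb.hasFDerivAt))
    have h2 : HasFDerivAt (fun y' ↦ α y' (a y') + J (α y' (b y'))) (0 : E →L[ℝ] K) y :=
      (hasFDerivAt_const (0 : K) y).congr_of_eventuallyEq hab
    have h3 := congrArg (fun l : E →L[ℝ] K ↦ l v) (h1.unique h2)
    simp at h3
    rw [← sub_eq_zero, ← h3]
    abel
  have h1 := key hc hd hcd (a y)
  have h2 := key hc hd hcd (b y)
  have h3 := key ha hb hab (c y)
  have h4 := key ha hb hab (d y)
  -- The desired identity is `h1 + J h2 - h3 - J h4`; `J² = -1` produces the signs of the terms with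
  -- two imaginary parts.
  have h2' := congrArg J h2
  have h4' := congrArg J h4
  simp only [map_add, map_neg, hJ] at h2' h4'
  simp only [VectorField.lieBracket, map_sub, map_add, dForm]
  rw [← sub_eq_zero] at h1 h2' h3 h4' ⊢
  have h5 : (0 : K) = 0 + 0 - 0 - 0 := by simp
  rw [h5]
  nth_rewrite 1 [← h1]
  nth_rewrite 1 [← h2']
  nth_rewrite 1 [← h3]
  nth_rewrite 1 [← h4']
  abel

/-- A vector in the kernel of a complexified 1-form, surjective at a point, extends to a smooth
field with values in the kernel. -/
theorem exists_smooth_section [FiniteDimensional ℝ E] [FiniteDimensional ℝ K]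
    {α : E → E →L[ℝ] K} {J : K →L[ℝ] K}
    {U : Set E} (hU : IsOpen U) (hα : ContDiffOn ℝ ∞ α U) {y : E} (hy : y ∈ U)
    (hsurj : ∀ k, ∃ a b, α y a + J (α y b) = k) {a₀ b₀ : E} (h₀ : α y a₀ + J (α y b₀) = 0) :
    ∃ U' ⊆ U, IsOpen U' ∧ y ∈ U' ∧ ∃ a b : E → E, ContDiffOn ℝ ∞ a U' ∧ ContDiffOn ℝ ∞ b U' ∧
      a y = a₀ ∧ b y = b₀ ∧ ∀ y' ∈ U', α y' (a y') + J (α y' (b y')) = 0 := by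
  have : CompleteSpace K := FiniteDimensional.complete ℝ K
  let Φ (y : E) : E × E →L[ℝ] K :=
    (α y).comp (ContinuousLinearMap.fst ℝ E E) + J.comp ((α y).comp (ContinuousLinearMap.snd ℝ E E))
  have hΦ : ContDiffOn ℝ ∞ Φ U :=
    (hα.clm_comp contDiffOn_const).add (contDiffOn_const.clm_comp (hα.clm_comp contDiffOn_const))
  have hΦs : (Φ y).range = ⊤ := by
    rw [LinearMap.range_eq_top]
    intro k
    obtain ⟨a, b, h⟩ := hsurj k
    exact ⟨(a, b), by simpa [Φ] using h⟩
  -- With a right inverse `R` of `Φ y` fixed, `Φ z ∘ R` is the identity for `z = y`, hence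
  -- invertible for `z` near `y`, and `R` followed by nothing but this inverse corrects to a right
  -- inverse of `Φ z`.
  obtain ⟨R, hR⟩ := (Φ y).exists_rightInverse_of_surjective hΦs
  let Θ (y : E) : K →L[ℝ] K := (Φ y).comp R
  have hΘ : ContDiffOn ℝ ∞ Θ U := hΦ.clm_comp contDiffOn_const
  have hΘ1 : Θ y = 1 := hR
  let U' : Set E := U ∩ Θ ⁻¹' {l | IsUnit l}
  have hU' : IsOpen U' := hΘ.continuousOn.isOpen_inter_preimage hU Units.isOpen
  have hinv : ContDiffOn ℝ ∞ (fun y ↦ Ring.inverse (Θ y)) U' := by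
    intro z hz
    obtain ⟨u, hu⟩ := hz.2
    have h1 := contDiffAt_ringInverse (n := ∞) ℝ u
    rw [hu] at h1
    exact h1.comp_contDiffWithinAt z ((hΘ z hz.1).mono inter_subset_left)
  -- The constant field minus its component along the corrected right inverse: it lies in the kernel
  -- wherever `Θ` is invertible, and the correction vanishes at `y` because `(a₀, b₀)` is already in
  -- the kernel there.
  let s (y : E) : E × E := (a₀, b₀) - R (Ring.inverse (Θ y) (Φ y (a₀, b₀)))
  have hs : ContDiffOn ℝ ∞ s U' :=
    contDiffOn_const.sub (R.contDiff.comp_contDiffOn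
      (hinv.clm_apply ((hΦ.mono inter_subset_left).clm_apply contDiffOn_const)))
  have hsy : s y = (a₀, b₀) := by
    have : Φ y (a₀, b₀) = 0 := by simpa [Φ] using h₀
    simp [s, this]
  refine ⟨U', inter_subset_left, hU', ⟨hy, ?_⟩, fun y ↦ (s y).1, fun y ↦ (s y).2,
    hs.fst, hs.snd, congrArg Prod.fst hsy, congrArg Prod.snd hsy, fun z hz ↦ ?_⟩
  · simp [hΘ1]
  · change Φ z (s z) = 0
    have h1 : Θ z * Ring.inverse (Θ z) = 1 := Ring.mul_inverse_cancel _ hz.2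
    have h2 := congrArg (fun l : K →L[ℝ] K ↦ l (Φ z (a₀, b₀))) h1
    change Φ z (R (Ring.inverse (Θ z) (Φ z (a₀, b₀)))) = Φ z (a₀, b₀) at h2
    simp only [s, map_sub, h2, sub_self]

end ComplexOneForms

/-! ### Complexifications -/

section Complexify

variable {E E' : Type*} [AddCommGroup E] [Module ℝ E] [AddCommGroup E'] [Module ℝ E']

@[simp] theorem reC_tmul (z : ℂ) (v : E) : reC E (z ⊗ₜ v) = z.re • v := by simp [reC]

@[simp] theorem imC_tmul (z : ℂ) (v : E) : imC E (z ⊗ₜ v) = z.im • v := by simp [imC]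

theorem reC_mk (a b : E) : reC E ((1 : ℂ) ⊗ₜ[ℝ] a + Complex.I ⊗ₜ[ℝ] b) = a := by simp

theorem imC_mk (a b : E) : imC E ((1 : ℂ) ⊗ₜ[ℝ] a + Complex.I ⊗ₜ[ℝ] b) = b := by simp

theorem eq_reC_add_imC (X : ℂ ⊗[ℝ] E) :
    X = (1 : ℂ) ⊗ₜ[ℝ] reC E X + Complex.I ⊗ₜ[ℝ] imC E X := by
  induction X using TensorProduct.induction_on with
  | zero => simp
  | tmul z v =>
    rw [reC_tmul, imC_tmul, TensorProduct.tmul_smul, TensorProduct.tmul_smul,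
      TensorProduct.smul_tmul', TensorProduct.smul_tmul', ← TensorProduct.add_tmul]
    congr 1
    simp
  | add x y hx hy =>
    conv_lhs => rw [hx, hy]
    simp only [map_add, TensorProduct.tmul_add]
    abel

theorem ext_reC_imC {X Y : ℂ ⊗[ℝ] E} (h : reC E X = reC E Y) (h' : imC E X = imC E Y) : X = Y := by
  rw [eq_reC_add_imC X, eq_reC_add_imC Y, h, h']

theorem reC_smul (z : ℂ) (X : ℂ ⊗[ℝ] E) : reC E (z • X) = z.re • reC E X - z.im • imC E X := by
  induction X using TensorProduct.induction_on with
  | zero => simp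
  | tmul w v => simp [TensorProduct.smul_tmul', smul_smul, sub_smul]
  | add x y hx hy => simp only [smul_add, map_add, hx, hy]; abel

theorem imC_smul (z : ℂ) (X : ℂ ⊗[ℝ] E) : imC E (z • X) = z.re • imC E X + z.im • reC E X := by
  induction X using TensorProduct.induction_on with
  | zero => simp
  | tmul w v => simp [TensorProduct.smul_tmul', smul_smul, add_smul]
  | add x y hx hy => simp only [smul_add, map_add, hx, hy]; abel

@[simp] theorem reC_baseChange (f : E →ₗ[ℝ] E') (X : ℂ ⊗[ℝ] E) :
    reC E' (f.baseChange ℂ X) = f (reC E X) := by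
  induction X using TensorProduct.induction_on with
  | zero => simp
  | tmul z v => simp
  | add x y hx hy => simp [hx, hy]

@[simp] theorem imC_baseChange (f : E →ₗ[ℝ] E') (X : ℂ ⊗[ℝ] E) :
    imC E' (f.baseChange ℂ X) = f (imC E X) := by
  induction X using TensorProduct.induction_on with
  | zero => simp
  | tmul z v => simp
  | add x y hx hy => simp [hx, hy]

theorem mem_baseChange_iff (S : Submodule ℝ E) (X : ℂ ⊗[ℝ] E) :
    X ∈ S.baseChange ℂ ↔ reC E X ∈ S ∧ imC E X ∈ S := by
  constructor
  · intro h
    rw [Submodule.baseChange_eq_span] at h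
    induction h using Submodule.span_induction with
    | mem x hx =>
      obtain ⟨v, hv, rfl⟩ := hx
      simpa using hv
    | zero => simp
    | add x y _ _ hx hy => exact ⟨by simpa using add_mem hx.1 hy.1, by simpa using add_mem hx.2 hy.2⟩
    | smul z x _ hx =>
      rw [reC_smul, imC_smul]
      exact ⟨sub_mem (S.smul_mem _ hx.1) (S.smul_mem _ hx.2),
        add_mem (S.smul_mem _ hx.2) (S.smul_mem _ hx.1)⟩
  · rintro ⟨h1, h2⟩
    rw [eq_reC_add_imC X]
    exact add_mem (Submodule.tmul_mem_baseChange_of_mem _ h1)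
      (Submodule.tmul_mem_baseChange_of_mem _ h2)

theorem mem_vectors01_iff {E : Type*} [AddCommGroup E] [Module ℂ E] [Module ℝ E]
    [IsScalarTower ℝ ℂ E] (X : ℂ ⊗[ℝ] E) :
    X ∈ vectors01 E ↔ reC E X + Complex.I • imC E X = 0 := by
  rw [vectors01, Module.End.mem_eigenspace_iff]
  constructor
  -- The real part of the eigenvalue equation reads `i Re X = Im X`; multiplication by `-i` gives
  -- the claim, so the imaginary part is not needed.
  · intro h
    have h1 := congrArg (reC E) h
    simp [mulI, reC_smul] at h1
    have := congrArg (fun v ↦ -Complex.I • v) h1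
    simp [smul_smul] at this
    rw [this]; simp
  · intro h
    have h1 : reC E X = -(Complex.I • imC E X) := eq_neg_of_add_eq_zero_left h
    apply ext_reC_imC <;> simp [mulI, h1, smul_smul, reC_smul, imC_smul]

theorem mem_vectors10_iff {E : Type*} [AddCommGroup E] [Module ℂ E] [Module ℝ E]
    [IsScalarTower ℝ ℂ E] (X : ℂ ⊗[ℝ] E) :
    X ∈ vectors10 E ↔ reC E X - Complex.I • imC E X = 0 := by
  rw [vectors10, Module.End.mem_eigenspace_iff]
  constructor
  · intro h
    have h1 := congrArg (reC E) h
    simp [mulI, reC_smul] at h1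
    have := congrArg (fun v ↦ -Complex.I • v) h1
    simp [smul_smul] at this
    rw [this]; simp
  · intro h
    have h1 : reC E X = Complex.I • imC E X := sub_eq_zero.1 h
    apply ext_reC_imC <;> simp [mulI, h1, smul_smul, reC_smul, imC_smul]

end Complexify

/-! ### Derivatives of maps between manifolds, as maps of the model spaces -/

section Derivatives

variable {E : Type*} [NormedAddCommGroup E] [NormedSpace ℝ E]
  {H : Type*} [TopologicalSpace H] (I : ModelWithCorners ℝ E H)
  {N : Type*} [TopologicalSpace N] [ChartedSpace H N]
  {E' : Type*} [NormedAddCommGroup E'] [NormedSpace ℝ E']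
  {H' : Type*} [TopologicalSpace H'] (I' : ModelWithCorners ℝ E' H')
  {N' : Type*} [TopologicalSpace N'] [ChartedSpace H' N']
  {E'' : Type*} [NormedAddCommGroup E''] [NormedSpace ℝ E'']
  {H'' : Type*} [TopologicalSpace H''] (I'' : ModelWithCorners ℝ E'' H'')
  {N'' : Type*} [TopologicalSpace N''] [ChartedSpace H'' N'']

/-- The derivative of a map between manifolds, as a linear map of the model spaces. -/
noncomputable def mD (f : N → N') (x : N) : E →L[ℝ] E' := mfderiv I I' f x

variable {I I' I''}

theorem mD_comp {g : N' → N''} {f : N → N'} {x : N} (hg : MDifferentiableAt I' I'' g (f x))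
    (hf : MDifferentiableAt I I' f x) :
    mD I I'' (fun x ↦ g (f x)) x = (mD I' I'' g (f x)).comp (mD I I' f x) :=
  mfderiv_comp x hg hf

theorem mD_comp_apply {g : N' → N''} {f : N → N'} {x : N} {y : N'} (hy : f x = y)
    (hg : MDifferentiableAt I' I'' g y) (hf : MDifferentiableAt I I' f x) (v : E) :
    mD I I'' (fun x ↦ g (f x)) x v = mD I' I'' g y (mD I I' f x v) := by
  subst hy
  rw [mD_comp hg hf]
  rfl

theorem mD_congr {f g : N → N'} {x : N} (h : f =ᶠ[nhds x] g) : mD I I' f x = mD I I' g x :=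
  h.mfderiv_eq

theorem mD_id (x : N) : mD I I (fun x : N ↦ x) x = ContinuousLinearMap.id ℝ E :=
  mfderiv_id

theorem mD_const (c : N') (x : N) : mD I I' (fun _ : N ↦ c) x = 0 :=
  mfderiv_const

theorem mD_eq_fderiv (f : E → E') (x : E) : mD 𝓘(ℝ, E) 𝓘(ℝ, E') f x = fderiv ℝ f x :=
  mfderiv_eq_fderiv

theorem mD_prodMk {f : N → N'} {g : N → N''} {x : N} (hf : MDifferentiableAt I I' f x)
    (hg : MDifferentiableAt I I'' g x) :
    mD I (I'.prod I'') (fun x ↦ (f x, g x)) x = (mD I I' f x).prod (mD I I'' g x) :=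
  mfderiv_prodMk hf hg

/-- The derivative of a function of two variables along a pair of maps. -/
theorem mD_comp₂ {A : Type*} [NormedAddCommGroup A] [NormedSpace ℝ A]
    {HA : Type*} [TopologicalSpace HA] {IA : ModelWithCorners ℝ A HA}
    {X : Type*} [TopologicalSpace X] [ChartedSpace HA X]
    {h : N × N' → N''} {f : X → N} {g : X → N'} {x : X} {a : N} {b : N'} (ha : f x = a)
    (hb : g x = b)
    (hh : MDifferentiableAt (I.prod I') I'' h (a, b)) (hf : MDifferentiableAt IA I f x)
    (hg : MDifferentiableAt IA I' g x) (v : A) :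
    mD IA I'' (fun x ↦ h (f x, g x)) x v =
      mD I I'' (fun y ↦ h (y, b)) a (mD IA I f x v) +
        mD I' I'' (fun y ↦ h (a, y)) b (mD IA I' g x v) := by
  subst ha hb
  have h0 := mD_comp (I := IA) (I' := I.prod I') (I'' := I'') (f := fun x ↦ (f x, g x)) (x := x) hh
    (hf.prodMk hg)
  rw [h0, mD_prodMk hf hg]
  have h1 := mD_comp (I := I) (I' := I.prod I') (I'' := I'') (f := fun y ↦ (y, g x)) (x := f x) hh
    (mdifferentiableAt_id.prodMk mdifferentiableAt_const)
  have h2 := mD_comp (I := I') (I' := I.prod I') (I'' := I'') (f := fun y ↦ (f x, y)) (x := g x) hh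
    (mdifferentiableAt_const.prodMk mdifferentiableAt_id)
  have h1' : mD I (I.prod I') (fun y : N ↦ (y, g x)) (f x) = ContinuousLinearMap.inl ℝ E E' := by
    have h3 := mD_prodMk (I := I) (I' := I) (I'' := I') (f := fun y : N ↦ y) (g := fun _ ↦ g x)
      (x := f x) mdifferentiableAt_id mdifferentiableAt_const
    rw [h3, mD_id, mD_const]
    rfl
  have h2' : mD I' (I.prod I') (fun y : N' ↦ (f x, y)) (g x) = ContinuousLinearMap.inr ℝ E E' := by
    have h3 := mD_prodMk (I := I') (I' := I) (I'' := I') (f := fun _ ↦ f x) (g := fun y : N' ↦ y)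
      (x := g x) mdifferentiableAt_const mdifferentiableAt_id
    rw [h3, mD_id, mD_const]
    rfl
  rw [h1, h2, h1', h2']
  simp only [ContinuousLinearMap.comp_apply, ← map_add]
  congr 1
  simp

end Derivatives

/-! ### Real and complex derivatives -/

section RealComplex

variable {E : Type*} [NormedAddCommGroup E] [NormedSpace ℂ E]
  {N : Type*} [TopologicalSpace N] [ChartedSpace E N]
  {E' : Type*} [NormedAddCommGroup E'] [NormedSpace ℂ E']
  {N' : Type*} [TopologicalSpace N'] [ChartedSpace E' N']

theorem contMDiffAt_real_of_complex {f : N → N'} {x : N}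
    (hf : ContMDiffAt 𝓘(ℂ, E) 𝓘(ℂ, E') ω f x) : ContMDiffAt 𝓘(ℝ, E) 𝓘(ℝ, E') ∞ f x := by
  rw [contMDiffAt_iff] at hf ⊢
  refine ⟨hf.1, ?_⟩
  have h2 := (hf.2.restrict_scalars ℝ).of_le (m := ∞) le_top
  convert h2 using 1 <;> rfl

/-- The real derivative of a holomorphic map is its complex derivative. -/
theorem mD_eq_complex {f : N → N'} {x : N} (hf : MDifferentiableAt 𝓘(ℂ, E) 𝓘(ℂ, E') f x) (v : E) :
    mD 𝓘(ℝ, E) 𝓘(ℝ, E') f x v = mfderiv 𝓘(ℂ, E) 𝓘(ℂ, E') f x v := by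
  have h1 := hf.hasMFDerivAt
  have h2 : HasMFDerivAt 𝓘(ℝ, E) 𝓘(ℝ, E') f x
      ((mfderiv 𝓘(ℂ, E) 𝓘(ℂ, E') f x : E →L[ℂ] E').restrictScalars ℝ) := by
    refine ⟨h1.1, ?_⟩
    have h3 := h1.2
    exact HasFDerivWithinAt.restrictScalars ℝ (𝕜' := ℂ) h3
  have h4 := h2.mfderiv
  exact congrArg (fun l : E →L[ℝ] E' ↦ l v) h4

theorem mD_smul {f : N → N'} {x : N} (hf : MDifferentiableAt 𝓘(ℂ, E) 𝓘(ℂ, E') f x) (z : ℂ)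
    (v : E) : mD 𝓘(ℝ, E) 𝓘(ℝ, E') f x (z • v) = z • mD 𝓘(ℝ, E) 𝓘(ℝ, E') f x v := by
  rw [mD_eq_complex hf, mD_eq_complex hf]
  exact ContinuousLinearMap.map_smul (mfderiv 𝓘(ℂ, E) 𝓘(ℂ, E') f x : E →L[ℂ] E') z v

end RealComplex

/-! ### Smooth coordinate systems -/

section Coordinates

theorem two_le_infty : (2 : ℕ∞ω) ≤ ∞ := by
  change ((2 : ℕ∞) : ℕ∞ω) ≤ ((⊤ : ℕ∞) : ℕ∞ω)
  exact WithTop.coe_le_coe.2 le_top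

variable {E : Type*} [NormedAddCommGroup E] [NormedSpace ℝ E]
  {H : Type*} [TopologicalSpace H] (I : ModelWithCorners ℝ E H)
  {N : Type*} [TopologicalSpace N] [ChartedSpace H N]

/-- `Φ` is a smooth coordinate system of `N`. -/
structure IsSmoothCoord (Φ : OpenPartialHomeomorph N E) : Prop where
  smooth : ContMDiffOn I 𝓘(ℝ, E) ∞ Φ Φ.source
  smooth_symm : ContMDiffOn 𝓘(ℝ, E) I ∞ Φ.symm Φ.target

/-- The real part of a complex tangent vector, as an element of the model space. -/
noncomputable def reE {z : N} (X : TangentSpaceC I z) : E := reC (TangentSpace I z) X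

/-- The imaginary part of a complex tangent vector, as an element of the model space. -/
noncomputable def imE {z : N} (X : TangentSpaceC I z) : E := imC (TangentSpace I z) X

/-- The complex tangent vector with given real and imaginary parts. -/
noncomputable def mkE (z : N) (a b : E) : TangentSpaceC I z :=
  (1 : ℂ) ⊗ₜ[ℝ] (a : TangentSpace I z) + Complex.I ⊗ₜ[ℝ] (b : TangentSpace I z)

theorem reE_mkE (z : N) (a b : E) : reE I (mkE I z a b) = a :=
  reC_mk (E := TangentSpace I z) a b

theorem imE_mkE (z : N) (a b : E) : imE I (mkE I z a b) = b :=
  imC_mk (E := TangentSpace I z) a b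

/-- The Lie bracket of vector fields, as functions with values in the model space. -/
noncomputable def bracketE (V W : N → E) (z : N) : E := VectorField.mlieBracket I V W z

theorem reE_lieBracketC (X Y : (z : N) → TangentSpaceC I z) (z : N) :
    reE I (lieBracketC I X Y z) = bracketE I (fun z ↦ reE I (X z)) (fun z ↦ reE I (Y z)) z -
      bracketE I (fun z ↦ imE I (X z)) (fun z ↦ imE I (Y z)) z :=
  reE_mkE I z _ _

theorem imE_lieBracketC (X Y : (z : N) → TangentSpaceC I z) (z : N) :
    imE I (lieBracketC I X Y z) = bracketE I (fun z ↦ reE I (X z)) (fun z ↦ imE I (Y z)) z +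
      bracketE I (fun z ↦ imE I (X z)) (fun z ↦ reE I (Y z)) z :=
  imE_mkE I z _ _

/-- A vector field, as a function with values in the model space, is smooth on a set. -/
def SmoothE [IsManifold I 1 N] (V : N → E) (W : Set N) : Prop :=
  ContMDiffOn I I.tangent ∞ (fun x ↦ (⟨x, V x⟩ : TangentBundle I N)) W

theorem smoothFieldOn_iff [IsManifold I 1 N] (X : (z : N) → TangentSpaceC I z) (W : Set N) :
    SmoothFieldOn I X W ↔ SmoothE I (fun z ↦ reE I (X z)) W ∧ SmoothE I (fun z ↦ imE I (X z)) W :=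
  Iff.rfl

variable {I} {Φ : OpenPartialHomeomorph N E} (hΦ : IsSmoothCoord I Φ)

namespace IsSmoothCoord
include hΦ

theorem contMDiffAt {z : N} (hz : z ∈ Φ.source) : ContMDiffAt I 𝓘(ℝ, E) ∞ Φ z :=
  hΦ.smooth.contMDiffAt (Φ.open_source.mem_nhds hz)

theorem contMDiffAt_symm {y : E} (hy : y ∈ Φ.target) : ContMDiffAt 𝓘(ℝ, E) I ∞ Φ.symm y :=
  hΦ.smooth_symm.contMDiffAt (Φ.open_target.mem_nhds hy)

theorem mdifferentiableAt {z : N} (hz : z ∈ Φ.source) : MDifferentiableAt I 𝓘(ℝ, E) Φ z :=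
  (hΦ.contMDiffAt hz).mdifferentiableAt (by simp)

theorem mdifferentiableAt_symm {y : E} (hy : y ∈ Φ.target) :
    MDifferentiableAt 𝓘(ℝ, E) I Φ.symm y :=
  (hΦ.contMDiffAt_symm hy).mdifferentiableAt (by simp)

theorem mD_symm_mD {z : N} (hz : z ∈ Φ.source) (v : E) :
    mD 𝓘(ℝ, E) I Φ.symm (Φ z) (mD I 𝓘(ℝ, E) Φ z v) = v := by
  rw [← mD_comp_apply rfl (hΦ.mdifferentiableAt_symm (Φ.map_source hz)) (hΦ.mdifferentiableAt hz),
    mD_congr (g := fun z ↦ z), mD_id]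
  · rfl
  · exact Φ.eventually_left_inverse hz

theorem mD_mD_symm {y : E} (hy : y ∈ Φ.target) (v : E) :
    mD I 𝓘(ℝ, E) Φ (Φ.symm y) (mD 𝓘(ℝ, E) I Φ.symm y v) = v := by
  rw [← mD_comp_apply rfl (hΦ.mdifferentiableAt (Φ.map_target hy)) (hΦ.mdifferentiableAt_symm hy),
    mD_congr (g := fun z ↦ z), mD_id]
  · rfl
  · exact Φ.eventually_right_inverse hy

/-- The derivative of a coordinate system, as an isomorphism. -/
noncomputable def equiv {z : N} (hz : z ∈ Φ.source) : E ≃L[ℝ] E :=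
  ContinuousLinearEquiv.equivOfInverse (mD I 𝓘(ℝ, E) Φ z) (mD 𝓘(ℝ, E) I Φ.symm (Φ z))
    (hΦ.mD_symm_mD hz) (fun v ↦ by
      have := hΦ.mD_mD_symm (Φ.map_source hz) v
      rwa [Φ.left_inv hz] at this)

theorem mD_injective {z : N} (hz : z ∈ Φ.source) : Function.Injective (mD I 𝓘(ℝ, E) Φ z) :=
  (hΦ.equiv hz).injective

theorem isInvertible {z : N} (hz : z ∈ Φ.source) : (mfderiv I 𝓘(ℝ, E) Φ z).IsInvertible :=
  ⟨hΦ.equiv hz, rfl⟩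

theorem isInvertible_symm {y : E} (hy : y ∈ Φ.target) :
    (mfderiv 𝓘(ℝ, E) I Φ.symm y).IsInvertible := by
  refine ⟨(hΦ.equiv (Φ.map_target hy)).symm, ?_⟩
  change mD 𝓘(ℝ, E) I Φ.symm (Φ (Φ.symm y)) = mD 𝓘(ℝ, E) I Φ.symm y
  rw [Φ.right_inv hy]

theorem inverse_symm {y : E} (hy : y ∈ Φ.target) :
    (mD 𝓘(ℝ, E) I Φ.symm y).inverse = mD I 𝓘(ℝ, E) Φ (Φ.symm y) := by
  apply ContinuousLinearMap.inverse_eq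
  · ext v
    have := hΦ.mD_symm_mD (Φ.map_target hy) v
    rwa [Φ.right_inv hy] at this
  · ext v
    exact hΦ.mD_mD_symm hy v

theorem inverse {z : N} (hz : z ∈ Φ.source) :
    (mD I 𝓘(ℝ, E) Φ z).inverse = mD 𝓘(ℝ, E) I Φ.symm (Φ z) := by
  apply ContinuousLinearMap.inverse_eq
  · ext v
    have := hΦ.mD_mD_symm (Φ.map_source hz) v
    rwa [Φ.left_inv hz] at this
  · ext v
    exact hΦ.mD_symm_mD hz v

variable [FiniteDimensional ℝ E] [IsManifold I ∞ N]

/-- A vector field in coordinates is smooth. -/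
theorem contDiffOn_field {V : N → E} {W : Set N} (hW : IsOpen W)
    (hV : SmoothE I V W) :
    ContDiffOn ℝ ∞ (fun y ↦ mD I 𝓘(ℝ, E) Φ (Φ.symm y) (V (Φ.symm y)))
      (Φ.target ∩ Φ.symm ⁻¹' W) := by
  have : CompleteSpace E := FiniteDimensional.complete ℝ E
  have : IsManifold I 1 N := IsManifold.of_le (n := ∞) (by simp)
  intro y hy
  have h1 := ContMDiffAt.mpullback_vectorField_preimage (m := ∞) (n := ∞) (I := 𝓘(ℝ, E)) (I' := I)
    (f := Φ.symm) (V := V) (x₀ := y) (hV.contMDiffAt (hW.mem_nhds hy.2))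
    (hΦ.contMDiffAt_symm hy.1) (hΦ.isInvertible_symm hy.1) (by simp)
  have h2 : ContDiffAt ℝ ∞ (VectorField.mpullback 𝓘(ℝ, E) I Φ.symm V) y :=
    contMDiffAt_vectorSpace_iff_contDiffAt.1 h1
  refine (h2.congr_of_eventuallyEq ?_).contDiffWithinAt
  filter_upwards [Φ.open_target.mem_nhds hy.1] with z hz
  exact congrArg (fun l : E →L[ℝ] E ↦ l (V (Φ.symm z))) (hΦ.inverse_symm hz).symm

/-- The vector field on a manifold with given coordinates. -/
theorem contMDiffOn_field {a : E → E} {U : Set E} (hU : IsOpen U) (ha : ContDiffOn ℝ ∞ a U) :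
    SmoothE I (fun z ↦ mD 𝓘(ℝ, E) I Φ.symm (Φ z) (a (Φ z)))
      (Φ.source ∩ Φ ⁻¹' U) := by
  have : CompleteSpace E := FiniteDimensional.complete ℝ E
  have : IsManifold I 1 N := IsManifold.of_le (n := ∞) (by simp)
  intro z hz
  have h0 : ContMDiffAt 𝓘(ℝ, E) 𝓘(ℝ, E).tangent ∞ (fun y ↦ (⟨y, a y⟩ : TangentBundle 𝓘(ℝ, E) E))
      (Φ z) :=
    contMDiffAt_vectorSpace_iff_contDiffAt.2 (ha.contDiffAt (hU.mem_nhds hz.2))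
  have h1 := ContMDiffAt.mpullback_vectorField_preimage (m := ∞) (n := ∞) (I := I) (I' := 𝓘(ℝ, E))
    (f := Φ) (V := a) (x₀ := z) h0 (hΦ.contMDiffAt hz.1) (hΦ.isInvertible hz.1) (by simp)
  refine (h1.congr_of_eventuallyEq ?_).contMDiffWithinAt
  filter_upwards [Φ.open_source.mem_nhds hz.1] with w hw
  exact congrArg (fun v : E ↦ (⟨w, v⟩ : TangentBundle I N))
    (congrArg (fun l : E →L[ℝ] E ↦ l (a (Φ w))) (hΦ.inverse hw).symm)

/-- The Lie bracket in coordinates. -/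
theorem mD_mlieBracket {V V' : N → E} {W : Set N} (hW : IsOpen W) {z : N} (hz : z ∈ Φ.source)
    (hzW : z ∈ W) (hV : SmoothE I V W) (hV' : SmoothE I V' W) :
    mD I 𝓘(ℝ, E) Φ z (bracketE I V V' z) =
      VectorField.lieBracket ℝ (fun y ↦ mD I 𝓘(ℝ, E) Φ (Φ.symm y) (V (Φ.symm y)))
        (fun y ↦ mD I 𝓘(ℝ, E) Φ (Φ.symm y) (V' (Φ.symm y))) (Φ z) := by
  have : CompleteSpace E := FiniteDimensional.complete ℝ E
  have : IsManifold I (minSmoothness ℝ 2) N :=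
    IsManifold.of_le (n := ∞) (by simpa using two_le_infty)
  have : IsManifold I 1 N := IsManifold.of_le (n := ∞) (by simp)
  have hz' : Φ.symm (Φ z) = z := Φ.left_inv hz
  have hd : ∀ {V : N → E}, SmoothE I V W → MDifferentiableAt I I.tangent
      (fun x ↦ (⟨x, V x⟩ : TangentBundle I N)) (Φ.symm (Φ z)) := by
    intro V hV
    rw [hz']
    exact (hV.contMDiffAt (hW.mem_nhds hzW)).mdifferentiableAt (by simp)
  have h1 := VectorField.mpullback_mlieBracket (I := 𝓘(ℝ, E)) (I' := I) (n := ∞) (f := Φ.symm)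
    (V := V) (W := V') (x₀ := Φ z) (hd hV) (hd hV')
    (hΦ.contMDiffAt_symm (Φ.map_source hz)) (by simpa using two_le_infty)
  have h2 : ∀ V : N → E, VectorField.mpullback 𝓘(ℝ, E) I Φ.symm V
      =ᶠ[nhds (Φ z)] fun y ↦ mD I 𝓘(ℝ, E) Φ (Φ.symm y) (V (Φ.symm y)) := by
    intro V
    filter_upwards [Φ.open_target.mem_nhds (Φ.map_source hz)] with y hy
    exact congrArg (fun l : E →L[ℝ] E ↦ l (V (Φ.symm y))) (hΦ.inverse_symm hy)
  have h3 : ∀ a b : E → E, VectorField.mlieBracket 𝓘(ℝ, E) a b (Φ z) =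
      VectorField.lieBracket ℝ a b (Φ z) := by
    intro a b
    refine (congrFun (VectorField.mlieBracketWithin_eq_lieBracketWithin (V := a) (W := b)
      (s := univ)) (Φ z)).trans ?_
    rw [VectorField.lieBracketWithin_univ]
  rw [(h2 V).mlieBracket_vectorField_eq (h2 V')] at h1
  refine Eq.trans ?_ (h1.trans (h3 _ _))
  have h4 := (h2 (bracketE I V V')).self_of_nhds
  refine Eq.trans ?_ h4.symm
  simp only [hz']

end IsSmoothCoord

/-- The condition `dα (X, Y) = 0` for complex vectors `X = a + i b` and `Y = c + i d` in the kernel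
of the complexification of `α`. -/
def ClosedOnKernel {K : Type*} [NormedAddCommGroup K] [NormedSpace ℝ K] (α : E → E →L[ℝ] K)
    (J : K →L[ℝ] K) (y : E) : Prop :=
  ∀ a b c d, α y a + J (α y b) = 0 → α y c + J (α y d) = 0 →
    (dForm α y a c - dForm α y b d) + J (dForm α y a d + dForm α y b c) = 0

variable {K : Type*} [NormedAddCommGroup K] [NormedSpace ℝ K] {α : E → E →L[ℝ] K} {J : K →L[ℝ] K}
  [FiniteDimensional ℝ E] [IsManifold I ∞ N]
  {D : (z : N) → Submodule ℂ (TangentSpaceC I z)}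

include hΦ in
/-- Brackets of sections of the kernel of the complexification of `α`. -/
theorem lieBracketC_mem_iff (hJ : ∀ k, J (J k) = -k) (hα : ContDiffOn ℝ ∞ α Φ.target)
    (hD : ∀ z ∈ Φ.source, ∀ X : TangentSpaceC I z, X ∈ D z ↔
      α (Φ z) (mD I 𝓘(ℝ, E) Φ z (reE I X)) + J (α (Φ z) (mD I 𝓘(ℝ, E) Φ z (imE I X))) = 0)
    {W : Set N} (hW : IsOpen W) {X Y : (z : N) → TangentSpaceC I z}
    (hX : SmoothFieldOn I X W) (hY : SmoothFieldOn I Y W)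
    (hXD : ∀ z ∈ W, X z ∈ D z) (hYD : ∀ z ∈ W, Y z ∈ D z) {z : N} (hz : z ∈ W)
    (hzΦ : z ∈ Φ.source) :
    lieBracketC I X Y z ∈ D z ↔
      (dForm α (Φ z) (mD I 𝓘(ℝ, E) Φ z (reE I (X z))) (mD I 𝓘(ℝ, E) Φ z (reE I (Y z)))
        - dForm α (Φ z) (mD I 𝓘(ℝ, E) Φ z (imE I (X z))) (mD I 𝓘(ℝ, E) Φ z (imE I (Y z)))) +
      J (dForm α (Φ z) (mD I 𝓘(ℝ, E) Φ z (reE I (X z))) (mD I 𝓘(ℝ, E) Φ z (imE I (Y z)))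
        + dForm α (Φ z) (mD I 𝓘(ℝ, E) Φ z (imE I (X z))) (mD I 𝓘(ℝ, E) Φ z (reE I (Y z)))) = 0 := by
  rw [smoothFieldOn_iff] at hX hY
  let f (V : N → E) (y : E) : E := mD I 𝓘(ℝ, E) Φ (Φ.symm y) (V (Φ.symm y))
  have hz' : Φ.symm (Φ z) = z := Φ.left_inv hzΦ
  have hy : Φ z ∈ Φ.target := Φ.map_source hzΦ
  have hopen : IsOpen (Φ.target ∩ Φ.symm ⁻¹' W) :=
    Φ.symm.isOpen_inter_preimage hW
  have hmem : Φ.target ∩ Φ.symm ⁻¹' W ∈ nhds (Φ z) :=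
    hopen.mem_nhds ⟨hy, by rw [mem_preimage, hz']; exact hz⟩
  have hdiff : ∀ V : N → E, SmoothE I V W → DifferentiableAt ℝ (f V) (Φ z) := fun V hV ↦
    ((hΦ.contDiffOn_field hW hV).contDiffAt hmem).differentiableAt (by simp)
  have hf : ∀ V : N → E, f V (Φ z) = mD I 𝓘(ℝ, E) Φ z (V z) := by
    intro V
    simp only [f]
    rw [hz']
  have hbr : ∀ V V' : N → E, SmoothE I V W → SmoothE I V' W →
      VectorField.lieBracket ℝ (f V) (f V') (Φ z) = mD I 𝓘(ℝ, E) Φ z (bracketE I V V' z) :=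
    fun V V' hV hV' ↦ (hΦ.mD_mlieBracket hW hzΦ hz hV hV').symm
  have hker : ∀ X : (z : N) → TangentSpaceC I z, (∀ z ∈ W, X z ∈ D z) → ∀ᶠ y in nhds (Φ z),
      α y (f (fun z ↦ reE I (X z)) y) + J (α y (f (fun z ↦ imE I (X z)) y)) = 0 := by
    intro X hX
    filter_upwards [hmem] with y hy
    have := (hD _ (Φ.map_target hy.1) _).1 (hX _ hy.2)
    rwa [Φ.right_inv hy.1] at this
  have h1 := form_lieBracket hJ
    ((hα.contDiffAt (Φ.open_target.mem_nhds hy)).differentiableAt (by simp))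
    (hdiff _ hX.1) (hdiff _ hX.2) (hdiff _ hY.1) (hdiff _ hY.2) (hker X hXD) (hker Y hYD)
  rw [hbr _ _ hX.1 hY.1, hbr _ _ hX.1 hY.2, hbr _ _ hX.2 hY.1, hbr _ _ hX.2 hY.2] at h1
  simp only [hf] at h1
  rw [hD z hzΦ, reE_lieBracketC, imE_lieBracketC, map_sub, map_add, h1, neg_eq_zero]

include hΦ in
theorem lieBracketC_mem_of_closedOnKernel (hJ : ∀ k, J (J k) = -k) (hα : ContDiffOn ℝ ∞ α Φ.target)
    (hD : ∀ z ∈ Φ.source, ∀ X : TangentSpaceC I z, X ∈ D z ↔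
      α (Φ z) (mD I 𝓘(ℝ, E) Φ z (reE I X)) + J (α (Φ z) (mD I 𝓘(ℝ, E) Φ z (imE I X))) = 0)
    {W : Set N} (hW : IsOpen W) {X Y : (z : N) → TangentSpaceC I z}
    (hX : SmoothFieldOn I X W) (hY : SmoothFieldOn I Y W)
    (hXD : ∀ z ∈ W, X z ∈ D z) (hYD : ∀ z ∈ W, Y z ∈ D z) {z : N} (hz : z ∈ W)
    (hzΦ : z ∈ Φ.source) (hcl : ClosedOnKernel α J (Φ z)) :
    lieBracketC I X Y z ∈ D z := by
  rw [lieBracketC_mem_iff hΦ hJ hα hD hW hX hY hXD hYD hz hzΦ]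
  exact hcl _ _ _ _ ((hD z hzΦ _).1 (hXD z hz)) ((hD z hzΦ _).1 (hYD z hz))

-- Closedness concerns single vectors while integrability concerns fields, so kernel vectors are
-- extended to local sections of the kernel. Surjectivity at the one point in question suffices for
-- this.
include hΦ in
theorem closedOnKernel_of_isIntegrable [FiniteDimensional ℝ K] (hJ : ∀ k, J (J k) = -k)
    (hα : ContDiffOn ℝ ∞ α Φ.target)
    (hD : ∀ z ∈ Φ.source, ∀ X : TangentSpaceC I z, X ∈ D z ↔
      α (Φ z) (mD I 𝓘(ℝ, E) Φ z (reE I X)) + J (α (Φ z) (mD I 𝓘(ℝ, E) Φ z (imE I X))) = 0)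
    {z : N} (hzΦ : z ∈ Φ.source) (hsurj : ∀ k, ∃ a b, α (Φ z) a + J (α (Φ z) b) = k)
    (hint : IsIntegrableDistribution I D) : ClosedOnKernel α J (Φ z) := by
  intro a₀ b₀ c₀ d₀ h h'
  have hy : Φ z ∈ Φ.target := Φ.map_source hzΦ
  obtain ⟨U, hUs, hU, hyU, a, b, ha, hb, ha₀, hb₀, hab⟩ :=
    exists_smooth_section Φ.open_target hα hy hsurj h
  obtain ⟨U', hUs', hU', hyU', c, d, hc, hd, hc₀, hd₀, hcd⟩ :=
    exists_smooth_section Φ.open_target hα hy hsurj h'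
  -- Transport of fields from coordinates back to `N`; applying the derivative of `Φ` recovers the
  -- coordinate field.
  let g (a : E → E) (z : N) : E := mD 𝓘(ℝ, E) I Φ.symm (Φ z) (a (Φ z))
  have hg : ∀ (a : E → E) {z : N} (_ : z ∈ Φ.source), mD I 𝓘(ℝ, E) Φ z (g a z) = a (Φ z) := by
    intro a z hz
    have := hΦ.mD_mD_symm (Φ.map_source hz) (a (Φ z))
    rwa [Φ.left_inv hz] at this
  let F (a b : E → E) (z : N) : TangentSpaceC I z := mkE I z (g a z) (g b z)
  have hre : ∀ a b z, reE I (F a b z) = g a z := fun a b z ↦ reE_mkE I z _ _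
  have him : ∀ a b z, imE I (F a b z) = g b z := fun a b z ↦ imE_mkE I z _ _
  have hFD : ∀ {a b : E → E} {z : N}, z ∈ Φ.source →
      α (Φ z) (a (Φ z)) + J (α (Φ z) (b (Φ z))) = 0 → F a b z ∈ D z := by
    intro a b z hz h
    rw [hD z hz, hre, him, hg a hz, hg b hz]
    exact h
  have hsm : ∀ {a b : E → E} {V : Set E}, IsOpen V → ContDiffOn ℝ ∞ a V → ContDiffOn ℝ ∞ b V →
      SmoothFieldOn I (F a b) (Φ.source ∩ Φ ⁻¹' V) := by
    intro a b V hV ha hb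
    rw [smoothFieldOn_iff]
    simp only [hre, him]
    exact ⟨hΦ.contMDiffOn_field hV ha, hΦ.contMDiffOn_field hV hb⟩
  have hV : IsOpen (U ∩ U') := hU.inter hU'
  have hW : IsOpen (Φ.source ∩ Φ ⁻¹' (U ∩ U')) := Φ.isOpen_inter_preimage hV
  have hX := hsm hV (ha.mono inter_subset_left) (hb.mono inter_subset_left)
  have hY := hsm hV (hc.mono inter_subset_right) (hd.mono inter_subset_right)
  have hXD : ∀ z ∈ Φ.source ∩ Φ ⁻¹' (U ∩ U'), F a b z ∈ D z := fun z hz ↦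
    hFD hz.1 (hab _ hz.2.1)
  have hYD : ∀ z ∈ Φ.source ∩ Φ ⁻¹' (U ∩ U'), F c d z ∈ D z := fun z hz ↦
    hFD hz.1 (hcd _ hz.2.2)
  have hzW : z ∈ Φ.source ∩ Φ ⁻¹' (U ∩ U') := ⟨hzΦ, hyU, hyU'⟩
  have h1 := (lieBracketC_mem_iff hΦ hJ hα hD hW hX hY hXD hYD hzW hzΦ).1
    (hint _ hW _ _ hX hY hXD hYD z hzW)
  rw [hre, him, hre, him, hg a hzΦ, hg b hzΦ, hg c hzΦ, hg d hzΦ, ha₀, hb₀, hc₀, hd₀] at h1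
  exact h1

end Coordinates

/-! ### Horizontal vectors of a connection on a principal bundle -/

namespace PrincipalBundle

variable {EM : Type*} [NormedAddCommGroup EM] [NormedSpace ℝ EM]
  {M : Type*} [TopologicalSpace M] [ChartedSpace EM M]
  {EP : Type*} [NormedAddCommGroup EP] [NormedSpace ℝ EP]
  {P : Type*} [TopologicalSpace P] [ChartedSpace EP P]
  {EG : Type*} [NormedAddCommGroup EG] [NormedSpace ℂ EG]
  {G : Type*} [TopologicalSpace G] [ChartedSpace EG G] [Group G]
  (B : PrincipalBundle EM M EP P EG G)

theorem mdifferentiableAt_act (z : P × G) :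
    MDifferentiableAt (𝓘(ℝ, EP).prod 𝓘(ℝ, EG)) 𝓘(ℝ, EP) (fun z : P × G ↦ B.act z.1 z.2) z :=
  B.contMDiff_act.mdifferentiableAt (by simp)

theorem mdifferentiableAt_proj (u : P) : MDifferentiableAt 𝓘(ℝ, EP) 𝓘(ℝ, EM) B.proj u :=
  B.contMDiff_proj.mdifferentiableAt (by simp)

theorem mdifferentiableAt_act_left (u : P) (g : G) :
    MDifferentiableAt 𝓘(ℝ, EP) 𝓘(ℝ, EP) (fun u ↦ B.act u g) u :=
  (B.mdifferentiableAt_act (u, g)).comp u (mdifferentiableAt_id.prodMk mdifferentiableAt_const)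

theorem mdifferentiableAt_act_right (u : P) (g : G) :
    MDifferentiableAt 𝓘(ℝ, EG) 𝓘(ℝ, EP) (B.act u) g :=
  (B.mdifferentiableAt_act (u, g)).comp g (mdifferentiableAt_const.prodMk mdifferentiableAt_id)

theorem mD_proj_act_left (u : P) (g : G) (w : EP) :
    mD 𝓘(ℝ, EP) 𝓘(ℝ, EM) B.proj (B.act u g) (mD 𝓘(ℝ, EP) 𝓘(ℝ, EP) (fun u ↦ B.act u g) u w) =
      mD 𝓘(ℝ, EP) 𝓘(ℝ, EM) B.proj u w := by
  rw [← mD_comp_apply rfl (B.mdifferentiableAt_proj _) (B.mdifferentiableAt_act_left u g)]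
  simp only [B.proj_act]

theorem mD_proj_act_right (u : P) (a : EG) :
    mD 𝓘(ℝ, EP) 𝓘(ℝ, EM) B.proj u (mD 𝓘(ℝ, EG) 𝓘(ℝ, EP) (B.act u) 1 a) = 0 := by
  rw [← mD_comp_apply (B.act_one u) (B.mdifferentiableAt_proj _) (B.mdifferentiableAt_act_right u 1)]
  simp only [B.proj_act]
  rw [mD_const]
  rfl

section Triv

variable {B} (τ : B.Triv)

theorem isOpen_preimage_base : IsOpen (B.proj ⁻¹' τ.base) :=
  τ.isOpen_base.preimage B.contMDiff_proj.continuous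

theorem mdifferentiableAt_sec {x : M} (hx : x ∈ τ.base) :
    MDifferentiableAt 𝓘(ℝ, EM) 𝓘(ℝ, EP) τ.sec x :=
  (τ.contMDiffOn_sec.contMDiffAt (τ.isOpen_base.mem_nhds hx)).mdifferentiableAt (by simp)

theorem mdifferentiableAt_coord {u : P} (hu : B.proj u ∈ τ.base) :
    MDifferentiableAt 𝓘(ℝ, EP) 𝓘(ℝ, EG) τ.coord u :=
  (τ.contMDiffOn_coord.contMDiffAt ((isOpen_preimage_base τ).mem_nhds hu)).mdifferentiableAt (by simp)

theorem coord_sec {x : M} (hx : x ∈ τ.base) : τ.coord (τ.sec x) = 1 := by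
  have := τ.coord_act x hx 1
  rwa [B.act_one] at this

theorem mD_proj_sec {x : M} (hx : x ∈ τ.base) (v : EM) :
    mD 𝓘(ℝ, EP) 𝓘(ℝ, EM) B.proj (τ.sec x) (mD 𝓘(ℝ, EM) 𝓘(ℝ, EP) τ.sec x v) = v := by
  rw [← mD_comp_apply rfl (B.mdifferentiableAt_proj _) (mdifferentiableAt_sec τ hx),
    mD_congr (g := fun x ↦ x), mD_id]
  · rfl
  · filter_upwards [τ.isOpen_base.mem_nhds hx] with y hy using τ.proj_sec y hy

/-- The decomposition of a tangent vector of `P` along a local section. -/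
theorem eq_mD_sec_add {x : M} (hx : x ∈ τ.base) (w : EP) :
    w = mD 𝓘(ℝ, EM) 𝓘(ℝ, EP) τ.sec x (mD 𝓘(ℝ, EP) 𝓘(ℝ, EM) B.proj (τ.sec x) w) +
      mD 𝓘(ℝ, EG) 𝓘(ℝ, EP) (B.act (τ.sec x)) 1 (mD 𝓘(ℝ, EP) 𝓘(ℝ, EG) τ.coord (τ.sec x) w) := by
  have hp : B.proj (τ.sec x) = x := τ.proj_sec x hx
  have hpb : B.proj (τ.sec x) ∈ τ.base := by rwa [hp]
  -- The decomposition is the derivative of the identity `u = sec (proj u) · coord u`, in which both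
  -- factors vary.
  have h1 : mD 𝓘(ℝ, EP) 𝓘(ℝ, EP) (fun u ↦ B.act (τ.sec (B.proj u)) (τ.coord u)) (τ.sec x) w = w := by
    rw [mD_congr (g := fun u ↦ u), mD_id]
    · rfl
    · filter_upwards [(isOpen_preimage_base τ).mem_nhds hpb] with u hu using τ.act_coord u hu
  have hsp : MDifferentiableAt 𝓘(ℝ, EP) 𝓘(ℝ, EP) (fun u ↦ τ.sec (B.proj u)) (τ.sec x) :=
    (mdifferentiableAt_sec τ hpb).comp (τ.sec x) (B.mdifferentiableAt_proj _)
  have h2 := mD_comp₂ (h := fun z : P × G ↦ B.act z.1 z.2) (f := fun u ↦ τ.sec (B.proj u))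
    (g := τ.coord) (x := τ.sec x) (a := τ.sec x) (b := 1) (by rw [hp]) (coord_sec τ hx)
    (B.mdifferentiableAt_act _) hsp (mdifferentiableAt_coord τ hpb) w
  rw [h1] at h2
  refine h2.trans ?_
  congr 1
  have h3 : (fun y ↦ B.act y 1) = fun y ↦ y := funext B.act_one
  change mD _ _ (fun y ↦ B.act y 1) _ _ = _
  rw [h3, mD_id]
  exact mD_comp_apply hp (mdifferentiableAt_sec τ hx) (B.mdifferentiableAt_proj _) w

end Triv

variable {B} [IsManifold 𝓘(ℝ, EP) ∞ P]

namespace Connection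

variable (c : B.Connection) (τ : B.Triv)

/-- The connection form, as a linear map of the model spaces. -/
def formE (u : P) : EP →L[ℝ] EG := c.form u

theorem formE_mD_act_right (u : P) (a : EG) :
    c.formE u (mD 𝓘(ℝ, EG) 𝓘(ℝ, EP) (B.act u) 1 a) = a := by
  have h : ∀ u', u' = B.act u 1 → c.formE u' (mD 𝓘(ℝ, EG) 𝓘(ℝ, EP) (B.act u) 1 a) = a := by
    rintro _ rfl
    exact c.form_fundamental u a
  exact h u (B.act_one u).symm

theorem formE_mD_act_left {u : P} {w : EP} (hw : c.formE u w = 0) (g : G) :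
    c.formE (B.act u g) (mD 𝓘(ℝ, EP) 𝓘(ℝ, EP) (fun u ↦ B.act u g) u w) = 0 := by
  refine (c.form_act u g w).trans ?_
  have h : c.form u w = 0 := hw
  rw [h]
  exact map_zero (mfderiv 𝓘(ℂ, EG) 𝓘(ℂ, EG) (fun h : G ↦ g⁻¹ * h * g) 1 : EG →L[ℂ] EG)

/-- The pullback of the connection form by a local section. -/
noncomputable def secForm (x : M) : EM →L[ℝ] EG :=
  (c.formE (τ.sec x)).comp (mD 𝓘(ℝ, EM) 𝓘(ℝ, EP) τ.sec x)

variable {τ}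

theorem mD_coord_of_horizontal {x : M} (hx : x ∈ τ.base) {w : EP} (hw : c.formE (τ.sec x) w = 0) :
    mD 𝓘(ℝ, EP) 𝓘(ℝ, EG) τ.coord (τ.sec x) w =
      -c.secForm τ x (mD 𝓘(ℝ, EP) 𝓘(ℝ, EM) B.proj (τ.sec x) w) := by
  -- The connection form of the decomposition along the section: the vertical summand is
  -- fundamental, so it is reproduced and must cancel the form of the tangential summand.
  have h := congrArg (c.formE (τ.sec x)) (eq_mD_sec_add τ hx w)
  rw [hw, map_add, c.formE_mD_act_right] at h
  exact eq_neg_of_add_eq_zero_right h.symm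

/-- The tangent vector of the section is made horizontal by subtracting the fundamental vector of
its own connection form, which does not change its projection. -/
theorem exists_horizontal_sec {x : M} (hx : x ∈ τ.base) (v : EM) :
    ∃ w : EP, c.formE (τ.sec x) w = 0 ∧ mD 𝓘(ℝ, EP) 𝓘(ℝ, EM) B.proj (τ.sec x) w = v := by
  refine ⟨mD 𝓘(ℝ, EM) 𝓘(ℝ, EP) τ.sec x v -
    mD 𝓘(ℝ, EG) 𝓘(ℝ, EP) (B.act (τ.sec x)) 1 (c.secForm τ x v), ?_, ?_⟩
  · rw [map_sub, c.formE_mD_act_right]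
    exact sub_self _
  · rw [map_sub, B.mD_proj_act_right, mD_proj_sec τ hx, sub_zero]

/-- A horizontal vector is determined by its projection. -/
theorem eq_of_horizontal_sec {x : M} (hx : x ∈ τ.base) {w w' : EP} (hw : c.formE (τ.sec x) w = 0)
    (hw' : c.formE (τ.sec x) w' = 0)
    (h : mD 𝓘(ℝ, EP) 𝓘(ℝ, EM) B.proj (τ.sec x) w = mD 𝓘(ℝ, EP) 𝓘(ℝ, EM) B.proj (τ.sec x) w') :
    w = w' := by
  rw [eq_mD_sec_add τ hx w, eq_mD_sec_add τ hx w', c.mD_coord_of_horizontal hx hw,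
    c.mD_coord_of_horizontal hx hw', h]

/-- Right translation carries a horizontal vector at the point of a local section to any other point
of the fibre, preserving both horizontality and the projection. -/
theorem exists_horizontal (u : P) (v : EM) :
    ∃ w : EP, c.formE u w = 0 ∧ mD 𝓘(ℝ, EP) 𝓘(ℝ, EM) B.proj u w = v := by
  let σ := B.trivAt (B.proj u)
  have hx : B.proj u ∈ σ.base := B.mem_trivAt _
  obtain ⟨w, hw, hwv⟩ := c.exists_horizontal_sec (τ := σ) hx v
  have h1 := c.formE_mD_act_left hw (σ.coord u)
  have h2 := B.mD_proj_act_left (σ.sec (B.proj u)) (σ.coord u) w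
  rw [σ.act_coord u hx] at h1 h2
  exact ⟨_, h1, h2.trans hwv⟩

/-- The lift of a tangent vector at a point of a local section which is horizontal there. -/
theorem lift_eq {x : M} (hx : x ∈ τ.base) (h0 : c.secForm τ x = 0) (v : EM) :
    c.lift (τ.sec x) v = mD 𝓘(ℝ, EM) 𝓘(ℝ, EP) τ.sec x v := by
  have h1 : ∃ w : TangentSpace 𝓘(ℝ, EP) (τ.sec x), w ∈ c.horizontal (τ.sec x) ∧
      mfderiv 𝓘(ℝ, EP) 𝓘(ℝ, EM) B.proj (τ.sec x) w = v := c.exists_horizontal (τ.sec x) v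
  have h2 := Classical.epsilon_spec h1
  refine c.eq_of_horizontal_sec hx h2.1 ?_ (h2.2.trans (mD_proj_sec τ hx v).symm)
  exact congrArg (fun l : EM →L[ℝ] EG ↦ l v) h0

variable {F : Type*} [TopologicalSpace F] {EF : Type*} [NormedAddCommGroup EF] [NormedSpace ℂ EF]
  [ChartedSpace EF F] [MulAction G F] [ContMDiffSMul 𝓘(ℂ, EG) 𝓘(ℂ, EF) ω G F]

/-- Parallel transport in the fibre, infinitesimally: it moves by minus the infinitesimal action of
the local connection form. Right translation by `g⁻¹`, with `g = τ.coord u`, moves `u` onto the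
section, where `mD_coord_of_horizontal` applies; the factor `g` is absorbed in the point `g • f`. -/
theorem mD_coord_smul {η : F → EF} {u : P} (hu : B.proj u ∈ τ.base) (f : F)
    (hη : MDifferentiableAt 𝓘(ℝ, EF) 𝓘(ℝ, EF) η (τ.coord u • f)) {w : EP} (hw : c.formE u w = 0) :
    mD 𝓘(ℝ, EP) 𝓘(ℝ, EF) (fun u ↦ η (τ.coord u • f)) u w =
      -mD 𝓘(ℝ, EG) 𝓘(ℝ, EF) (fun g : G ↦ η (g • τ.coord u • f)) 1
        (c.secForm τ (B.proj u) (mD 𝓘(ℝ, EP) 𝓘(ℝ, EM) B.proj u w)) := by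
  set g := τ.coord u
  have hψ : B.act u g⁻¹ = τ.sec (B.proj u) := by
    conv_lhs => rw [← τ.act_coord u hu]
    rw [← B.act_mul, mul_inv_cancel, B.act_one]
  have h1 : mD 𝓘(ℝ, EP) 𝓘(ℝ, EF) (fun u ↦ η (τ.coord u • f)) u =
      mD 𝓘(ℝ, EP) 𝓘(ℝ, EF) (fun u ↦ η (τ.coord (B.act u g⁻¹) • g • f)) u := by
    apply mD_congr
    filter_upwards [(isOpen_preimage_base τ).mem_nhds hu] with u' hu'
    rw [B.coord_act' τ u' hu', smul_smul, mul_assoc, inv_mul_cancel, mul_one]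
  have hp : B.proj (B.act u g⁻¹) = B.proj u := B.proj_act _ _
  have hco : MDifferentiableAt 𝓘(ℝ, EP) 𝓘(ℝ, EG) τ.coord (B.act u g⁻¹) :=
    mdifferentiableAt_coord τ (by rwa [hp])
  have hco1 : τ.coord (B.act u g⁻¹) = 1 := by rw [hψ, coord_sec τ hu]
  have hsm : MDifferentiableAt 𝓘(ℝ, EG) 𝓘(ℝ, EF) (fun g' : G ↦ η (g' • g • f)) 1 := by
    have h2 := (contMDiff_real_of_complex (ContMDiffSMul.contMDiff_smul (I := 𝓘(ℂ, EG))
      (I' := 𝓘(ℂ, EF)) (n := ω) (G := G) (M := F))).mdifferentiableAt (by simp)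
      (x := ((1 : G), g • f))
    have h3 : MDifferentiableAt 𝓘(ℝ, EG) 𝓘(ℝ, EF) (fun g' : G ↦ g' • g • f) 1 :=
      h2.comp (1 : G) (mdifferentiableAt_id.prodMk mdifferentiableAt_const)
    refine MDifferentiableAt.comp (1 : G) (g := η) ?_ h3
    rwa [one_smul]
  rw [h1]
  have h4 := mD_comp_apply (g := fun g' : G ↦ η (g' • g • f)) (f := fun u ↦ τ.coord (B.act u g⁻¹))
    (x := u) (y := 1) hco1 hsm (hco.comp u (B.mdifferentiableAt_act_left u g⁻¹)) w
  refine h4.trans ?_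
  rw [← map_neg]
  congr 1
  rw [mD_comp_apply (f := fun u ↦ B.act u g⁻¹) hψ (by rwa [hψ] at hco)
    (B.mdifferentiableAt_act_left u g⁻¹), c.mD_coord_of_horizontal hu]
  · have := B.mD_proj_act_left u g⁻¹ w
    rw [hψ] at this
    rw [this]
  · have := c.formE_mD_act_left hw g⁻¹
    rwa [hψ] at this

end Connection

end PrincipalBundle

/-! ### Smooth 1-forms on manifolds, pulled back to vector spaces -/

section Forms

variable {E : Type*} [NormedAddCommGroup E] [NormedSpace ℝ E]
  {N : Type*} [TopologicalSpace N] [ChartedSpace E N]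
  {V : Type*} [NormedAddCommGroup V] [NormedSpace ℝ V]
  {W : Type*} [NormedAddCommGroup W] [NormedSpace ℝ W]

theorem isSmoothCoord_chartAt [IsManifold 𝓘(ℝ, E) ∞ N] (x : N) :
    IsSmoothCoord 𝓘(ℝ, E) (chartAt E x) :=
  ⟨contMDiffOn_chart, contMDiffOn_chart_symm⟩

/-- The derivative of the preferred chart at its centre. -/
theorem mD_chartAt_self [IsManifold 𝓘(ℝ, E) ∞ N] (x : N) (v : E) :
    mD 𝓘(ℝ, E) 𝓘(ℝ, E) (chartAt E x) x v = v := by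
  have h : HasMFDerivAt 𝓘(ℝ, E) 𝓘(ℝ, E) (chartAt E x) x (ContinuousLinearMap.id ℝ E) := by
    refine ⟨(chartAt E x).continuousAt (mem_chart_source E x), ?_⟩
    refine HasFDerivAt.hasFDerivWithinAt ?_
    -- Derivatives on `N` are read in this very chart, so the map to differentiate is the chart
    -- composed with its own inverse.
    refine (hasFDerivAt_id _).congr_of_eventuallyEq ?_
    filter_upwards [(chartAt E x).open_target.mem_nhds (mem_chart_target E x)] with y hy
    exact (chartAt E x).right_inv hy
  exact congrArg (fun l : E →L[ℝ] E ↦ l v) h.mfderiv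

/-- The fibre coordinate of a smooth map to the tangent bundle. -/
theorem contMDiffAt_mD_chartAt [IsManifold 𝓘(ℝ, E) ∞ N] {E' : Type*} [NormedAddCommGroup E']
    [NormedSpace ℝ E'] {H' : Type*} [TopologicalSpace H'] {I' : ModelWithCorners ℝ E' H'}
    {N' : Type*} [TopologicalSpace N'] [ChartedSpace H' N'] {p : N' → N} {v : N' → E} {x : N'}
    (h : ContMDiffAt I' 𝓘(ℝ, E).tangent ∞
      (fun x ↦ (⟨p x, v x⟩ : TangentBundle 𝓘(ℝ, E) N)) x) :
    ContMDiffAt I' 𝓘(ℝ, E) ∞ (fun y ↦ mD 𝓘(ℝ, E) 𝓘(ℝ, E) (chartAt E (p x)) (p y) (v y)) x := by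
  rw [Bundle.contMDiffAt_totalSpace] at h
  refine h.2.congr_of_eventuallyEq ?_
  have h1 : p ⁻¹' (chartAt E (p x)).source ∈ nhds x :=
    h.1.continuousAt ((chartAt E (p x)).open_source.mem_nhds (mem_chart_source E (p x)))
  filter_upwards [h1] with y hy
  have h2 := (isSmoothCoord_chartAt (p x)).mdifferentiableAt hy
  rw [TangentBundle.trivializationAt_apply]
  have h3 : mfderiv 𝓘(ℝ, E) 𝓘(ℝ, E) (chartAt E (p x)) (p y) = _ := h2.mfderiv
  exact congrArg (fun l : E →L[ℝ] E ↦ l (v y)) h3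

/-- The pullback to a vector space of a 1-form on a manifold. -/
noncomputable def pullForm (α : N → E →L[ℝ] W) (f : V → N) (y : V) : V →L[ℝ] W :=
  (α (f y)).comp (mD 𝓘(ℝ, V) 𝓘(ℝ, E) f y)

/-- A 1-form is smooth. -/
def SmoothOneForm (α : N → E →L[ℝ] W) : Prop :=
  ∀ u : N, ContDiffAt ℝ ∞ (pullForm α (chartAt E u).symm) (chartAt E u u)

variable [IsManifold 𝓘(ℝ, E) ∞ N] {α : N → E →L[ℝ] W} {f : V → N} {y : V}

/-- Factoring `f` through the chart at `f y` turns the pullback into an ordinary composition of maps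
between vector spaces, to which the chain rule applies. -/
theorem pullForm_eventuallyEq (hf : ContMDiffAt 𝓘(ℝ, V) 𝓘(ℝ, E) ∞ f y) :
    pullForm α f =ᶠ[nhds y] fun y' ↦
      (pullForm α (chartAt E (f y)).symm (chartAt E (f y) (f y'))).comp
        (fderiv ℝ (fun y' ↦ chartAt E (f y) (f y')) y') := by
  have h1 : f ⁻¹' (chartAt E (f y)).source ∈ nhds y :=
    hf.continuousAt ((chartAt E (f y)).open_source.mem_nhds (mem_chart_source E (f y)))
  have : IsManifold 𝓘(ℝ, E) 1 N := IsManifold.of_le (n := ∞) (by simp)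
  have h2 : ∀ᶠ y' in nhds y, ContMDiffAt 𝓘(ℝ, V) 𝓘(ℝ, E) 1 f y' :=
    (contMDiffAt_iff_contMDiffAt_nhds (by simp)).1 (hf.of_le (by simp))
  filter_upwards [h1, h2] with y' hy' hfy'
  have hκ := isSmoothCoord_chartAt (E := E) (f y)
  ext v
  simp only [pullForm, ContinuousLinearMap.comp_apply, (chartAt E (f y)).left_inv hy']
  congr 1
  rw [← mD_eq_fderiv, mD_comp_apply rfl (hκ.mdifferentiableAt hy')
    (hfy'.mdifferentiableAt (by simp)), hκ.mD_symm_mD hy']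

theorem contDiffAt_chartAt_comp (hf : ContMDiffAt 𝓘(ℝ, V) 𝓘(ℝ, E) ∞ f y) :
    ContDiffAt ℝ ∞ (fun y' ↦ chartAt E (f y) (f y')) y :=
  (((isSmoothCoord_chartAt (E := E) (f y)).contMDiffAt
    (mem_chart_source E (f y))).comp y hf).contDiffAt

theorem SmoothOneForm.contDiffAt_pullForm (hα : SmoothOneForm α)
    (hf : ContMDiffAt 𝓘(ℝ, V) 𝓘(ℝ, E) ∞ f y) : ContDiffAt ℝ ∞ (pullForm α f) y := by
  refine ContDiffAt.congr_of_eventuallyEq ?_ (pullForm_eventuallyEq hf)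
  have h := contDiffAt_chartAt_comp hf
  exact ((hα (f y)).comp y h).clm_comp (h.fderiv_right (m := ∞) (by simp))

/-- The exterior derivative commutes with pullbacks. -/
theorem SmoothOneForm.extDerivOneForm_eq (hα : SmoothOneForm α)
    (hf : ContMDiffAt 𝓘(ℝ, V) 𝓘(ℝ, E) ∞ f y) (v w : V) :
    extDerivOneForm 𝓘(ℝ, E) (fun u w ↦ α u w) (f y) (mD 𝓘(ℝ, V) 𝓘(ℝ, E) f y v)
      (mD 𝓘(ℝ, V) 𝓘(ℝ, E) f y w) = dForm (pullForm α f) y v w := by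
  set β := pullForm α (chartAt E (f y)).symm
  set h := fun y' ↦ chartAt E (f y) (f y')
  have hh : ContDiffAt ℝ ∞ h y := contDiffAt_chartAt_comp hf
  have hβ : DifferentiableAt ℝ β (h y) := (hα (f y)).differentiableAt (by simp)
  have hdh : ∀ v, mD 𝓘(ℝ, V) 𝓘(ℝ, E) f y v = fderiv ℝ h y v := by
    intro v
    have hκ := isSmoothCoord_chartAt (E := E) (f y)
    rw [← mD_eq_fderiv, mD_comp_apply rfl (hκ.mdifferentiableAt (mem_chart_source E (f y)))
      (hf.mdifferentiableAt (by simp)), mD_chartAt_self]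
  have h1 : ∀ a b : E, extDerivOneForm 𝓘(ℝ, E) (fun u w ↦ α u w) (f y) a b =
      fderiv ℝ β (h y) a b - fderiv ℝ β (h y) b a := by
    intro a b
    have h2 : ∀ a b : E, fderiv ℝ (fun p ↦ β p a) (h y) b = fderiv ℝ β (h y) b a := by
      intro a b
      have := (hβ.hasFDerivAt.clm_apply (hasFDerivAt_const a (h y))).fderiv
      rw [this]
      simp
    exact congrArg₂ (· - ·) (h2 b a) (h2 a b)
  rw [hdh, hdh, h1]
  have h3 := (hβ.hasFDerivAt.comp y (hh.differentiableAt (by simp)).hasFDerivAt).clm_comp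
    ((hh.fderiv_right (m := ∞) (by simp)).differentiableAt (by simp)).hasFDerivAt
  have h4 : fderiv ℝ (pullForm α f) y = _ :=
    (h3.congr_of_eventuallyEq (pullForm_eventuallyEq hf)).fderiv
  -- The terms with second derivatives of `f` cancel in the antisymmetrization.
  have h5 : fderiv ℝ (fderiv ℝ h) y v w = fderiv ℝ (fderiv ℝ h) y w v :=
    (hh.isSymmSndFDerivAt (by simpa using two_le_infty)).eq v w
  simp only [dForm, h4]
  simp [h5]

end Forms

/-! ### Smoothness of a connection form in charts -/

namespace PrincipalBundle

variable {EM : Type*} [NormedAddCommGroup EM] [NormedSpace ℝ EM]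
  {M : Type*} [TopologicalSpace M] [ChartedSpace EM M]
  {EP : Type*} [NormedAddCommGroup EP] [NormedSpace ℝ EP] [FiniteDimensional ℝ EP]
  {P : Type*} [TopologicalSpace P] [ChartedSpace EP P] [IsManifold 𝓘(ℝ, EP) ∞ P]
  {EG : Type*} [NormedAddCommGroup EG] [NormedSpace ℂ EG]
  {G : Type*} [TopologicalSpace G] [ChartedSpace EG G] [Group G]
  {B : PrincipalBundle EM M EP P EG G}

/-- The connection form is given as smooth on the tangent bundle. In finite dimension, smoothness of
the family of linear maps can be tested on constant coordinate fields, which are smooth sections of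
that bundle. -/
theorem Connection.smoothOneForm (c : B.Connection) : SmoothOneForm c.formE := by
  intro u
  have hκ := isSmoothCoord_chartAt (E := EP) u
  have hmem : (chartAt EP u).target ∈ nhds (chartAt EP u u) :=
    (chartAt EP u).open_target.mem_nhds (mem_chart_target EP u)
  suffices h : ContDiffOn ℝ ∞ (pullForm c.formE (chartAt EP u).symm) (chartAt EP u).target from
    h.contDiffAt hmem
  rw [contDiffOn_clm_apply]
  intro e
  have h1 := hκ.contMDiffOn_field (a := fun _ ↦ e) isOpen_univ contDiffOn_const
  have h2 : ContMDiffOn 𝓘(ℝ, EP) 𝓘(ℝ, EG) ∞ (fun p ↦ c.formE ((chartAt EP u).symm p)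
      (mD 𝓘(ℝ, EP) 𝓘(ℝ, EP) (chartAt EP u).symm (chartAt EP u ((chartAt EP u).symm p)) e))
      (chartAt EP u).target :=
    (c.smooth.comp_contMDiffOn h1).comp hκ.smooth_symm
      fun p hp ↦ ⟨(chartAt EP u).map_target hp, mem_univ _⟩
  refine (contMDiffOn_iff_contDiffOn.1 h2).congr fun p hp ↦ ?_
  simp only [(chartAt EP u).right_inv hp]
  rfl

end PrincipalBundle

/-! ### Local sections which are horizontal at a point -/

namespace PrincipalBundle

variable {EM : Type*} [NormedAddCommGroup EM] [NormedSpace ℝ EM]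
  {M : Type*} [TopologicalSpace M] [ChartedSpace EM M] [IsManifold 𝓘(ℝ, EM) ∞ M]
  {EP : Type*} [NormedAddCommGroup EP] [NormedSpace ℝ EP]
  {P : Type*} [TopologicalSpace P] [ChartedSpace EP P] [IsManifold 𝓘(ℝ, EP) ∞ P]
  {EG : Type*} [NormedAddCommGroup EG] [NormedSpace ℂ EG]
  {G : Type*} [TopologicalSpace G] [ChartedSpace EG G] [Group G] [LieGroup 𝓘(ℂ, EG) ω G]
  {B : PrincipalBundle EM M EP P EG G}

/-- The change of a local trivialization by a function with values in the structure group. -/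
def gaugeTriv (σ : B.Triv) (g : M → G) (U : Set M) (hU : IsOpen U)
    (hg : ContMDiffOn 𝓘(ℝ, EM) 𝓘(ℝ, EG) ∞ g U) : B.Triv where
  base := σ.base ∩ U
  isOpen_base := σ.isOpen_base.inter hU
  sec x := B.act (σ.sec x) (g x)
  coord u := (g (B.proj u))⁻¹ * σ.coord u
  contMDiffOn_sec := B.contMDiff_act.comp_contMDiffOn
    ((σ.contMDiffOn_sec.mono inter_subset_left).prodMk (hg.mono inter_subset_right))
  contMDiffOn_coord := by
    have h1 : ContMDiffOn 𝓘(ℝ, EP) 𝓘(ℝ, EG) ∞ (fun u ↦ g (B.proj u)) (B.proj ⁻¹' (σ.base ∩ U)) :=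
      hg.comp B.contMDiff_proj.contMDiffOn fun u hu ↦ hu.2
    have h2 : ContMDiff 𝓘(ℝ, EG) 𝓘(ℝ, EG) ∞ (fun g : G ↦ g⁻¹) := fun g ↦
      contMDiffAt_real_of_complex (contMDiff_inv 𝓘(ℂ, EG) ω g)
    have h3 := contMDiff_real_of_complex (contMDiff_mul 𝓘(ℂ, EG) ω (G := G))
    exact h3.comp_contMDiffOn ((h2.comp_contMDiffOn h1).prodMk
      (σ.contMDiffOn_coord.mono fun u hu ↦ hu.1))
  proj_sec x hx := (B.proj_act _ _).trans (σ.proj_sec x hx.1)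
  act_coord u hu := by
    rw [B.act_mul, ← B.act_mul _ (g _), mul_inv_cancel, B.act_one, σ.act_coord u hu.1]
  coord_act x hx h := by
    rw [B.proj_act, B.proj_act, σ.proj_sec x hx.1, ← B.act_mul, σ.coord_act x hx.1,
      inv_mul_cancel_left]

/-- A change of gauge by `g` with `g x₀ = 1` changes the local connection form at `x₀` from `A` to
`A + dg`. It therefore suffices to find such a `g` with derivative `-A` at `x₀`; an affine map in
charts of `M` and `G` will do. The condition at `x₀` makes the new section pass through the
reference point, so that tensors computed with `B.pt x₀` can be read off it. -/
theorem Connection.exists_triv_horizontal (c : B.Connection) (x₀ : M) :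
    ∃ τ : B.Triv, x₀ ∈ τ.base ∧ τ.sec x₀ = B.pt x₀ ∧ c.secForm τ x₀ = 0 := by
  let σ := B.trivAt x₀
  have hσ : x₀ ∈ σ.base := B.mem_trivAt x₀
  let φ := chartAt EM x₀
  let ψ := chartAt EG (1 : G)
  have hφ : IsSmoothCoord 𝓘(ℝ, EM) φ := isSmoothCoord_chartAt x₀
  have hψ : IsSmoothCoord 𝓘(ℝ, EG) ψ := isSmoothCoord_chartAt 1
  have hx₀ : x₀ ∈ φ.source := mem_chart_source EM x₀
  have h1 : (1 : G) ∈ ψ.source := mem_chart_source EG 1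
  -- The derivative prescribed for `g`, namely `-A` at `x₀`, transferred to the charts.
  let l : EM →L[ℝ] EG := -((mD 𝓘(ℝ, EG) 𝓘(ℝ, EG) ψ 1).comp ((c.secForm σ x₀).comp
    (mD 𝓘(ℝ, EM) 𝓘(ℝ, EM) φ.symm (φ x₀))))
  let k (y : EM) : EG := ψ 1 + l (y - φ x₀)
  have hk : ContDiff ℝ ∞ k := contDiff_const.add (l.contDiff.comp (contDiff_id.sub contDiff_const))
  have hk0 : k (φ x₀) = ψ 1 := by simp [k]
  have hkd : fderiv ℝ k (φ x₀) = l := by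
    have h : HasFDerivAt (fun y ↦ l (y - φ x₀)) l (φ x₀) :=
      l.hasFDerivAt.comp (φ x₀) ((hasFDerivAt_id (φ x₀)).sub_const (φ x₀))
    exact (h.const_add (ψ 1)).fderiv
  let g (x : M) : G := ψ.symm (k (φ x))
  have hg1 : g x₀ = 1 := by
    simp only [g, hk0]
    exact ψ.left_inv h1
  let U : Set M := φ.source ∩ φ ⁻¹' (k ⁻¹' ψ.target)
  have hU : IsOpen U := φ.isOpen_inter_preimage (ψ.open_target.preimage hk.continuous)
  have hxU : x₀ ∈ U := ⟨hx₀, by simp only [mem_preimage, hk0]; exact ψ.map_source h1⟩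
  have hg : ContMDiffOn 𝓘(ℝ, EM) 𝓘(ℝ, EG) ∞ g U :=
    hψ.smooth_symm.comp (hk.contMDiff.comp_contMDiffOn (hφ.smooth.mono inter_subset_left))
      fun x hx ↦ hx.2
  have hgd : MDifferentiableAt 𝓘(ℝ, EM) 𝓘(ℝ, EG) g x₀ :=
    (hg.contMDiffAt (hU.mem_nhds hxU)).mdifferentiableAt (by simp)
  have hkm : MDifferentiableAt 𝓘(ℝ, EM) 𝓘(ℝ, EG) k (φ x₀) :=
    hk.contMDiff.mdifferentiableAt (by simp)
  have hdg : ∀ v, mD 𝓘(ℝ, EM) 𝓘(ℝ, EG) g x₀ v = -c.secForm σ x₀ v := by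
    intro v
    have h2 := mD_comp_apply (f := fun x ↦ k (φ x)) (g := ψ.symm) hk0
      (hψ.mdifferentiableAt_symm (ψ.map_source h1))
      (MDifferentiableAt.comp x₀ (g := k) hkm (hφ.mdifferentiableAt hx₀)) v
    refine h2.trans ?_
    rw [mD_comp_apply rfl hkm (hφ.mdifferentiableAt hx₀), mD_eq_fderiv, hkd]
    simp only [l, neg_apply, ContinuousLinearMap.comp_apply, map_neg]
    rw [hφ.mD_symm_mD hx₀, hψ.mD_symm_mD h1]
  have hsec : (gaugeTriv σ g U hU hg).sec x₀ = σ.sec x₀ := by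
    change B.act (σ.sec x₀) (g x₀) = σ.sec x₀
    rw [hg1, B.act_one]
  refine ⟨gaugeTriv σ g U hU hg, ⟨hσ, hxU⟩, hsec, ?_⟩
  ext v
  change c.formE ((gaugeTriv σ g U hU hg).sec x₀)
    (mD 𝓘(ℝ, EM) 𝓘(ℝ, EP) (fun x ↦ B.act (σ.sec x) (g x)) x₀ v) = 0
  -- Derivative of the product `sec · g` at `x₀`: since `g x₀ = 1`, it is the derivative of the
  -- section plus the fundamental vector of `dg = -A`, and the two contributions to the connection
  -- form cancel.
  have h3 := mD_comp₂ (h := fun z : P × G ↦ B.act z.1 z.2) (f := σ.sec) (g := g) (x := x₀) rfl hg1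
    (B.mdifferentiableAt_act _) (mdifferentiableAt_sec σ hσ) hgd v
  have h4 : (fun y ↦ B.act y 1) = fun y ↦ y := funext B.act_one
  rw [hsec, h3]
  simp only [h4, mD_id, hdg]
  rw [map_add, map_neg, map_neg]
  change c.secForm σ x₀ v + -c.formE (σ.sec x₀) (mD _ _ (B.act (σ.sec x₀)) 1 _) = 0
  rw [c.formE_mD_act_right, add_neg_cancel]

namespace Connection

variable (c : B.Connection) (τ : B.Triv)

/-- The pullback of the connection form by a local section, in the chart of `M` at `x₀`. -/
noncomputable def localForm (x₀ : M) : EM → EM →L[ℝ] EG :=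
  pullForm c.formE (fun y ↦ τ.sec ((chartAt EM x₀).symm y))

variable {τ} {x₀ : M}

omit [LieGroup 𝓘(ℂ, EG) ω G] [IsManifold 𝓘(ℝ, EP) ∞ P] in
theorem _root_.PrincipalBundle.contMDiffAt_sec_chart {y : EM} (hy : y ∈ (chartAt EM x₀).target)
    (hyτ : (chartAt EM x₀).symm y ∈ τ.base) :
    ContMDiffAt 𝓘(ℝ, EM) 𝓘(ℝ, EP) ∞ (fun y ↦ τ.sec ((chartAt EM x₀).symm y)) y :=
  ContMDiffAt.comp y (τ.contMDiffOn_sec.contMDiffAt (τ.isOpen_base.mem_nhds hyτ))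
    ((isSmoothCoord_chartAt x₀).contMDiffAt_symm hy)

omit [LieGroup 𝓘(ℂ, EG) ω G] [IsManifold 𝓘(ℝ, EP) ∞ P] in
theorem _root_.PrincipalBundle.mD_sec_chart {y : EM} (hy : y ∈ (chartAt EM x₀).target)
    (hyτ : (chartAt EM x₀).symm y ∈ τ.base) (v : EM) :
    mD 𝓘(ℝ, EM) 𝓘(ℝ, EP) (fun y ↦ τ.sec ((chartAt EM x₀).symm y)) y v =
      mD 𝓘(ℝ, EM) 𝓘(ℝ, EP) τ.sec ((chartAt EM x₀).symm y)
        (mD 𝓘(ℝ, EM) 𝓘(ℝ, EM) (chartAt EM x₀).symm y v) :=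
  mD_comp_apply rfl (mdifferentiableAt_sec τ hyτ)
    ((isSmoothCoord_chartAt x₀).mdifferentiableAt_symm hy) v

omit [LieGroup 𝓘(ℂ, EG) ω G] in
theorem localForm_apply {y : EM} (hy : y ∈ (chartAt EM x₀).target)
    (hyτ : (chartAt EM x₀).symm y ∈ τ.base) (v : EM) :
    c.localForm τ x₀ y v = c.secForm τ ((chartAt EM x₀).symm y)
      (mD 𝓘(ℝ, EM) 𝓘(ℝ, EM) (chartAt EM x₀).symm y v) := by
  simp only [localForm, pullForm, ContinuousLinearMap.comp_apply, mD_sec_chart hy hyτ]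
  rfl

omit [LieGroup 𝓘(ℂ, EG) ω G] in
theorem localForm_eq_zero (hx : x₀ ∈ τ.base) (h0 : c.secForm τ x₀ = 0) :
    c.localForm τ x₀ (chartAt EM x₀ x₀) = 0 := by
  have h1 : (chartAt EM x₀).symm (chartAt EM x₀ x₀) = x₀ :=
    (chartAt EM x₀).left_inv (mem_chart_source EM x₀)
  ext v
  rw [c.localForm_apply (mem_chart_target EM x₀) (by rwa [h1]), h1, h0]
  rfl

omit [LieGroup 𝓘(ℂ, EG) ω G] in
theorem contDiffAt_localForm [FiniteDimensional ℝ EP] {y : EM} (hy : y ∈ (chartAt EM x₀).target)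
    (hyτ : (chartAt EM x₀).symm y ∈ τ.base) : ContDiffAt ℝ ∞ (c.localForm τ x₀) y :=
  c.smoothOneForm.contDiffAt_pullForm (contMDiffAt_sec_chart hy hyτ)

-- The section is horizontal at `x₀` and the chart has identity derivative there, so the derivative
-- of the section in coordinates is the horizontal lift. Exterior derivatives evaluated on lifts
-- thereby become exterior derivatives of pullbacks by the section.
omit [LieGroup 𝓘(ℂ, EG) ω G] in
theorem lift_pt (hx : x₀ ∈ τ.base) (hpt : τ.sec x₀ = B.pt x₀) (h0 : c.secForm τ x₀ = 0) (v : EM) :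
    c.lift (B.pt x₀) v =
      mD 𝓘(ℝ, EM) 𝓘(ℝ, EP) (fun y ↦ τ.sec ((chartAt EM x₀).symm y)) (chartAt EM x₀ x₀) v := by
  have h1 : (chartAt EM x₀).symm (chartAt EM x₀ x₀) = x₀ :=
    (chartAt EM x₀).left_inv (mem_chart_source EM x₀)
  rw [mD_sec_chart (mem_chart_target EM x₀) (by rwa [h1]), h1]
  have h2 := (isSmoothCoord_chartAt (E := EM) x₀).mD_symm_mD (mem_chart_source EM x₀) v
  rw [mD_chartAt_self] at h2
  rw [h2, ← c.lift_eq hx h0]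
  have h3 : ∀ u, u = B.pt x₀ → (c.lift (B.pt x₀) v : EP) = c.lift u v := by
    rintro _ rfl
    rfl
  exact h3 _ hpt

omit [LieGroup 𝓘(ℂ, EG) ω G] in
/-- The curvature, by means of a local section which is horizontal at the point. -/
theorem curvature_pt [FiniteDimensional ℝ EP] (hx : x₀ ∈ τ.base) (hpt : τ.sec x₀ = B.pt x₀)
    (h0 : c.secForm τ x₀ = 0) (v w : EM) :
    c.curvature (B.pt x₀) v w = dForm (c.localForm τ x₀) (chartAt EM x₀ x₀) v w := by
  have h1 : (chartAt EM x₀).symm (chartAt EM x₀ x₀) = x₀ :=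
    (chartAt EM x₀).left_inv (mem_chart_source EM x₀)
  have h2 := c.smoothOneForm.extDerivOneForm_eq
    (contMDiffAt_sec_chart (τ := τ) (mem_chart_target EM x₀) (by rwa [h1])) v w
  rw [← c.lift_pt hx hpt h0, ← c.lift_pt hx hpt h0] at h2
  refine Eq.trans ?_ h2
  have h3 : ∀ u, u = B.pt x₀ → (c.curvature (B.pt x₀) v w : EG) =
      extDerivOneForm 𝓘(ℝ, EP) (fun u w ↦ c.formE u w) u (c.lift (B.pt x₀) v)
        (c.lift (B.pt x₀) w) := by
    rintro _ rfl
    rfl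
  exact h3 _ (by rw [h1, hpt])

end Connection

end PrincipalBundle

/-! ### The canonical form of a bundle of frames -/

/-- A map with values in the linear maps of a finite-dimensional space is smooth if it is so when
applied to each vector. -/
theorem contDiffAt_clm_of_apply {D E F : Type*} [NormedAddCommGroup D] [NormedSpace ℝ D]
    [NormedAddCommGroup E] [NormedSpace ℝ E] [FiniteDimensional ℝ E] [NormedAddCommGroup F]
    [NormedSpace ℝ F] {n : ℕ∞ω} {f : D → E →L[ℝ] F} {x : D}
    (h : ∀ y, ContDiffAt ℝ n (fun x ↦ f x y) x) : ContDiffAt ℝ n f x := by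
  let d := Module.finrank ℝ E
  have hd : d = Module.finrank ℝ (Fin d → ℝ) := (Module.finrank_fin_fun ℝ).symm
  let e₁ := ContinuousLinearEquiv.ofFinrankEq hd
  let e₂ := (e₁.arrowCongr (1 : F ≃L[ℝ] F)).trans (ContinuousLinearEquiv.piRing (Fin d))
  rw [← Function.id_comp f, ← e₂.symm_comp_self]
  exact e₂.symm.contDiff.contDiffAt.comp x (contDiffAt_pi.mpr fun i ↦ h _)

/-- A complexified real vector space, as a real vector space, is the square of the space. -/
noncomputable def complexEquiv (E : Type*) [AddCommGroup E] [Module ℝ E] :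
    (ℂ ⊗[ℝ] E) ≃ₗ[ℝ] E × E where
  toFun X := (reC E X, imC E X)
  map_add' X Y := by simp
  map_smul' r X := by simp
  invFun a := (1 : ℂ) ⊗ₜ[ℝ] a.1 + Complex.I ⊗ₜ[ℝ] a.2
  left_inv X := (eq_reC_add_imC X).symm
  right_inv a := Prod.ext (reC_mk _ _) (imC_mk _ _)

namespace FrameInclusion

variable {EM : Type*} [NormedAddCommGroup EM] [NormedSpace ℝ EM]
  {M : Type*} [TopologicalSpace M] [ChartedSpace EM M] [IsManifold 𝓘(ℝ, EM) ∞ M]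
  {EP : Type*} [NormedAddCommGroup EP] [NormedSpace ℝ EP]
  {P : Type*} [TopologicalSpace P] [ChartedSpace EP P] [IsManifold 𝓘(ℝ, EP) ∞ P]
  {EG : Type*} [NormedAddCommGroup EG] [NormedSpace ℂ EG]
  {G : Type*} [TopologicalSpace G] [ChartedSpace EG G] [Group G] {m : ℕ}
  {B : PrincipalBundle EM M EP P EG G} {L : LieSubgroupGL m EG G} (e : FrameInclusion B L)

/-- A frame, with values in the complexified model space. -/
noncomputable def frameE (u : P) : (Fin m → ℂ) ≃ₗ[ℂ] ℂ ⊗[ℝ] EM := e.frame u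

omit [IsManifold 𝓘(ℝ, EP) ∞ P] in
theorem frameE_act (u : P) (g : G) (ξ : Fin m → ℂ) :
    e.frameE (B.act u g) ξ = e.frameE u (L.rep g ξ) := e.frame_act u g ξ

/-- The real isomorphism given by the real and imaginary parts of a frame. -/
noncomputable def frameRI (u : P) : (Fin m → ℂ) ≃L[ℝ] EM × EM :=
  (((e.frameE u).restrictScalars ℝ).trans (complexEquiv EM)).toContinuousLinearEquiv

omit [IsManifold 𝓘(ℝ, EP) ∞ P] in
theorem frameRI_symm_apply (u : P) (a b : EM) :
    (e.frameRI u).symm (a, b) = (e.frameE u).symm ((1 : ℂ) ⊗ₜ[ℝ] a + Complex.I ⊗ₜ[ℝ] b) := rfl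

/-- The canonical form, as a linear map of the model spaces. -/
noncomputable def canonE (u : P) : EP →L[ℝ] (Fin m → ℂ) :=
  ((e.frameRI u).symm : EM × EM →L[ℝ] (Fin m → ℂ)).comp
    ((ContinuousLinearMap.inl ℝ EM EM).comp (mD 𝓘(ℝ, EP) 𝓘(ℝ, EM) B.proj u))

omit [IsManifold 𝓘(ℝ, EP) ∞ P] in
theorem canonE_apply (u : P) (w : EP) :
    e.canonE u w = (e.frameE u).symm ((1 : ℂ) ⊗ₜ[ℝ] mD 𝓘(ℝ, EP) 𝓘(ℝ, EM) B.proj u w) := by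
  change (e.frameRI u).symm (mD 𝓘(ℝ, EP) 𝓘(ℝ, EM) B.proj u w, 0) = _
  rw [frameRI_symm_apply, TensorProduct.tmul_zero, add_zero]

omit [IsManifold 𝓘(ℝ, EP) ∞ P] in
theorem canonicalForm_eq (u : P) (w : EP) : e.canonicalForm u w = e.canonE u w :=
  (e.canonE_apply u w).symm

/-- Real and imaginary parts make a frame a real isomorphism of `ℂ^m` with `EM × EM`. In a chart of
`M` this isomorphism depends smoothly on the point, as is checked on each vector of `ℂ^m`; its
inverse is then smooth too, and the canonical form is that inverse applied to `(dπ, 0)`. -/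
theorem smoothOneForm_canonE [FiniteDimensional ℝ EP] : SmoothOneForm e.canonE := by
  intro u₀
  set κ := chartAt EP u₀
  set φ := chartAt EM (B.proj u₀)
  have hκ : IsSmoothCoord 𝓘(ℝ, EP) κ := isSmoothCoord_chartAt u₀
  have hφ : IsSmoothCoord 𝓘(ℝ, EM) φ := isSmoothCoord_chartAt (B.proj u₀)
  have hu₀ : u₀ ∈ κ.source := mem_chart_source EP u₀
  have hx₀ : B.proj u₀ ∈ φ.source := mem_chart_source EM _
  have hκu : κ.symm (κ u₀) = u₀ := κ.left_inv hu₀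
  have hκs : ContMDiffAt 𝓘(ℝ, EP) 𝓘(ℝ, EP) ∞ κ.symm (κ u₀) :=
    hκ.contMDiffAt_symm (κ.map_source hu₀)
  have hopen : IsOpen (κ.target ∩ κ.symm ⁻¹' (B.proj ⁻¹' φ.source)) :=
    κ.symm.isOpen_inter_preimage (φ.open_source.preimage B.contMDiff_proj.continuous)
  have hmem : κ.target ∩ κ.symm ⁻¹' (B.proj ⁻¹' φ.source) ∈ nhds (κ u₀) :=
    hopen.mem_nhds ⟨κ.map_source hu₀, by simpa only [mem_preimage, hκu] using hx₀⟩
  -- the frame in the chart of `M`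
  let Rm (p : EP) (hp : B.proj (κ.symm p) ∈ φ.source) : (Fin m → ℂ) ≃L[ℝ] EM × EM :=
    (e.frameRI (κ.symm p)).trans ((hφ.equiv hp).prodCongr (hφ.equiv hp))
  let R (p : EP) : (Fin m → ℂ) →L[ℝ] EM × EM :=
    ((mD 𝓘(ℝ, EM) 𝓘(ℝ, EM) φ (B.proj (κ.symm p))).prodMap
      (mD 𝓘(ℝ, EM) 𝓘(ℝ, EM) φ (B.proj (κ.symm p)))).comp
      (e.frameRI (κ.symm p) : (Fin m → ℂ) →L[ℝ] EM × EM)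
  have hRm : ∀ p hp, R p = Rm p hp := fun p hp ↦ rfl
  have hsm : ∀ u, ∀ {v : P → EM}, ContMDiff 𝓘(ℝ, EP) 𝓘(ℝ, EM).tangent ∞
      (fun u ↦ (⟨B.proj u, v u⟩ : TangentBundle 𝓘(ℝ, EM) M)) → u = u₀ →
      ContMDiffAt 𝓘(ℝ, EP) 𝓘(ℝ, EM) ∞ (fun u ↦ mD 𝓘(ℝ, EM) 𝓘(ℝ, EM) φ (B.proj u) (v u)) u := by
    rintro u v hv rfl
    exact contMDiffAt_mD_chartAt (hv u)
  have hR : ContDiffAt ℝ ∞ R (κ u₀) := by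
    have hRξ : ∀ ξ, ContDiffAt ℝ ∞ (fun p ↦ R p ξ) (κ u₀) := by
      intro ξ
      have h1 := (hsm _ (e.smooth_re ξ) hκu).comp (κ u₀) hκs
      have h2 := (hsm _ (e.smooth_im ξ) hκu).comp (κ u₀) hκs
      exact h1.contDiffAt.prodMk h2.contDiffAt
    exact contDiffAt_clm_of_apply hRξ
  let h (p : EP) : EM := φ (B.proj (κ.symm p))
  have hh : ContDiffAt ℝ ∞ h (κ u₀) := by
    have h1 : ContMDiffAt 𝓘(ℝ, EP) 𝓘(ℝ, EM) ∞ (fun p ↦ B.proj (κ.symm p)) (κ u₀) :=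
      B.contMDiff_proj.contMDiffAt.comp (κ u₀) hκs
    exact (ContMDiffAt.comp (κ u₀) (g := φ) (by rw [hκu]; exact hφ.contMDiffAt hx₀) h1).contDiffAt
  have hinv : ContDiffAt ℝ ∞ (fun p ↦ (R p).inverse) (κ u₀) := by
    have hx : B.proj (κ.symm (κ u₀)) ∈ φ.source := by rwa [hκu]
    have h1 := contDiffAt_map_inverse (𝕜 := ℝ) (n := ∞) (Rm (κ u₀) hx)
    exact ContDiffAt.comp (κ u₀) (g := ContinuousLinearMap.inverse) (f := R) h1 hR
  refine ContDiffAt.congr_of_eventuallyEq (hinv.clm_comp ((contDiffAt_const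
    (c := ContinuousLinearMap.inl ℝ EM EM)).clm_comp (hh.fderiv_right (m := ∞) (by simp)))) ?_
  filter_upwards [hmem] with p hp
  have hκp : MDifferentiableAt 𝓘(ℝ, EP) 𝓘(ℝ, EP) κ.symm p := hκ.mdifferentiableAt_symm hp.1
  have hder : ∀ w, fderiv ℝ h p w = mD 𝓘(ℝ, EM) 𝓘(ℝ, EM) φ (B.proj (κ.symm p))
      (mD 𝓘(ℝ, EP) 𝓘(ℝ, EM) B.proj (κ.symm p) (mD 𝓘(ℝ, EP) 𝓘(ℝ, EP) κ.symm p w)) := by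
    intro w
    rw [← mD_eq_fderiv, mD_comp_apply (f := fun p ↦ B.proj (κ.symm p)) rfl
      (hφ.mdifferentiableAt hp.2) ((B.mdifferentiableAt_proj _).comp p hκp),
      mD_comp_apply rfl (B.mdifferentiableAt_proj _) hκp]
  ext1 w
  have h1 : (R p).inverse = ((Rm p hp.2).symm : EM × EM →L[ℝ] (Fin m → ℂ)) := by
    rw [hRm p hp.2, ContinuousLinearMap.inverse_equiv]
  change (e.frameRI (κ.symm p)).symm (mD 𝓘(ℝ, EP) 𝓘(ℝ, EM) B.proj (κ.symm p)
    (mD 𝓘(ℝ, EP) 𝓘(ℝ, EP) κ.symm p w), 0) = (R p).inverse (fderiv ℝ h p w, 0)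
  rw [h1, hder]
  change _ = (Rm p hp.2).symm _
  rw [ContinuousLinearEquiv.eq_symm_apply]
  change ((hφ.equiv hp.2).prodCongr (hφ.equiv hp.2)) (e.frameRI (κ.symm p)
    ((e.frameRI (κ.symm p)).symm _)) = _
  rw [ContinuousLinearEquiv.apply_symm_apply]
  exact Prod.ext rfl (map_zero (hφ.equiv hp.2))

variable {x₀ : M} {τ : B.Triv}

/-- The pullback of the canonical form by a local section, in the chart of `M` at `x₀`. -/
noncomputable def localCanon (τ : B.Triv) (x₀ : M) : EM → EM →L[ℝ] (Fin m → ℂ) :=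
  pullForm e.canonE (fun y ↦ τ.sec ((chartAt EM x₀).symm y))

theorem contDiffAt_localCanon [FiniteDimensional ℝ EP] {y : EM} (hy : y ∈ (chartAt EM x₀).target)
    (hyτ : (chartAt EM x₀).symm y ∈ τ.base) : ContDiffAt ℝ ∞ (e.localCanon τ x₀) y :=
  e.smoothOneForm_canonE.contDiffAt_pullForm (PrincipalBundle.contMDiffAt_sec_chart hy hyτ)

omit [IsManifold 𝓘(ℝ, EP) ∞ P] in
theorem localCanon_apply {y : EM} (hy : y ∈ (chartAt EM x₀).target)
    (hyτ : (chartAt EM x₀).symm y ∈ τ.base) (v : EM) :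
    e.localCanon τ x₀ y v = (e.frameE (τ.sec ((chartAt EM x₀).symm y))).symm
      ((1 : ℂ) ⊗ₜ[ℝ] mD 𝓘(ℝ, EM) 𝓘(ℝ, EM) (chartAt EM x₀).symm y v) := by
  simp only [localCanon, pullForm, ContinuousLinearMap.comp_apply,
    PrincipalBundle.mD_sec_chart hy hyτ]
  rw [canonE_apply, PrincipalBundle.mD_proj_sec τ hyτ]

/-- The torsion form, by means of a local section which is horizontal at the point. -/
theorem torsionForm_pt [FiniteDimensional ℝ EP] (c : B.Connection) (hx : x₀ ∈ τ.base)
    (hpt : τ.sec x₀ = B.pt x₀) (h0 : c.secForm τ x₀ = 0) (v w : EM) :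
    e.torsionForm c (B.pt x₀) v w = dForm (e.localCanon τ x₀) (chartAt EM x₀ x₀) v w := by
  have h1 : (chartAt EM x₀).symm (chartAt EM x₀ x₀) = x₀ :=
    (chartAt EM x₀).left_inv (mem_chart_source EM x₀)
  have h2 := e.smoothOneForm_canonE.extDerivOneForm_eq
    (PrincipalBundle.contMDiffAt_sec_chart (τ := τ) (mem_chart_target EM x₀) (by rwa [h1])) v w
  rw [← c.lift_pt hx hpt h0, ← c.lift_pt hx hpt h0] at h2
  refine Eq.trans ?_ h2
  have h3 : ∀ u, u = B.pt x₀ → (e.torsionForm c (B.pt x₀) v w : Fin m → ℂ) =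
      extDerivOneForm 𝓘(ℝ, EP) (fun u w ↦ e.canonE u w) u (c.lift (B.pt x₀) v)
        (c.lift (B.pt x₀) w) := by
    rintro _ rfl
    have h4 : e.canonicalForm = fun u w ↦ e.canonE u w := by
      funext u w
      exact e.canonicalForm_eq u w
    change extDerivOneForm 𝓘(ℝ, EP) e.canonicalForm _ _ _ = _
    rw [h4]
    rfl
  exact h3 _ (by rw [h1, hpt])

end FrameInclusion

/-! ### Coordinates on associated bundles -/

section Atlas

variable {E : Type*} [NormedAddCommGroup E] [NormedSpace ℝ E]
  {H : Type*} [TopologicalSpace H] {I : ModelWithCorners ℝ E H}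
  {N : Type*} [TopologicalSpace N] [ChartedSpace H N]

/-- A chart of a manifold without boundary is a smooth coordinate system. -/
theorem isSmoothCoord_of_mem_atlas [IsManifold I ∞ N] (κ : H ≃ₜ E) (hκ : ∀ h, κ h = I h)
    {Φ : OpenPartialHomeomorph N H} (hΦ : Φ ∈ atlas H N) :
    IsSmoothCoord I (Φ ≫ₕ κ.toOpenPartialHomeomorph) := by
  have hΦ' := StructureGroupoid.subset_maximalAtlas (contDiffGroupoid ∞ I) hΦ
  have hκ' : (κ : H → E) = I := funext hκ
  have hr : range I = univ := by rw [← hκ']; exact κ.surjective.range_eq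
  have hsymm : (κ.symm : E → H) = I.symm := by
    funext y
    obtain ⟨h, rfl⟩ := κ.surjective y
    rw [κ.symm_apply_apply, hκ, I.left_inv]
  refine ⟨?_, ?_⟩
  · have h1 : ContMDiffOn I 𝓘(ℝ, E) ∞ (fun z ↦ I (Φ z)) Φ.source :=
      I.contMDiff.comp_contMDiffOn (contMDiffOn_of_mem_maximalAtlas hΦ')
    rw [← hκ'] at h1
    exact h1.mono fun z hz ↦ hz.1
  · have h1 : ContMDiffOn 𝓘(ℝ, E) I ∞ I.symm univ := hr ▸ I.contMDiffOn_symm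
    have h2 : ContMDiffOn 𝓘(ℝ, E) I ∞ (fun y ↦ Φ.symm (I.symm y)) (I.symm ⁻¹' Φ.target) :=
      (contMDiffOn_symm_of_mem_maximalAtlas hΦ').comp (h1.mono (subset_univ _)) fun y hy ↦ hy
    rw [← hsymm] at h2
    exact h2.mono fun y hy ↦ hy.2

theorem IsSmoothCoord.restr {Φ : OpenPartialHomeomorph N E} (hΦ : IsSmoothCoord I Φ) (s : Set N) :
    IsSmoothCoord I (Φ.restr s) :=
  ⟨hΦ.smooth.mono fun _ hz ↦ hz.1, hΦ.smooth_symm.mono fun _ hz ↦ hz.1⟩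

end Atlas

namespace PrincipalBundle

variable {EM : Type*} [NormedAddCommGroup EM] [NormedSpace ℝ EM]
  {M : Type*} [TopologicalSpace M] [ChartedSpace EM M]
  {EP : Type*} [NormedAddCommGroup EP] [NormedSpace ℝ EP]
  {P : Type*} [TopologicalSpace P] [ChartedSpace EP P]
  {EG : Type*} [NormedAddCommGroup EG] [NormedSpace ℂ EG]
  {G : Type*} [TopologicalSpace G] [ChartedSpace EG G] [Group G]
  {EF : Type*} [NormedAddCommGroup EF] [NormedSpace ℂ EF]
  {F : Type*} [TopologicalSpace F] [ChartedSpace EF F] [MulAction G F]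
  [ContMDiffSMul 𝓘(ℂ, EG) 𝓘(ℂ, EF) ω G F]
  {B : PrincipalBundle EM M EP P EG G} (τ : B.Triv)

/-- The point of `F` which represents a point of `P ×_G F`. -/
def assocFib (z : Bundle.TotalSpace F (B.assoc F EF).Fiber) : F := z.2

/-- The coordinates on `P ×_G F` given by a local trivialization of `P` and charts of `M` and `F`. -/
noncomputable def assocCoord (x₀ : M) (f₀ : F) :
    OpenPartialHomeomorph (Bundle.TotalSpace F (B.assoc F EF).Fiber) (EM × EF) :=
  (((B.assoc F EF).localTriv τ).toOpenPartialHomeomorph ≫ₕ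
    chartAt (ModelProd EM EF) (x₀, f₀)) ≫ₕ
    (Homeomorph.refl (EM × EF) : ModelProd EM EF ≃ₜ EM × EF).toOpenPartialHomeomorph

variable {τ} {x₀ : M} {f₀ : F}

theorem assocCoord_apply (z : Bundle.TotalSpace F (B.assoc F EF).Fiber) :
    assocCoord τ x₀ f₀ z = (chartAt EM x₀ z.1, chartAt EF f₀ (τ.coord (B.pt z.1) • assocFib z)) := rfl

theorem mem_assocCoord_source (z : Bundle.TotalSpace F (B.assoc F EF).Fiber) :
    z ∈ (assocCoord τ x₀ f₀).source ↔ z.1 ∈ τ.base ∧ z.1 ∈ (chartAt EM x₀).source ∧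
      τ.coord (B.pt z.1) • assocFib z ∈ (chartAt EF f₀).source := by
  change ((z.1 ∈ τ.base ∧ (z.1 ∈ (chartAt EM x₀).source ∧
    τ.coord (B.pt z.1) • assocFib z ∈ (chartAt EF f₀).source)) ∧ True) ↔ _
  tauto

-- The reference point of the fibre cancels: it is used once to represent the class of `(u, f)` by
-- an element of `F`, and once more to read that class in `τ`.
omit [TopologicalSpace F] in
theorem coord_pt_smul {u : P} (hu : B.proj u ∈ τ.base) (f : F) :
    τ.coord (B.pt (B.proj u)) • (B.trivAt (B.proj u)).coord u • f = τ.coord u • f := by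
  have h := (B.trivAt (B.proj u)).act_coord u (B.mem_trivAt _)
  rw [smul_smul, ← B.coord_act' τ _ (by rwa [B.proj_pt])]
  congr 2

variable [IsManifold 𝓘(ℝ, EM) ∞ M] [IsManifold 𝓘(ℂ, EF) ω F]

theorem isSmoothCoord_assocCoord :
    IsSmoothCoord (𝓘(ℝ, EM).prod 𝓘(ℝ, EF)) (assocCoord (EF := EF) τ x₀ f₀) :=
  isSmoothCoord_of_mem_atlas (H := ModelProd EM EF) (I := 𝓘(ℝ, EM).prod 𝓘(ℝ, EF))
    (Homeomorph.refl (EM × EF) : ModelProd EM EF ≃ₜ EM × EF) (fun _ ↦ rfl)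
    ⟨_, ⟨_, ⟨τ, rfl⟩, rfl⟩, _, chart_mem_atlas (ModelProd EM EF) ((x₀, f₀) : M × F), rfl⟩

/-- The infinitesimal action of `G` on `F`, in a chart of `F`. -/
noncomputable def infAct (G : Type*) [TopologicalSpace G] [ChartedSpace EG G] [Group G]
    [MulAction G F] (f₀ f : F) : EG →L[ℝ] EF :=
  mD 𝓘(ℝ, EG) 𝓘(ℝ, EF) (fun g : G ↦ chartAt EF f₀ (g • f)) 1

namespace Connection

variable [IsManifold 𝓘(ℝ, EP) ∞ P] (c : B.Connection)

/-- In these coordinates the map `u ↦ [u, f]` is the pair of `B.proj u` and `τ.coord u • f`, read in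
charts, and `mD_coord_smul` differentiates the second component along a horizontal vector. -/
theorem mD_assocCoord_cls {z : Bundle.TotalSpace F (B.assoc F EF).Fiber}
    (hz : z ∈ (assocCoord τ x₀ f₀).source) {h : EP} (hh : c.formE (B.pt z.1) h = 0) {v : EM}
    (hv : mD 𝓘(ℝ, EP) 𝓘(ℝ, EM) B.proj (B.pt z.1) h = mD 𝓘(ℝ, EM) 𝓘(ℝ, EM) (chartAt EM x₀).symm
      (chartAt EM x₀ z.1) v) :
    mD (𝓘(ℝ, EM).prod 𝓘(ℝ, EF)) 𝓘(ℝ, EM × EF) (assocCoord τ x₀ f₀) z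
      (mD 𝓘(ℝ, EP) (𝓘(ℝ, EM).prod 𝓘(ℝ, EF)) (fun u ↦ B.cls (F := F) (EF := EF) u (assocFib z)) (B.pt z.1) h) =
      (v, -infAct G f₀ (τ.coord (B.pt z.1) • assocFib z)
        (c.localForm τ x₀ (chartAt EM x₀ z.1) v)) := by
  obtain ⟨x, f⟩ := z
  change F at f
  have hcls : B.cls (EF := EF) (B.pt x) f = ⟨x, f⟩ := B.cls_pt x f
  have hΦ : IsSmoothCoord (𝓘(ℝ, EM).prod 𝓘(ℝ, EF)) (assocCoord (EF := EF) τ x₀ f₀) :=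
    isSmoothCoord_assocCoord
  obtain ⟨hx, hxφ, hfψ⟩ := (mem_assocCoord_source _).1 hz
  change x ∈ τ.base at hx
  change x ∈ (chartAt EM x₀).source at hxφ
  change τ.coord (B.pt x) • f ∈ _ at hfψ
  have hp : B.proj (B.pt x) = x := B.proj_pt x
  have hxu : B.proj (B.pt x) ∈ τ.base := by rwa [hp]
  have hφ : IsSmoothCoord 𝓘(ℝ, EM) (chartAt EM x₀) := isSmoothCoord_chartAt x₀
  have hψ : IsSmoothCoord 𝓘(ℝ, EF) (chartAt EF f₀) := isSmoothCoord_chartAt f₀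
  have hco : ContMDiffAt 𝓘(ℝ, EP) 𝓘(ℝ, EG) ∞ τ.coord (B.pt x) :=
    τ.contMDiffOn_coord.contMDiffAt ((isOpen_preimage_base τ).mem_nhds hxu)
  let k (u : P) : EM × EF := (chartAt EM x₀ (B.proj u), chartAt EF f₀ (τ.coord u • f))
  have hk₁ : MDifferentiableAt 𝓘(ℝ, EP) 𝓘(ℝ, EM) (fun u ↦ chartAt EM x₀ (B.proj u)) (B.pt x) :=
    MDifferentiableAt.comp (B.pt x) (g := chartAt EM x₀) (hφ.mdifferentiableAt (by rwa [hp]))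
      (B.mdifferentiableAt_proj _)
  have hk₂ : MDifferentiableAt 𝓘(ℝ, EP) 𝓘(ℝ, EF) (fun u ↦ chartAt EF f₀ (τ.coord u • f))
      (B.pt x) := by
    refine MDifferentiableAt.comp (B.pt x) (g := chartAt EF f₀) (hψ.mdifferentiableAt hfψ) ?_
    have h2 := (contMDiff_real_of_complex (ContMDiffSMul.contMDiff_smul (I := 𝓘(ℂ, EG))
      (I' := 𝓘(ℂ, EF)) (n := ω) (G := G) (M := F))).mdifferentiableAt (by simp)
      (x := (τ.coord (B.pt x), f))
    exact h2.comp (B.pt x) ((hco.mdifferentiableAt (by simp)).prodMk mdifferentiableAt_const)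
  have hk : MDifferentiableAt 𝓘(ℝ, EP) 𝓘(ℝ, EM × EF) k (B.pt x) := by
    rw [modelWithCornersSelf_prod, ← chartedSpaceSelf_prod]
    exact hk₁.prodMk hk₂
  have heq : ∀ᶠ u in nhds (B.pt x), assocCoord τ x₀ f₀ (B.cls (EF := EF) u f) = k u := by
    filter_upwards [(isOpen_preimage_base τ).mem_nhds hxu] with u hu
    rw [assocCoord_apply]
    exact Prod.ext rfl (congrArg (chartAt EF f₀) (coord_pt_smul hu f))
  have hkx : k (B.pt x) = assocCoord τ x₀ f₀ (⟨x, f⟩ : Bundle.TotalSpace F (B.assoc F EF).Fiber) := by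
    rw [← heq.self_of_nhds, hcls]
  have hsrc : ∀ᶠ u in nhds (B.pt x), B.cls (EF := EF) u f ∈ (assocCoord τ x₀ f₀).source := by
    have h1 : ∀ᶠ u in nhds (B.pt x), B.proj u ∈ (chartAt EM x₀).source :=
      B.contMDiff_proj.continuous.continuousAt ((chartAt EM x₀).open_source.mem_nhds (by rwa [hp]))
    have h2 : ∀ᶠ u in nhds (B.pt x), τ.coord u • f ∈ (chartAt EF f₀).source := by
      have h3 : ContinuousAt (fun u ↦ τ.coord u • f) (B.pt x) := by
        have h2 := (contMDiff_real_of_complex (ContMDiffSMul.contMDiff_smul (I := 𝓘(ℂ, EG))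
          (I' := 𝓘(ℂ, EF)) (n := ω) (G := G) (M := F))).continuous
        exact h2.continuousAt.comp (f := fun u ↦ (τ.coord u, f))
          (hco.continuousAt.prodMk continuousAt_const)
      exact h3 ((chartAt EF f₀).open_source.mem_nhds hfψ)
    filter_upwards [(isOpen_preimage_base τ).mem_nhds hxu, h1, h2] with u hu hu1 hu2
    rw [mem_assocCoord_source]
    refine ⟨hu, hu1, ?_⟩
    have := coord_pt_smul hu f
    change τ.coord (B.pt (B.proj u)) • (B.trivAt (B.proj u)).coord u • f ∈ _
    rwa [this]
  have hclsd : MDifferentiableAt 𝓘(ℝ, EP) (𝓘(ℝ, EM).prod 𝓘(ℝ, EF))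
      (fun u ↦ B.cls (F := F) (EF := EF) u f) (B.pt x) := by
    refine MDifferentiableAt.congr_of_eventuallyEq (f := fun u ↦ (assocCoord τ x₀ f₀).symm (k u))
      ?_ ?_
    · refine MDifferentiableAt.comp (B.pt x) (g := (assocCoord τ x₀ f₀).symm) ?_ hk
      rw [hkx]
      exact hΦ.mdifferentiableAt_symm ((assocCoord τ x₀ f₀).map_source hz)
    · filter_upwards [heq, hsrc] with u hu hus
      rw [← hu, (assocCoord τ x₀ f₀).left_inv hus]
  refine (mD_comp_apply (f := fun u ↦ B.cls (F := F) (EF := EF) u f) hcls (hΦ.mdifferentiableAt hz) hclsd h).symm.trans ?_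
  rw [mD_congr heq]
  have hprod : mD 𝓘(ℝ, EP) 𝓘(ℝ, EM × EF) k (B.pt x) =
      (mD 𝓘(ℝ, EP) 𝓘(ℝ, EM) (fun u ↦ chartAt EM x₀ (B.proj u)) (B.pt x)).prod
        (mD 𝓘(ℝ, EP) 𝓘(ℝ, EF) (fun u ↦ chartAt EF f₀ (τ.coord u • f)) (B.pt x)) := by
    rw [modelWithCornersSelf_prod, ← chartedSpaceSelf_prod]
    exact mD_prodMk hk₁ hk₂
  rw [hprod]
  refine Prod.ext ?_ ?_
  · change mD 𝓘(ℝ, EP) 𝓘(ℝ, EM) (fun u ↦ chartAt EM x₀ (B.proj u)) (B.pt x) h = v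
    rw [mD_comp_apply hp (hφ.mdifferentiableAt hxφ) (B.mdifferentiableAt_proj _), hv]
    have := hφ.mD_mD_symm ((chartAt EM x₀).map_source hxφ) v
    rwa [(chartAt EM x₀).left_inv hxφ] at this
  · change mD 𝓘(ℝ, EP) 𝓘(ℝ, EF) (fun u ↦ chartAt EF f₀ (τ.coord u • f)) (B.pt x) h = _
    rw [c.mD_coord_smul hxu f (hψ.mdifferentiableAt hfψ) hh, hv,
      c.localForm_apply ((chartAt EM x₀).map_source hxφ)
        (by rw [(chartAt EM x₀).left_inv hxφ]; exact hx), (chartAt EM x₀).left_inv hxφ, hp]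
    rfl

/-- The horizontal vectors of an associated bundle, in coordinates. -/
theorem mem_assocHorizontal_iff {z : Bundle.TotalSpace F (B.assoc F EF).Fiber}
    (hz : z ∈ (assocCoord τ x₀ f₀).source)
    (V : TangentSpace (𝓘(ℝ, EM).prod 𝓘(ℝ, EF)) z) {v : EM} {w : EF}
    (hV : mD (𝓘(ℝ, EM).prod 𝓘(ℝ, EF)) 𝓘(ℝ, EM × EF) (assocCoord τ x₀ f₀) z V = (v, w)) :
    V ∈ c.assocHorizontal F z ↔ w + infAct G f₀ (τ.coord (B.pt z.1) • assocFib z)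
        (c.localForm τ x₀ (chartAt EM x₀ z.1) v) = 0 := by
  have hφ : IsSmoothCoord 𝓘(ℝ, EM) (chartAt EM x₀) := isSmoothCoord_chartAt x₀
  have hxφ := ((mem_assocCoord_source _).1 hz).2.1
  have hΦ : IsSmoothCoord (𝓘(ℝ, EM).prod 𝓘(ℝ, EF)) (assocCoord (EF := EF) τ x₀ f₀) :=
    isSmoothCoord_assocCoord
  constructor
  · rintro ⟨h, hh, rfl⟩
    have h1 := c.mD_assocCoord_cls hz (h := h) hh
      (v := mD 𝓘(ℝ, EM) 𝓘(ℝ, EM) (chartAt EM x₀) z.1 (mD 𝓘(ℝ, EP) 𝓘(ℝ, EM) B.proj (B.pt z.1) h))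
      (hφ.mD_symm_mD hxφ _).symm
    have h2 := h1.symm.trans hV
    obtain ⟨h3, h4⟩ := Prod.mk.inj h2
    rw [← h3, ← h4, neg_add_cancel]
  · intro hw
    -- The horizontal vector of `P` with the same projection induces a vector with the same
    -- coordinates as `V`, hence `V` itself.
    obtain ⟨h, hh, hhv⟩ := c.exists_horizontal (B.pt z.1)
      (mD 𝓘(ℝ, EM) 𝓘(ℝ, EM) (chartAt EM x₀).symm (chartAt EM x₀ z.1) v)
    refine ⟨h, hh, hΦ.mD_injective hz ?_⟩
    refine (c.mD_assocCoord_cls hz hh hhv).trans (Eq.trans ?_ hV.symm)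
    rw [← eq_neg_of_add_eq_zero_left hw]

end Connection

end PrincipalBundle

/-! ### Coordinates on the bundle `Q` -/

section CoordMaps

variable {E : Type*} [NormedAddCommGroup E] [NormedSpace ℝ E]
  {H : Type*} [TopologicalSpace H] {I : ModelWithCorners ℝ E H}
  {N : Type*} [TopologicalSpace N] [ChartedSpace H N]
  {E' : Type*} [NormedAddCommGroup E'] [NormedSpace ℝ E']
  {H' : Type*} [TopologicalSpace H'] {I' : ModelWithCorners ℝ E' H'}
  {N' : Type*} [TopologicalSpace N'] [ChartedSpace H' N']
  {E'' : Type*} [NormedAddCommGroup E''] [NormedSpace ℝ E'']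

/-- A map is differentiable if it is so in a coordinate system of the target. -/
theorem IsSmoothCoord.mdifferentiableAt_of_coord {Φ : OpenPartialHomeomorph N' E'}
    (hΦ : IsSmoothCoord I' Φ) {f : N → N'} {k : N → E'} {z : N}
    (hk : MDifferentiableAt I 𝓘(ℝ, E') k z) (hfk : ∀ᶠ z' in nhds z, Φ (f z') = k z')
    (hf : ∀ᶠ z' in nhds z, f z' ∈ Φ.source) : MDifferentiableAt I I' f z := by
  refine MDifferentiableAt.congr_of_eventuallyEq (f := fun u ↦ Φ.symm (k u)) ?_ ?_
  · refine MDifferentiableAt.comp z (g := Φ.symm) ?_ hk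
    rw [← hfk.self_of_nhds]
    exact hΦ.mdifferentiableAt_symm (Φ.map_source hf.self_of_nhds)
  · filter_upwards [hfk, hf] with u hu hus
    rw [← hu, Φ.left_inv hus]

theorem IsSmoothCoord.mD_mD_of_coord {Φ : OpenPartialHomeomorph N' E'}
    (hΦ : IsSmoothCoord I' Φ) {f : N → N'} {k : N → E'} {z : N}
    (hk : MDifferentiableAt I 𝓘(ℝ, E') k z) (hfk : ∀ᶠ z' in nhds z, Φ (f z') = k z')
    (hf : ∀ᶠ z' in nhds z, f z' ∈ Φ.source) (v : E) :
    mD I' 𝓘(ℝ, E') Φ (f z) (mD I I' f z v) = mD I 𝓘(ℝ, E') k z v := by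
  rw [← mD_comp_apply rfl (hΦ.mdifferentiableAt hf.self_of_nhds)
    (hΦ.mdifferentiableAt_of_coord hk hfk hf), mD_congr hfk]

theorem mD_prodMk_space {f : N → E'} {g : N → E''} {z : N}
    (hf : MDifferentiableAt I 𝓘(ℝ, E') f z) (hg : MDifferentiableAt I 𝓘(ℝ, E'') g z) :
    mD I 𝓘(ℝ, E' × E'') (fun z ↦ (f z, g z)) z =
      (mD I 𝓘(ℝ, E') f z).prod (mD I 𝓘(ℝ, E'') g z) := by
  rw [modelWithCornersSelf_prod, ← chartedSpaceSelf_prod]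
  exact mD_prodMk hf hg

theorem mD_clm_comp (l : E' →L[ℝ] E'') {f : N → E'} {z : N}
    (hf : MDifferentiableAt I 𝓘(ℝ, E') f z) (v : E) :
    mD I 𝓘(ℝ, E'') (fun z ↦ l (f z)) z v = l (mD I 𝓘(ℝ, E') f z v) := by
  rw [mD_comp_apply rfl l.differentiableAt.mdifferentiableAt hf, mD_eq_fderiv, l.fderiv]

end CoordMaps

namespace TwistorBundle

variable {EM : Type*} [NormedAddCommGroup EM] [NormedSpace ℝ EM]
  {M : Type*} [TopologicalSpace M] [ChartedSpace EM M]
  {EP₁ : Type*} [NormedAddCommGroup EP₁] [NormedSpace ℝ EP₁]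
  {P₁ : Type*} [TopologicalSpace P₁] [ChartedSpace EP₁ P₁]
  {EG₁ : Type*} [NormedAddCommGroup EG₁] [NormedSpace ℂ EG₁]
  {G₁ : Type*} [TopologicalSpace G₁] [ChartedSpace EG₁ G₁] [Group G₁]
  {EF₁ : Type*} [NormedAddCommGroup EF₁] [NormedSpace ℂ EF₁]
  {F₁ : Type*} [TopologicalSpace F₁] [ChartedSpace EF₁ F₁] [MulAction G₁ F₁]
  [ContMDiffSMul 𝓘(ℂ, EG₁) 𝓘(ℂ, EF₁) ω G₁ F₁]
  {EP₂ : Type*} [NormedAddCommGroup EP₂] [NormedSpace ℝ EP₂]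
  {P₂ : Type*} [TopologicalSpace P₂] [ChartedSpace EP₂ P₂]
  {EG₂ : Type*} [NormedAddCommGroup EG₂] [NormedSpace ℂ EG₂]
  {G₂ : Type*} [TopologicalSpace G₂] [ChartedSpace EG₂ G₂] [Group G₂]
  {EF₂ : Type*} [NormedAddCommGroup EF₂] [NormedSpace ℂ EF₂]
  {F₂ : Type*} [TopologicalSpace F₂] [ChartedSpace EF₂ F₂] [MulAction G₂ F₂]
  [ContMDiffSMul 𝓘(ℂ, EG₂) 𝓘(ℂ, EF₂) ω G₂ F₂]
  {B₁ : PrincipalBundle EM M EP₁ P₁ EG₁ G₁} {B₂ : PrincipalBundle EM M EP₂ P₂ EG₂ G₂}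

/-- The coordinates on `Q` given by local trivializations of `P₁`, `P₂` and charts of `M`, `F₁`
and `F₂`. -/
noncomputable def coord (τ₁ : B₁.Triv) (τ₂ : B₂.Triv) (x₀ : M) (f₁ : F₁) (f₂ : F₂) :
    OpenPartialHomeomorph (TwistorBundle EF₁ F₁ EF₂ F₂ B₁ B₂) (EM × EF₁ × EF₂) :=
  (((prodCore (B₁.assoc F₁ EF₁) (B₂.assoc F₂ EF₂)).localTriv (τ₁, τ₂)).toOpenPartialHomeomorph ≫ₕ
    chartAt (ModelProd EM (ModelProd EF₁ EF₂)) (x₀, f₁, f₂)) ≫ₕ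
    (Homeomorph.refl (EM × EF₁ × EF₂) :
      ModelProd EM (ModelProd EF₁ EF₂) ≃ₜ EM × EF₁ × EF₂).toOpenPartialHomeomorph

/-- The point of `F₁` which represents the first component in a local trivialization. -/
noncomputable def fib₁ (τ₁ : B₁.Triv) (z : TwistorBundle EF₁ F₁ EF₂ F₂ B₁ B₂) : F₁ :=
  τ₁.coord (B₁.pt z.proj) • z.fibrePoint.1

/-- The point of `F₂` which represents the second component in a local trivialization. -/
noncomputable def fib₂ (τ₂ : B₂.Triv) (z : TwistorBundle EF₁ F₁ EF₂ F₂ B₁ B₂) : F₂ :=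
  τ₂.coord (B₂.pt z.proj) • z.fibrePoint.2

variable {τ₁ : B₁.Triv} {τ₂ : B₂.Triv} {x₀ : M} {f₁ : F₁} {f₂ : F₂}

theorem coord_apply (z : TwistorBundle EF₁ F₁ EF₂ F₂ B₁ B₂) :
    coord τ₁ τ₂ x₀ f₁ f₂ z =
      (chartAt EM x₀ z.proj, chartAt EF₁ f₁ (z.fib₁ τ₁), chartAt EF₂ f₂ (z.fib₂ τ₂)) := rfl

theorem mem_coord_source (z : TwistorBundle EF₁ F₁ EF₂ F₂ B₁ B₂) :
    z ∈ (coord τ₁ τ₂ x₀ f₁ f₂).source ↔ (z.proj ∈ τ₁.base ∧ z.proj ∈ τ₂.base) ∧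
      z.proj ∈ (chartAt EM x₀).source ∧ z.fib₁ τ₁ ∈ (chartAt EF₁ f₁).source ∧
      z.fib₂ τ₂ ∈ (chartAt EF₂ f₂).source := by
  change ((((z.proj ∈ τ₁.base ∧ z.proj ∈ τ₂.base) ∧ (z.proj ∈ (chartAt EM x₀).source ∧
    z.fib₁ τ₁ ∈ (chartAt EF₁ f₁).source ∧ z.fib₂ τ₂ ∈ (chartAt EF₂ f₂).source)) ∧ True)) ↔ _
  tauto

variable [IsManifold 𝓘(ℝ, EM) ∞ M] [IsManifold 𝓘(ℂ, EF₁) ω F₁] [IsManifold 𝓘(ℂ, EF₂) ω F₂]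

theorem isSmoothCoord_coord :
    IsSmoothCoord (modelQ EM EF₁ EF₂) (coord (EF₁ := EF₁) (EF₂ := EF₂) τ₁ τ₂ x₀ f₁ f₂) :=
  isSmoothCoord_of_mem_atlas (H := ModelProd EM (ModelProd EF₁ EF₂)) (I := modelQ EM EF₁ EF₂)
    (Homeomorph.refl (EM × EF₁ × EF₂) : ModelProd EM (ModelProd EF₁ EF₂) ≃ₜ EM × EF₁ × EF₂)
    (fun _ ↦ rfl)
    ⟨_, ⟨_, ⟨(τ₁, τ₂), rfl⟩, rfl⟩, _,
      chart_mem_atlas (ModelProd EM (ModelProd EF₁ EF₂)) ((x₀, f₁, f₂) : M × F₁ × F₂), rfl⟩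

variable {z : TwistorBundle EF₁ F₁ EF₂ F₂ B₁ B₂} (hz : z ∈ (coord τ₁ τ₂ x₀ f₁ f₂).source)

include hz

theorem mD_assocCoord_toQ₁ (v : EM × EF₁ × EF₂) :
    mD (𝓘(ℝ, EM).prod 𝓘(ℝ, EF₁)) 𝓘(ℝ, EM × EF₁) (PrincipalBundle.assocCoord τ₁ x₀ f₁) z.toQ₁
      (mD (modelQ EM EF₁ EF₂) (𝓘(ℝ, EM).prod 𝓘(ℝ, EF₁)) toQ₁ z v) =
      ((mD (modelQ EM EF₁ EF₂) 𝓘(ℝ, EM × EF₁ × EF₂) (coord τ₁ τ₂ x₀ f₁ f₂) z v).1,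
        (mD (modelQ EM EF₁ EF₂) 𝓘(ℝ, EM × EF₁ × EF₂) (coord τ₁ τ₂ x₀ f₁ f₂) z v).2.1) := by
  let l : EM × EF₁ × EF₂ →L[ℝ] EM × EF₁ :=
    (ContinuousLinearMap.fst ℝ EM (EF₁ × EF₂)).prod
      ((ContinuousLinearMap.fst ℝ EF₁ EF₂).comp (ContinuousLinearMap.snd ℝ EM (EF₁ × EF₂)))
  have hΦ := isSmoothCoord_coord (EF₁ := EF₁) (EF₂ := EF₂) (τ₁ := τ₁) (τ₂ := τ₂) (x₀ := x₀)
    (f₁ := f₁) (f₂ := f₂)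
  have hd := hΦ.mdifferentiableAt hz
  have hs : ∀ᶠ z' in nhds z, toQ₁ z' ∈ (PrincipalBundle.assocCoord τ₁ x₀ f₁).source := by
    filter_upwards [(coord τ₁ τ₂ x₀ f₁ f₂).open_source.mem_nhds hz] with z hz
    obtain ⟨h1, h2, h3⟩ := (mem_coord_source z).1 hz
    exact (PrincipalBundle.mem_assocCoord_source _).2 ⟨h1.1, h2, h3.1⟩
  have he : ∀ᶠ z' in nhds z, PrincipalBundle.assocCoord τ₁ x₀ f₁ (toQ₁ z') =
      l (coord τ₁ τ₂ x₀ f₁ f₂ z') := Filter.Eventually.of_forall fun z ↦ rfl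
  have hk := MDifferentiableAt.comp z (g := l) l.differentiableAt.mdifferentiableAt hd
  exact (PrincipalBundle.isSmoothCoord_assocCoord.mD_mD_of_coord (f := toQ₁) hk he hs v).trans
    (mD_clm_comp l hd v)

theorem mD_assocCoord_toQ₂ (v : EM × EF₁ × EF₂) :
    mD (𝓘(ℝ, EM).prod 𝓘(ℝ, EF₂)) 𝓘(ℝ, EM × EF₂) (PrincipalBundle.assocCoord τ₂ x₀ f₂) z.toQ₂
      (mD (modelQ EM EF₁ EF₂) (𝓘(ℝ, EM).prod 𝓘(ℝ, EF₂)) toQ₂ z v) =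
      ((mD (modelQ EM EF₁ EF₂) 𝓘(ℝ, EM × EF₁ × EF₂) (coord τ₁ τ₂ x₀ f₁ f₂) z v).1,
        (mD (modelQ EM EF₁ EF₂) 𝓘(ℝ, EM × EF₁ × EF₂) (coord τ₁ τ₂ x₀ f₁ f₂) z v).2.2) := by
  let l : EM × EF₁ × EF₂ →L[ℝ] EM × EF₂ :=
    (ContinuousLinearMap.fst ℝ EM (EF₁ × EF₂)).prod
      ((ContinuousLinearMap.snd ℝ EF₁ EF₂).comp (ContinuousLinearMap.snd ℝ EM (EF₁ × EF₂)))
  have hΦ := isSmoothCoord_coord (EF₁ := EF₁) (EF₂ := EF₂) (τ₁ := τ₁) (τ₂ := τ₂) (x₀ := x₀)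
    (f₁ := f₁) (f₂ := f₂)
  have hd := hΦ.mdifferentiableAt hz
  have hs : ∀ᶠ z' in nhds z, toQ₂ z' ∈ (PrincipalBundle.assocCoord τ₂ x₀ f₂).source := by
    filter_upwards [(coord τ₁ τ₂ x₀ f₁ f₂).open_source.mem_nhds hz] with z hz
    obtain ⟨h1, h2, h3⟩ := (mem_coord_source z).1 hz
    exact (PrincipalBundle.mem_assocCoord_source _).2 ⟨h1.2, h2, h3.2⟩
  have he : ∀ᶠ z' in nhds z, PrincipalBundle.assocCoord τ₂ x₀ f₂ (toQ₂ z') =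
      l (coord τ₁ τ₂ x₀ f₁ f₂ z') := Filter.Eventually.of_forall fun z ↦ rfl
  have hk := MDifferentiableAt.comp z (g := l) l.differentiableAt.mdifferentiableAt hd
  exact (PrincipalBundle.isSmoothCoord_assocCoord.mD_mD_of_coord (f := toQ₂) hk he hs v).trans
    (mD_clm_comp l hd v)

theorem mD_chartAt_proj (v : EM × EF₁ × EF₂) :
    mD 𝓘(ℝ, EM) 𝓘(ℝ, EM) (chartAt EM x₀) z.proj (mD (modelQ EM EF₁ EF₂) 𝓘(ℝ, EM) proj z v) =
      (mD (modelQ EM EF₁ EF₂) 𝓘(ℝ, EM × EF₁ × EF₂) (coord τ₁ τ₂ x₀ f₁ f₂) z v).1 := by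
  have hΦ := isSmoothCoord_coord (EF₁ := EF₁) (EF₂ := EF₂) (τ₁ := τ₁) (τ₂ := τ₂) (x₀ := x₀)
    (f₁ := f₁) (f₂ := f₂)
  have hd := hΦ.mdifferentiableAt hz
  let l := ContinuousLinearMap.fst ℝ EM (EF₁ × EF₂)
  refine ((isSmoothCoord_chartAt x₀).mD_mD_of_coord
    (k := fun z ↦ l (coord τ₁ τ₂ x₀ f₁ f₂ z)) (l.differentiableAt.mdifferentiableAt.comp z hd)
    (Filter.Eventually.of_forall fun z ↦ rfl) ?_ v).trans (mD_clm_comp l hd v)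
  filter_upwards [(coord τ₁ τ₂ x₀ f₁ f₂).open_source.mem_nhds hz] with z hz
  exact ((mem_coord_source z).1 hz).2.1

/-- The inclusions of the fibres of `Q`, in coordinates. -/
theorem mD_coord_fibreInclusion (w : EF₁ × EF₂) :
    mD (modelQ EM EF₁ EF₂) 𝓘(ℝ, EM × EF₁ × EF₂) (coord τ₁ τ₂ x₀ f₁ f₂) z
      (mD (𝓘(ℝ, EF₁).prod 𝓘(ℝ, EF₂)) (modelQ EM EF₁ EF₂)
        (fibreInclusion z.proj : F₁ × F₂ → TwistorBundle EF₁ F₁ EF₂ F₂ B₁ B₂) z.fibrePoint w) =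
      (0, mD 𝓘(ℝ, EF₁) 𝓘(ℝ, EF₁) (fun f : F₁ ↦ chartAt EF₁ f₁ (τ₁.coord (B₁.pt z.proj) • f))
          z.fibrePoint.1 w.1,
        mD 𝓘(ℝ, EF₂) 𝓘(ℝ, EF₂) (fun f : F₂ ↦ chartAt EF₂ f₂ (τ₂.coord (B₂.pt z.proj) • f))
          z.fibrePoint.2 w.2) := by
  obtain ⟨hx, hxφ, hf₁, hf₂⟩ := (mem_coord_source z).1 hz
  have hΦ := isSmoothCoord_coord (EF₁ := EF₁) (EF₂ := EF₂) (τ₁ := τ₁) (τ₂ := τ₂) (x₀ := x₀)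
    (f₁ := f₁) (f₂ := f₂)
  set g₁ := τ₁.coord (B₁.pt z.proj)
  set g₂ := τ₂.coord (B₂.pt z.proj)
  have hs₁ := (contMDiff_real_of_complex (ContMDiffSMul.contMDiff_smul (I := 𝓘(ℂ, EG₁))
      (I' := 𝓘(ℂ, EF₁)) (n := ω) (G := G₁) (M := F₁)))
  have hs₂ := (contMDiff_real_of_complex (ContMDiffSMul.contMDiff_smul (I := 𝓘(ℂ, EG₂))
      (I' := 𝓘(ℂ, EF₂)) (n := ω) (G := G₂) (M := F₂)))
  have hc₁ : ContMDiff 𝓘(ℝ, EF₁) 𝓘(ℝ, EF₁) ∞ (fun f : F₁ ↦ g₁ • f) :=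
    hs₁.comp (contMDiff_const.prodMk contMDiff_id)
  have hc₂ : ContMDiff 𝓘(ℝ, EF₂) 𝓘(ℝ, EF₂) ∞ (fun f : F₂ ↦ g₂ • f) :=
    hs₂.comp (contMDiff_const.prodMk contMDiff_id)
  have hd₁ : MDifferentiableAt 𝓘(ℝ, EF₁) 𝓘(ℝ, EF₁) (fun f : F₁ ↦ chartAt EF₁ f₁ (g₁ • f))
      z.fibrePoint.1 :=
    MDifferentiableAt.comp _ (g := chartAt EF₁ f₁) ((isSmoothCoord_chartAt f₁).mdifferentiableAt hf₁)
      (hc₁.mdifferentiableAt (by simp))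
  have hd₂ : MDifferentiableAt 𝓘(ℝ, EF₂) 𝓘(ℝ, EF₂) (fun f : F₂ ↦ chartAt EF₂ f₂ (g₂ • f))
      z.fibrePoint.2 :=
    MDifferentiableAt.comp _ (g := chartAt EF₂ f₂) ((isSmoothCoord_chartAt f₂).mdifferentiableAt hf₂)
      (hc₂.mdifferentiableAt (by simp))
  have hk₁ : MDifferentiableAt (𝓘(ℝ, EF₁).prod 𝓘(ℝ, EF₂)) 𝓘(ℝ, EF₁)
      (fun f : F₁ × F₂ ↦ chartAt EF₁ f₁ (g₁ • f.1)) z.fibrePoint :=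
    MDifferentiableAt.comp z.fibrePoint (g := fun f : F₁ ↦ chartAt EF₁ f₁ (g₁ • f)) hd₁
      mdifferentiableAt_fst
  have hk₂ : MDifferentiableAt (𝓘(ℝ, EF₁).prod 𝓘(ℝ, EF₂)) 𝓘(ℝ, EF₂)
      (fun f : F₁ × F₂ ↦ chartAt EF₂ f₂ (g₂ • f.2)) z.fibrePoint :=
    MDifferentiableAt.comp z.fibrePoint (g := fun f : F₂ ↦ chartAt EF₂ f₂ (g₂ • f)) hd₂
      mdifferentiableAt_snd
  have hk₀ : MDifferentiableAt (𝓘(ℝ, EF₁).prod 𝓘(ℝ, EF₂)) 𝓘(ℝ, EM)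
      (fun _ : F₁ × F₂ ↦ chartAt EM x₀ z.proj) z.fibrePoint := mdifferentiableAt_const
  have h1 := hΦ.mD_mD_of_coord (f := fibreInclusion z.proj) (z := z.fibrePoint)
    (k := fun f : F₁ × F₂ ↦ (chartAt EM x₀ z.proj, chartAt EF₁ f₁ (g₁ • f.1),
      chartAt EF₂ f₂ (g₂ • f.2))) (hk₀.prodMk_space (hk₁.prodMk_space hk₂))
    (Filter.Eventually.of_forall fun f ↦ rfl) (by
      have h2 : ∀ᶠ f in nhds z.fibrePoint, g₁ • f.1 ∈ (chartAt EF₁ f₁).source :=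
        (hc₁.continuous.comp continuous_fst).continuousAt
          ((chartAt EF₁ f₁).open_source.mem_nhds hf₁)
      have h3 : ∀ᶠ f in nhds z.fibrePoint, g₂ • f.2 ∈ (chartAt EF₂ f₂).source :=
        (hc₂.continuous.comp continuous_snd).continuousAt
          ((chartAt EF₂ f₂).open_source.mem_nhds hf₂)
      filter_upwards [h2, h3] with f h2 h3
      exact (mem_coord_source _).2 ⟨hx, hxφ, h2, h3⟩) w
  refine h1.trans ?_
  rw [mD_prodMk_space hk₀ (hk₁.prodMk_space hk₂), mD_prodMk_space hk₁ hk₂, mD_const]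
  refine Prod.ext rfl (Prod.ext ?_ ?_)
  · refine (mD_comp_apply (f := fun f : F₁ × F₂ ↦ f.1) (g := fun f : F₁ ↦ chartAt EF₁ f₁ (g₁ • f))
      rfl hd₁ mdifferentiableAt_fst w).trans ?_
    have h4 : mD (𝓘(ℝ, EF₁).prod 𝓘(ℝ, EF₂)) 𝓘(ℝ, EF₁) (fun f : F₁ × F₂ ↦ f.1) z.fibrePoint =
      ContinuousLinearMap.fst ℝ EF₁ EF₂ := mfderiv_fst
    rw [h4]
    rfl
  · refine (mD_comp_apply (f := fun f : F₁ × F₂ ↦ f.2) (g := fun f : F₂ ↦ chartAt EF₂ f₂ (g₂ • f))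
      rfl hd₂ mdifferentiableAt_snd w).trans ?_
    have h4 : mD (𝓘(ℝ, EF₁).prod 𝓘(ℝ, EF₂)) 𝓘(ℝ, EF₂) (fun f : F₁ × F₂ ↦ f.2) z.fibrePoint =
      ContinuousLinearMap.snd ℝ EF₁ EF₂ := mfderiv_snd
    rw [h4]
    rfl

end TwistorBundle

/-! ### Translations of the fibre by elements of the group, in charts -/

namespace PrincipalBundle

variable (EG : Type*) [NormedAddCommGroup EG] [NormedSpace ℂ EG]
  {G : Type*} [TopologicalSpace G] [ChartedSpace EG G] [Group G]
  {EF : Type*} [NormedAddCommGroup EF] [NormedSpace ℂ EF]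
  {F : Type*} [TopologicalSpace F] [ChartedSpace EF F] [MulAction G F]
  [IsManifold 𝓘(ℂ, EF) ω F]

theorem mdifferentiableAt_chartAt_complex {f₀ f : F} (hf : f ∈ (chartAt EF f₀).source) :
    MDifferentiableAt 𝓘(ℂ, EF) 𝓘(ℂ, EF) (chartAt EF f₀) f :=
  (contMDiffOn_chart.contMDiffAt (n := ω) ((chartAt EF f₀).open_source.mem_nhds hf)).mdifferentiableAt
    (by simp)

variable [ContMDiffSMul 𝓘(ℂ, EG) 𝓘(ℂ, EF) ω G F]
include EG

/-- The derivatives of the maps of the action are complex linear. -/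
theorem mD_chartAt_smul_smul {f₀ f : F} {g : G} (hf : g • f ∈ (chartAt EF f₀).source) (c : ℂ)
    (w : EF) : mD 𝓘(ℝ, EF) 𝓘(ℝ, EF) (fun f : F ↦ chartAt EF f₀ (g • f)) f (c • w) =
      c • mD 𝓘(ℝ, EF) 𝓘(ℝ, EF) (fun f : F ↦ chartAt EF f₀ (g • f)) f w := by
  apply mD_smul
  refine MDifferentiableAt.comp f (g := chartAt EF f₀) (mdifferentiableAt_chartAt_complex hf) ?_
  exact ((ContMDiffSMul.contMDiff_smul (I := 𝓘(ℂ, EG)) (I' := 𝓘(ℂ, EF)) (n := ω) (G := G)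
    (M := F)).comp (contMDiff_const.prodMk contMDiff_id)).mdifferentiableAt (by simp)

/-- Translation by `g⁻¹` provides a right inverse. -/
theorem mD_chartAt_smul_surjective {f₀ f : F} {g : G} (hf : g • f ∈ (chartAt EF f₀).source) :
    Function.Surjective (mD 𝓘(ℝ, EF) 𝓘(ℝ, EF) (fun f : F ↦ chartAt EF f₀ (g • f)) f) := by
  have hs := (contMDiff_real_of_complex (ContMDiffSMul.contMDiff_smul (I := 𝓘(ℂ, EG))
      (I' := 𝓘(ℂ, EF)) (n := ω) (G := G) (M := F)))
  have hc : ∀ g : G, ContMDiff 𝓘(ℝ, EF) 𝓘(ℝ, EF) ∞ (fun f : F ↦ g • f) := fun g ↦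
    hs.comp (contMDiff_const.prodMk contMDiff_id)
  have hψ : IsSmoothCoord 𝓘(ℝ, EF) (chartAt EF f₀) := isSmoothCoord_chartAt f₀
  intro w
  have h1 := mD_comp_apply (f := fun y ↦ g⁻¹ • (chartAt EF f₀).symm y)
    (g := fun f : F ↦ chartAt EF f₀ (g • f)) (x := chartAt EF f₀ (g • f)) (y := f)
    (by simp [(chartAt EF f₀).left_inv hf])
    (MDifferentiableAt.comp f (g := chartAt EF f₀) (hψ.mdifferentiableAt hf)
      ((hc g).mdifferentiableAt (by simp)))
    (MDifferentiableAt.comp _ (g := fun f : F ↦ g⁻¹ • f) ((hc g⁻¹).mdifferentiableAt (by simp))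
      (hψ.mdifferentiableAt_symm ((chartAt EF f₀).map_source hf))) w
  refine ⟨_, h1.symm.trans ?_⟩
  rw [mD_congr (g := fun y ↦ y), mD_id]
  · rfl
  · filter_upwards [(chartAt EF f₀).open_target.mem_nhds ((chartAt EF f₀).map_source hf)] with y hy
    rw [smul_inv_smul, (chartAt EF f₀).right_inv hy]

end PrincipalBundle

/-! ### The distributions in coordinates -/

namespace FrameInclusion

variable {EM : Type*} [NormedAddCommGroup EM] [NormedSpace ℝ EM]
  {M : Type*} [TopologicalSpace M] [ChartedSpace EM M] [IsManifold 𝓘(ℝ, EM) ∞ M]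
  {EP : Type*} [NormedAddCommGroup EP] [NormedSpace ℝ EP]
  {P : Type*} [TopologicalSpace P] [ChartedSpace EP P] [IsManifold 𝓘(ℝ, EP) ∞ P]
  {EG : Type*} [NormedAddCommGroup EG] [NormedSpace ℂ EG]
  {G : Type*} [TopologicalSpace G] [ChartedSpace EG G] [Group G] {m : ℕ}
  {EF : Type*} [NormedAddCommGroup EF] [NormedSpace ℂ EF]
  {F : Type*} [TopologicalSpace F] [ChartedSpace EF F] [MulAction G F]
  {B : PrincipalBundle EM M EP P EG G} {L : LieSubgroupGL m EG G} (e : FrameInclusion B L)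

omit [IsManifold 𝓘(ℝ, EP) ∞ P] in
/-- The subspace of a complexified tangent space given by a point of `F`, in a local
trivialization. -/
theorem mem_map_frame_iff {r : ℕ} (S : HomogeneousSubmanifold EF F r L)
    {τ : B.Triv} {x₀ x : M}
    (hx : x ∈ τ.base) (hxφ : x ∈ (chartAt EM x₀).source) (f : F)
    {Y : TangentSpaceC 𝓘(ℝ, EM) x} {v w : EM}
    (hv : mD 𝓘(ℝ, EM) 𝓘(ℝ, EM) (chartAt EM x₀) x (reE 𝓘(ℝ, EM) Y) = v)
    (hw : mD 𝓘(ℝ, EM) 𝓘(ℝ, EM) (chartAt EM x₀) x (imE 𝓘(ℝ, EM) Y) = w) :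
    Y ∈ (S.sub f).1.map (e.frameAt x).toLinearMap ↔
      e.localCanon τ x₀ (chartAt EM x₀ x) v + Complex.I • e.localCanon τ x₀ (chartAt EM x₀ x) w ∈
        (S.sub (τ.coord (B.pt x) • f)).1 := by
  have hφ : IsSmoothCoord 𝓘(ℝ, EM) (chartAt EM x₀) := isSmoothCoord_chartAt x₀
  have hp : B.proj (B.pt x) = x := B.proj_pt x
  have hinv : (chartAt EM x₀).symm (chartAt EM x₀ x) = x := (chartAt EM x₀).left_inv hxφ
  have hloc : ∀ a : EM, e.localCanon τ x₀ (chartAt EM x₀ x)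
      (mD 𝓘(ℝ, EM) 𝓘(ℝ, EM) (chartAt EM x₀) x a) =
      (e.frameE (τ.sec x)).symm ((1 : ℂ) ⊗ₜ[ℝ] a) := by
    intro a
    rw [e.localCanon_apply ((chartAt EM x₀).map_source hxφ) (by rwa [hinv]),
      hφ.mD_symm_mD hxφ, hinv]
  have hY : (Y : ℂ ⊗[ℝ] EM) = (1 : ℂ) ⊗ₜ[ℝ] (reE 𝓘(ℝ, EM) Y) + Complex.I ⊗ₜ[ℝ] (imE 𝓘(ℝ, EM) Y) :=
    eq_reC_add_imC (E := EM) Y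
  have h1 : e.localCanon τ x₀ (chartAt EM x₀ x) v +
      Complex.I • e.localCanon τ x₀ (chartAt EM x₀ x) w = (e.frameE (τ.sec x)).symm Y := by
    rw [← hv, ← hw, hloc, hloc, ← map_smul, ← map_add, TensorProduct.smul_tmul', smul_eq_mul,
      mul_one]
    exact congrArg _ hY.symm
  have h2 : B.act (τ.sec x) (τ.coord (B.pt x)) = B.pt x := by
    have := τ.act_coord (B.pt x) (by rwa [hp])
    rwa [hp] at this
  -- The frames at the reference point and at the section differ by the matrix of `τ.coord (B.pt
  -- x)`, which is also the group element that moves `f`. The two changes compensate.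
  have h3 : ∀ ξ, e.frameE (B.pt x) ξ = e.frameE (τ.sec x) (L.rep (τ.coord (B.pt x)) ξ) := by
    intro ξ
    rw [← e.frameE_act, h2]
  rw [h1, S.sub_smul]
  constructor
  · rintro ⟨ξ, hξ, h⟩
    have h4 : e.frameE (B.pt x) ξ = Y := h
    exact ⟨ξ, hξ, by rw [← h4, h3, LinearEquiv.symm_apply_apply]; rfl⟩
  · rintro ⟨ξ, hξ, h⟩
    have h4 : e.frameE (B.pt x) ξ = Y := by
      rw [h3]
      exact (LinearEquiv.eq_symm_apply _).1 h
    exact ⟨ξ, hξ, h4⟩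

end FrameInclusion

namespace TwistorBundle

variable {EM : Type*} [NormedAddCommGroup EM] [NormedSpace ℝ EM]
  {M : Type*} [TopologicalSpace M] [ChartedSpace EM M] [IsManifold 𝓘(ℝ, EM) ∞ M]
  {EP₁ : Type*} [NormedAddCommGroup EP₁] [NormedSpace ℝ EP₁]
  {P₁ : Type*} [TopologicalSpace P₁] [ChartedSpace EP₁ P₁] [IsManifold 𝓘(ℝ, EP₁) ∞ P₁]
  {EG₁ : Type*} [NormedAddCommGroup EG₁] [NormedSpace ℂ EG₁]
  {G₁ : Type*} [TopologicalSpace G₁] [ChartedSpace EG₁ G₁] [Group G₁]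
  {EF₁ : Type*} [NormedAddCommGroup EF₁] [NormedSpace ℂ EF₁]
  {F₁ : Type*} [TopologicalSpace F₁] [ChartedSpace EF₁ F₁] [MulAction G₁ F₁]
  [ContMDiffSMul 𝓘(ℂ, EG₁) 𝓘(ℂ, EF₁) ω G₁ F₁]
  {EP₂ : Type*} [NormedAddCommGroup EP₂] [NormedSpace ℝ EP₂]
  {P₂ : Type*} [TopologicalSpace P₂] [ChartedSpace EP₂ P₂] [IsManifold 𝓘(ℝ, EP₂) ∞ P₂]
  {EG₂ : Type*} [NormedAddCommGroup EG₂] [NormedSpace ℂ EG₂]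
  {G₂ : Type*} [TopologicalSpace G₂] [ChartedSpace EG₂ G₂] [Group G₂]
  {EF₂ : Type*} [NormedAddCommGroup EF₂] [NormedSpace ℂ EF₂]
  {F₂ : Type*} [TopologicalSpace F₂] [ChartedSpace EF₂ F₂] [MulAction G₂ F₂]
  [ContMDiffSMul 𝓘(ℂ, EG₂) 𝓘(ℂ, EF₂) ω G₂ F₂]
  {m₁ r₁ m₂ : ℕ}
  {B₁ : PrincipalBundle EM M EP₁ P₁ EG₁ G₁} {B₂ : PrincipalBundle EM M EP₂ P₂ EG₂ G₂}
  {L₁ : LieSubgroupGL m₁ EG₁ G₁}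
  [IsManifold 𝓘(ℂ, EF₁) ω F₁] [IsManifold 𝓘(ℂ, EF₂) ω F₂]
  (c₁ : B₁.Connection) (c₂ : B₂.Connection) (e : FrameInclusion B₁ L₁)
  (S₁ : HomogeneousSubmanifold EF₁ F₁ r₁ L₁)
  {τ₁ : B₁.Triv} {τ₂ : B₂.Triv} {x₀ : M} {f₁ : F₁} {f₂ : F₂}
  {z : TwistorBundle EF₁ F₁ EF₂ F₂ B₁ B₂} (hz : z ∈ (coord τ₁ τ₂ x₀ f₁ f₂).source)

variable (τ₁ τ₂ x₀ f₁ f₂ z) in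
/-- The vertical part, with respect to the first connection, of a tangent vector in coordinates. -/
noncomputable def vert₁ : EM × EF₁ × EF₂ →L[ℝ] EF₁ :=
  (ContinuousLinearMap.fst ℝ EF₁ EF₂).comp (ContinuousLinearMap.snd ℝ EM (EF₁ × EF₂)) +
    ((PrincipalBundle.infAct G₁ f₁ (z.fib₁ τ₁)).comp
      (c₁.localForm τ₁ x₀ (chartAt EM x₀ z.proj))).comp (ContinuousLinearMap.fst ℝ EM (EF₁ × EF₂))

variable (τ₁ τ₂ x₀ f₁ f₂ z) in
/-- The vertical part, with respect to the second connection, of a tangent vector in coordinates. -/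
noncomputable def vert₂ : EM × EF₁ × EF₂ →L[ℝ] EF₂ :=
  (ContinuousLinearMap.snd ℝ EF₁ EF₂).comp (ContinuousLinearMap.snd ℝ EM (EF₁ × EF₂)) +
    ((PrincipalBundle.infAct G₂ f₂ (z.fib₂ τ₂)).comp
      (c₂.localForm τ₂ x₀ (chartAt EM x₀ z.proj))).comp (ContinuousLinearMap.fst ℝ EM (EF₁ × EF₂))

omit [IsManifold 𝓘(ℝ, EM) ∞ M] [IsManifold 𝓘(ℝ, EP₂) ∞ P₂] [IsManifold 𝓘(ℂ, EF₁) ω F₁]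
  [IsManifold 𝓘(ℂ, EF₂) ω F₂] in
theorem vert₁_apply (v : EM × EF₁ × EF₂) : z.vert₁ c₁ τ₁ x₀ f₁ v =
    v.2.1 + PrincipalBundle.infAct G₁ f₁ (z.fib₁ τ₁)
      (c₁.localForm τ₁ x₀ (chartAt EM x₀ z.proj) v.1) := rfl

omit [IsManifold 𝓘(ℝ, EM) ∞ M] [IsManifold 𝓘(ℝ, EP₁) ∞ P₁] [IsManifold 𝓘(ℂ, EF₁) ω F₁]
  [IsManifold 𝓘(ℂ, EF₂) ω F₂] in
theorem vert₂_apply (v : EM × EF₁ × EF₂) : z.vert₂ c₂ τ₂ x₀ f₂ v =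
    v.2.2 + PrincipalBundle.infAct G₂ f₂ (z.fib₂ τ₂)
      (c₂.localForm τ₂ x₀ (chartAt EM x₀ z.proj) v.1) := rfl

include hz

theorem mem_horizontal_iff (V : TangentSpace (modelQ EM EF₁ EF₂) z) {v : EM × EF₁ × EF₂}
    (hv : mD (modelQ EM EF₁ EF₂) 𝓘(ℝ, EM × EF₁ × EF₂) (coord τ₁ τ₂ x₀ f₁ f₂) z V = v) :
    V ∈ z.horizontal c₁ c₂ ↔ z.vert₁ c₁ τ₁ x₀ f₁ v = 0 ∧ z.vert₂ c₂ τ₂ x₀ f₂ v = 0 := by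
  obtain ⟨hx, hxφ, hf₁, hf₂⟩ := (mem_coord_source z).1 hz
  have h1 := c₁.mem_assocHorizontal_iff (z := z.toQ₁)
    ((PrincipalBundle.mem_assocCoord_source _).2 ⟨hx.1, hxφ, hf₁⟩)
    (mD (modelQ EM EF₁ EF₂) (𝓘(ℝ, EM).prod 𝓘(ℝ, EF₁)) toQ₁ z V) (mD_assocCoord_toQ₁ hz V)
  have h2 := c₂.mem_assocHorizontal_iff (z := z.toQ₂)
    ((PrincipalBundle.mem_assocCoord_source _).2 ⟨hx.2, hxφ, hf₂⟩)
    (mD (modelQ EM EF₁ EF₂) (𝓘(ℝ, EM).prod 𝓘(ℝ, EF₂)) toQ₂ z V) (mD_assocCoord_toQ₂ hz V)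
  subst hv
  rw [vert₁_apply, vert₂_apply]
  refine Iff.trans ?_ (and_congr h1 h2)
  exact Submodule.mem_inf

/-- Subtracting the vertical part of a complex vector leaves a horizontal one with the same
projection to `M`. Hence membership in the sum splits into a condition on the projection and a type
condition on the vertical parts. The parameter `ε` treats the types `(0,1)` and `(1,0)` together,
with `ε = i` and `ε = -i`. -/
theorem mem_sup_map_verticalMap_iff {D : Submodule ℂ (ℂ ⊗[ℝ] (EF₁ × EF₂))} {ε : ℂ}
    (hD : ∀ ζ, ζ ∈ D ↔ reC _ ζ + ε • imC _ ζ = 0)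
    (X : TangentSpaceC (modelQ EM EF₁ EF₂) z) {a b : EM × EF₁ × EF₂}
    (ha : mD (modelQ EM EF₁ EF₂) 𝓘(ℝ, EM × EF₁ × EF₂) (coord τ₁ τ₂ x₀ f₁ f₂) z
      (reE (modelQ EM EF₁ EF₂) X) = a)
    (hb : mD (modelQ EM EF₁ EF₂) 𝓘(ℝ, EM × EF₁ × EF₂) (coord τ₁ τ₂ x₀ f₁ f₂) z
      (imE (modelQ EM EF₁ EF₂) X) = b) :
    X ∈ z.G0 c₁ c₂ e S₁ ⊔ D.map z.verticalMap ↔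
      (e.localCanon τ₁ x₀ (chartAt EM x₀ z.proj) a.1 +
          Complex.I • e.localCanon τ₁ x₀ (chartAt EM x₀ z.proj) b.1 ∈ (S₁.sub (z.fib₁ τ₁)).1) ∧
        z.vert₁ c₁ τ₁ x₀ f₁ a + ε • z.vert₁ c₁ τ₁ x₀ f₁ b = 0 ∧
        z.vert₂ c₂ τ₂ x₀ f₂ a + ε • z.vert₂ c₂ τ₂ x₀ f₂ b = 0 := by
  obtain ⟨hx, hxφ, hf₁, hf₂⟩ := (mem_coord_source z).1 hz
  have hΦ := isSmoothCoord_coord (EF₁ := EF₁) (EF₂ := EF₂) (τ₁ := τ₁) (τ₂ := τ₂) (x₀ := x₀)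
    (f₁ := f₁) (f₂ := f₂)
  set Φ' := mD (modelQ EM EF₁ EF₂) 𝓘(ℝ, EM × EF₁ × EF₂) (coord τ₁ τ₂ x₀ f₁ f₂) z with hΦ'
  set C₁ := mD 𝓘(ℝ, EF₁) 𝓘(ℝ, EF₁)
    (fun f : F₁ ↦ chartAt EF₁ f₁ (τ₁.coord (B₁.pt z.proj) • f)) z.fibrePoint.1 with hC₁
  set C₂ := mD 𝓘(ℝ, EF₂) 𝓘(ℝ, EF₂)
    (fun f : F₂ ↦ chartAt EF₂ f₂ (τ₂.coord (B₂.pt z.proj) • f)) z.fibrePoint.2 with hC₂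
  have hCs₁ : ∀ (c : ℂ) w, C₁ (c • w) = c • C₁ w := PrincipalBundle.mD_chartAt_smul_smul EG₁ hf₁
  have hCs₂ : ∀ (c : ℂ) w, C₂ (c • w) = c • C₂ w := PrincipalBundle.mD_chartAt_smul_smul EG₂ hf₂
  have hvert : ∀ ζ : ℂ ⊗[ℝ] (EF₁ × EF₂),
      Φ' (reE _ (z.verticalMap ζ)) = (0, C₁ (reC _ ζ).1, C₂ (reC _ ζ).2) ∧
      Φ' (imE _ (z.verticalMap ζ)) = (0, C₁ (imC _ ζ).1, C₂ (imC _ ζ).2) := fun ζ ↦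
    ⟨(congrArg Φ' (reC_baseChange (E := EF₁ × EF₂) (E' := EM × EF₁ × EF₂) _ ζ)).trans
      (mD_coord_fibreInclusion hz _),
     (congrArg Φ' (imC_baseChange (E := EF₁ × EF₂) (E' := EM × EF₁ × EF₂) _ ζ)).trans
      (mD_coord_fibreInclusion hz _)⟩
  have hG0 : ∀ (Y : TangentSpaceC (modelQ EM EF₁ EF₂) z) {a b : EM × EF₁ × EF₂},
      Φ' (reE _ Y) = a → Φ' (imE _ Y) = b → (Y ∈ z.G0 c₁ c₂ e S₁ ↔
        ((z.vert₁ c₁ τ₁ x₀ f₁ a = 0 ∧ z.vert₂ c₂ τ₂ x₀ f₂ a = 0) ∧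
          (z.vert₁ c₁ τ₁ x₀ f₁ b = 0 ∧ z.vert₂ c₂ τ₂ x₀ f₂ b = 0)) ∧
        e.localCanon τ₁ x₀ (chartAt EM x₀ z.proj) a.1 +
          Complex.I • e.localCanon τ₁ x₀ (chartAt EM x₀ z.proj) b.1 ∈ (S₁.sub (z.fib₁ τ₁)).1) := by
    intro Y a b ha hb
    refine and_congr ?_ ?_
    · refine (mem_baseChange_iff (z.horizontal c₁ c₂) Y).trans (and_congr ?_ ?_)
      · exact mem_horizontal_iff c₁ c₂ hz _ ha
      · exact mem_horizontal_iff c₁ c₂ hz _ hb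
    · have h1 := (mD_chartAt_proj hz (reE _ Y)).trans (congrArg Prod.fst ha)
      have h2 := (mD_chartAt_proj hz (imE _ Y)).trans (congrArg Prod.fst hb)
      refine e.mem_map_frame_iff S₁ hx.1 hxφ z.fibrePoint.1 ?_ ?_
      · refine Eq.trans ?_ h1
        exact congrArg _ (reC_baseChange (E := EM × EF₁ × EF₂) (E' := EM) _ Y)
      · refine Eq.trans ?_ h2
        exact congrArg _ (imC_baseChange (E := EM × EF₁ × EF₂) (E' := EM) _ Y)
  have hadd : ∀ Y Z : TangentSpaceC (modelQ EM EF₁ EF₂) z,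
      Φ' (reE _ (Y + Z)) = Φ' (reE _ Y) + Φ' (reE _ Z) ∧
      Φ' (imE _ (Y + Z)) = Φ' (imE _ Y) + Φ' (imE _ Z) := fun Y Z ↦
    ⟨(congrArg Φ' (map_add (reC (EM × EF₁ × EF₂)) Y Z)).trans (map_add Φ' _ _),
      (congrArg Φ' (map_add (imC (EM × EF₁ × EF₂)) Y Z)).trans (map_add Φ' _ _)⟩
  constructor
  · intro hX
    obtain ⟨Y, hY, Z, ⟨ζ, hζ, rfl⟩, rfl⟩ := Submodule.mem_sup.1 hX
    obtain ⟨⟨⟨h1, h2⟩, h3, h4⟩, h5⟩ := (hG0 Y rfl rfl).1 hY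
    have hζ' := (hD ζ).1 hζ
    rw [(hadd _ _).1, (hvert ζ).1] at ha
    rw [(hadd _ _).2, (hvert ζ).2] at hb
    subst ha hb
    refine ⟨by simpa using h5, ?_, ?_⟩
    · rw [map_add, map_add, h1, h3, vert₁_apply, vert₁_apply]
      simp only [map_zero, add_zero, zero_add]
      rw [← hCs₁, ← map_add]
      have := congrArg Prod.fst hζ'
      exact (congrArg C₁ this).trans (map_zero C₁)
    · rw [map_add, map_add, h2, h4, vert₂_apply, vert₂_apply]
      simp only [map_zero, add_zero, zero_add]
      rw [← hCs₂, ← map_add]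
      have := congrArg Prod.snd hζ'
      exact (congrArg C₂ this).trans (map_zero C₂)
  · rintro ⟨h1, h2, h3⟩
    -- The vertical part of `b` determines the candidate: `p₁`, `p₂` represent it in the fibre, and
    -- the real part `-ε (p₁, p₂)` is forced by membership in `D`. The hypotheses say that it then
    -- also matches the vertical part of `a`.
    obtain ⟨p₁, hp₁⟩ := PrincipalBundle.mD_chartAt_smul_surjective EG₁ hf₁ (z.vert₁ c₁ τ₁ x₀ f₁ b)
    obtain ⟨p₂, hp₂⟩ := PrincipalBundle.mD_chartAt_smul_surjective EG₂ hf₂ (z.vert₂ c₂ τ₂ x₀ f₂ b)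
    let ζ : ℂ ⊗[ℝ] (EF₁ × EF₂) := (1 : ℂ) ⊗ₜ[ℝ] (-(ε • (p₁, p₂))) + Complex.I ⊗ₜ[ℝ] (p₁, p₂)
    have hre : reC _ ζ = -(ε • (p₁, p₂)) := reC_mk _ _
    have him : imC _ ζ = (p₁, p₂) := imC_mk _ _
    have hζ : ζ ∈ D := by
      rw [hD, hre, him, neg_add_cancel]
    have hsub : ∃ Y, Y + z.verticalMap ζ = X := ⟨X - z.verticalMap ζ, sub_add_cancel _ _⟩
    obtain ⟨Y, rfl⟩ := hsub
    refine add_mem (Submodule.mem_sup_left ?_)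
      (Submodule.mem_sup_right (Submodule.mem_map_of_mem hζ))
    have ha' := ha
    have hb' := hb
    rw [(hadd _ _).1, (hvert ζ).1, hre] at ha'
    rw [(hadd _ _).2, (hvert ζ).2, him] at hb'
    have hε₁ : C₁ (-(ε • p₁)) = z.vert₁ c₁ τ₁ x₀ f₁ a := by
      rw [map_neg, hCs₁, hp₁]
      exact (eq_neg_of_add_eq_zero_left h2).symm
    have hε₂ : C₂ (-(ε • p₂)) = z.vert₂ c₂ τ₂ x₀ f₂ a := by
      rw [map_neg, hCs₂, hp₂]
      exact (eq_neg_of_add_eq_zero_left h3).symm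
    have hYa : Φ' (reE _ Y) = a - (0, z.vert₁ c₁ τ₁ x₀ f₁ a, z.vert₂ c₂ τ₂ x₀ f₂ a) := by
      rw [← hε₁, ← hε₂]
      exact eq_sub_of_add_eq ha'
    have hYb : Φ' (imE _ Y) = b - (0, z.vert₁ c₁ τ₁ x₀ f₁ b, z.vert₂ c₂ τ₂ x₀ f₂ b) := by
      rw [← hp₁, ← hp₂]
      exact eq_sub_of_add_eq hb'
    have h10 : ∀ s t, z.vert₁ c₁ τ₁ x₀ f₁ (0, s, t) = s := by
      intro s t
      simp [vert₁_apply]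
    have h20 : ∀ s t, z.vert₂ c₂ τ₂ x₀ f₂ (0, s, t) = t := by
      intro s t
      simp [vert₂_apply]
    refine (hG0 Y hYa hYb).2 ⟨⟨⟨?_, ?_⟩, ?_, ?_⟩, ?_⟩
    · rw [map_sub, h10, sub_self]
    · rw [map_sub, h20, sub_self]
    · rw [map_sub, h10, sub_self]
    · rw [map_sub, h20, sub_self]
    · simpa using h1

end TwistorBundle

/-! ### The infinitesimal action on a homogeneous submanifold of a Grassmannian -/

namespace PrincipalBundle

variable {EG : Type*} [NormedAddCommGroup EG] [NormedSpace ℂ EG]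
  {G : Type*} [TopologicalSpace G] [ChartedSpace EG G] [Group G] [LieGroup 𝓘(ℂ, EG) ω G]
  {EF : Type*} [NormedAddCommGroup EF] [NormedSpace ℂ EF]
  {F : Type*} [TopologicalSpace F] [ChartedSpace EF F] [MulAction G F]
  [ContMDiffSMul 𝓘(ℂ, EG) 𝓘(ℂ, EF) ω G F] [IsManifold 𝓘(ℂ, EF) ω F]

/-- The infinitesimal action is the partial derivative at the identity, in the group variable, of
the jointly smooth action read in charts. -/
theorem contDiffAt_infAct (f₀ : F) {y : EF} (hy : y ∈ (chartAt EF f₀).target) :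
    ContDiffAt ℝ ∞ (fun y ↦ infAct (EG := EG) (EF := EF) G f₀ ((chartAt EF f₀).symm y)) y := by
  have : IsManifold 𝓘(ℂ, EG) ω G := inferInstance
  have hψ : IsSmoothCoord 𝓘(ℝ, EF) (chartAt EF f₀) := isSmoothCoord_chartAt f₀
  have hκ : IsSmoothCoord 𝓘(ℝ, EG) (chartAt EG (1 : G)) := isSmoothCoord_chartAt 1
  have h1 : (1 : G) ∈ (chartAt EG (1 : G)).source := mem_chart_source EG 1
  have hκ1 : (chartAt EG (1 : G)).symm (chartAt EG (1 : G) 1) = 1 := (chartAt EG (1 : G)).left_inv h1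
  have hs := (contMDiff_real_of_complex (ContMDiffSMul.contMDiff_smul (I := 𝓘(ℂ, EG))
      (I' := 𝓘(ℂ, EF)) (n := ω) (G := G) (M := F)))
  let h (p : EG × EF) : EF :=
    chartAt EF f₀ ((chartAt EG (1 : G)).symm p.1 • (chartAt EF f₀).symm p.2)
  have hh : ∀ y ∈ (chartAt EF f₀).target, ContDiffAt ℝ ∞ h (chartAt EG (1 : G) 1, y) := by
    intro y hy
    refine ContMDiffAt.contDiffAt ?_
    refine ContMDiffAt.comp (I' := 𝓘(ℝ, EF)) (chartAt EG (1 : G) 1, y) (g := chartAt EF f₀)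
      (f := fun p : EG × EF ↦ (chartAt EG (1 : G)).symm p.1 • (chartAt EF f₀).symm p.2) ?_ ?_
    · refine hψ.contMDiffAt ?_
      rw [hκ1, one_smul]
      exact (chartAt EF f₀).map_target hy
    · have h2 : ContMDiffAt 𝓘(ℝ, EG × EF) 𝓘(ℝ, EG) ∞
          (fun p : EG × EF ↦ (chartAt EG (1 : G)).symm p.1) (chartAt EG (1 : G) 1, y) :=
        ContMDiffAt.comp (chartAt EG (1 : G) 1, y) (g := (chartAt EG (1 : G)).symm)
          (f := fun p : EG × EF ↦ p.1)
          (hκ.contMDiffAt_symm ((chartAt EG (1 : G)).map_source h1)) contDiff_fst.contMDiff.contMDiffAt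
      have h3 : ContMDiffAt 𝓘(ℝ, EG × EF) 𝓘(ℝ, EF) ∞
          (fun p : EG × EF ↦ (chartAt EF f₀).symm p.2) (chartAt EG (1 : G) 1, y) :=
        ContMDiffAt.comp (chartAt EG (1 : G) 1, y) (g := (chartAt EF f₀).symm)
          (f := fun p : EG × EF ↦ p.2)
          (hψ.contMDiffAt_symm hy) contDiff_snd.contMDiff.contMDiffAt
      exact hs.contMDiffAt.comp (chartAt EG (1 : G) 1, y) (h2.prodMk h3)
  have heq : ∀ y ∈ (chartAt EF f₀).target, infAct (EG := EG) (EF := EF) G f₀ ((chartAt EF f₀).symm y) =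
      (fderiv ℝ h (chartAt EG (1 : G) 1, y)).comp (ContinuousLinearMap.inl ℝ EG EF) := by
    intro y hy
    have h4 : HasFDerivAt (fun γ : EG ↦ (γ, y)) (ContinuousLinearMap.inl ℝ EG EF)
        (chartAt EG (1 : G) 1) := hasFDerivAt_prodMk_left _ _
    have h5 := HasFDerivAt.comp (g := h) (f := fun γ : EG ↦ (γ, y)) _
      ((hh y hy).differentiableAt (by simp)).hasFDerivAt h4
    rw [← h5.fderiv]
    ext v
    have h6 := mD_comp_apply (I := 𝓘(ℝ, EG)) (I' := 𝓘(ℝ, EG)) (I'' := 𝓘(ℝ, EF))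
      (f := chartAt EG (1 : G)) (g := fun γ ↦ h (γ, y)) (x := 1) rfl
      h5.differentiableAt.mdifferentiableAt (hκ.mdifferentiableAt h1) v
    rw [mD_chartAt_self, mD_eq_fderiv] at h6
    refine Eq.trans ?_ h6
    refine congrArg (fun l : EG →L[ℝ] EF ↦ l v) (mD_congr ?_)
    filter_upwards [(chartAt EG (1 : G)).open_source.mem_nhds h1] with g hg
    simp only [h, (chartAt EG (1 : G)).left_inv hg]
  have h7 : ContDiffAt ℝ ∞ (fun y ↦ (fderiv ℝ h (chartAt EG (1 : G) 1, y)).comp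
      (ContinuousLinearMap.inl ℝ EG EF)) y := by
    have h8 : ContDiffAt ℝ ∞ (fderiv ℝ h) (chartAt EG (1 : G) 1, y) :=
      (hh y hy).fderiv_right (by simp)
    exact (h8.comp y (contDiffAt_const.prodMk contDiffAt_id)).clm_comp contDiffAt_const
  refine h7.congr_of_eventuallyEq ?_
  filter_upwards [(chartAt EF f₀).open_target.mem_nhds hy] with y hy using heq y hy

end PrincipalBundle

/-! ### Local equations of a homogeneous submanifold and its infinitesimal stabilizers -/

namespace HomogeneousSubmanifold

variable {EG : Type*} [NormedAddCommGroup EG] [NormedSpace ℂ EG]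
  {G : Type*} [TopologicalSpace G] [ChartedSpace EG G] [Group G]
  {EF : Type*} [NormedAddCommGroup EF] [NormedSpace ℂ EF]
  {F : Type*} [TopologicalSpace F] [ChartedSpace EF F] [MulAction G F]
  [ContMDiffSMul 𝓘(ℂ, EG) 𝓘(ℂ, EF) ω G F] [IsManifold 𝓘(ℂ, EF) ω F]
  {m r : ℕ} {L : LieSubgroupGL m EG G} (S : HomogeneousSubmanifold EF F r L)

/-- The Lie algebra homomorphism given by the inclusion of a Lie subgroup of `GL(m, ℂ)`. -/
noncomputable def _root_.LieSubgroupGL.infRep (L : LieSubgroupGL m EG G) :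
    EG →L[ℂ] (Fin m → ℂ) →L[ℂ] (Fin m → ℂ) :=
  mfderiv 𝓘(ℂ, EG) 𝓘(ℂ, (Fin m → ℂ) →L[ℂ] (Fin m → ℂ)) L.rep 1

/-- A family of complex linear maps, smooth in coordinates on `F` around `f₀`, whose kernels are the
subspaces given by the points of `F`. -/
structure DefiningMap (f₀ : F) where
  W : Type
  [normedAddCommGroup : NormedAddCommGroup W]
  [normedSpace : NormedSpace ℂ W]
  [finiteDimensional : FiniteDimensional ℂ W]
  toFun : EF → (Fin m → ℂ) →L[ℝ] W
  map_smul : ∀ y (c : ℂ) ξ, toFun y (c • ξ) = c • toFun y ξ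
  mem_iff : ∀ᶠ y in nhds (chartAt EF f₀ f₀), ∀ ξ,
    ξ ∈ (S.sub ((chartAt EF f₀).symm y)).1 ↔ toFun y ξ = 0
  contDiffAt : ∀ᶠ y in nhds (chartAt EF f₀ f₀), ContDiffAt ℝ ∞ toFun y
  surjective : ∀ y, Function.Surjective (toFun y)
  fderiv_smul : ∀ (c : ℂ) w ξ, fderiv ℝ toFun (chartAt EF f₀ f₀) (c • w) ξ =
    c • fderiv ℝ toFun (chartAt EF f₀ f₀) w ξ
  eq_zero : ∀ w, (∀ ξ ∈ (S.sub f₀).1, fderiv ℝ toFun (chartAt EF f₀ f₀) w ξ = 0) → w = 0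

attribute [instance] DefiningMap.normedAddCommGroup DefiningMap.normedSpace
  DefiningMap.finiteDimensional

-- The local equations are `pW ξ - ev (A f) ξ = 0`, where only `A f` depends on the point and does
-- so holomorphically. Their derivative in direction `w` is thus `-ev (dA (w))`, complex linear in
-- `w`, and injectivity of `dA` becomes `eq_zero`.
omit [ContMDiffSMul 𝓘(ℂ, EG) 𝓘(ℂ, EF) ω G F] in
variable {S} in
theorem nonempty_definingMap_of {f₀ : F} {W : Type} [NormedAddCommGroup W] [NormedSpace ℂ W]
    [FiniteDimensional ℂ W] {T : Type*} [NormedAddCommGroup T] [NormedSpace ℂ T]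
    [FiniteDimensional ℂ T] (pW : (Fin m → ℂ) →ₗ[ℂ] W) (ev : T →ₗ[ℂ] (Fin m → ℂ) →ₗ[ℂ] W) {A : F → T}
    (hAs : ContMDiffAt 𝓘(ℂ, EF) 𝓘(ℂ, T) ω A f₀)
    (hmem : ∀ᶠ f in nhds f₀, ∀ ξ, ξ ∈ (S.sub f).1 ↔ pW ξ - ev (A f) ξ = 0)
    (hsurj : ∀ t w, ∃ ξ, pW ξ - ev t ξ = w)
    (hinj : ∀ w : EF, (∀ ξ ∈ (S.sub f₀).1,
      ev (mfderiv 𝓘(ℂ, EF) 𝓘(ℂ, T) A f₀ w) ξ = 0) → w = 0) : Nonempty (S.DefiningMap f₀) := by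
  have hψ : IsSmoothCoord 𝓘(ℝ, EF) (chartAt EF f₀) := isSmoothCoord_chartAt f₀
  have hψ0 : (chartAt EF f₀).symm (chartAt EF f₀ f₀) = f₀ :=
    (chartAt EF f₀).left_inv (mem_chart_source EF f₀)
  have hψt := mem_chart_target EF f₀
  have hψc : Filter.Tendsto (chartAt EF f₀).symm (nhds (chartAt EF f₀ f₀)) (nhds f₀) := by
    have h := (chartAt EF f₀).continuousAt_symm hψt
    rwa [ContinuousAt, hψ0] at h
  let q : ((Fin m → ℂ) →ₗ[ℂ] W) →ₗ[ℝ] ((Fin m → ℂ) →L[ℝ] W) :=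
    { toFun := fun T ↦ (T.restrictScalars ℝ).toContinuousLinearMap
      map_add' := fun _ _ ↦ rfl
      map_smul' := fun _ _ ↦ rfl }
  have : FiniteDimensional ℝ T := FiniteDimensional.complexToReal T
  let l : T →L[ℝ] ((Fin m → ℂ) →L[ℝ] W) := (q ∘ₗ ev.restrictScalars ℝ).toContinuousLinearMap
  have hl : ∀ t ξ, l t ξ = ev t ξ := fun _ _ ↦ rfl
  let A' (y : EF) := A ((chartAt EF f₀).symm y)
  have hA's : ∀ᶠ y in nhds (chartAt EF f₀ f₀), ContDiffAt ℝ ∞ A' y := by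
    have h1 := hψc.eventually ((contMDiffAt_iff_contMDiffAt_nhds (by simp)).1 hAs)
    filter_upwards [h1, (chartAt EF f₀).open_target.mem_nhds hψt] with y hy hyt
    exact ((contMDiffAt_real_of_complex hy).comp y (hψ.contMDiffAt_symm hyt)).contDiffAt
  have hA'd : ∀ w, fderiv ℝ A' (chartAt EF f₀ f₀) w = mD 𝓘(ℝ, EF) 𝓘(ℝ, T) A f₀ w := by
    intro w
    rw [← mD_eq_fderiv, mD_comp_apply hψ0
      ((contMDiffAt_real_of_complex hAs).mdifferentiableAt (by simp))
      (hψ.mdifferentiableAt_symm hψt)]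
    have h2 := hψ.mD_symm_mD (mem_chart_source EF f₀) w
    rw [mD_chartAt_self] at h2
    rw [h2]
  have hDd : ∀ w ξ, fderiv ℝ (fun y ↦ q pW - l (A' y)) (chartAt EF f₀ f₀) w ξ =
      -ev (mD 𝓘(ℝ, EF) 𝓘(ℝ, T) A f₀ w) ξ := by
    intro w ξ
    have h3 := (l.hasFDerivAt.comp (chartAt EF f₀ f₀)
      (hA's.self_of_nhds.differentiableAt (by simp)).hasFDerivAt).const_sub (q pW)
    have h4 := congrArg (fun T ↦ T w ξ) h3.fderiv
    refine h4.trans ?_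
    change -(l (fderiv ℝ A' (chartAt EF f₀ f₀) w)) ξ = _
    rw [hA'd, hl]
  refine ⟨{
    W := W
    toFun := fun y ↦ q pW - l (A' y)
    map_smul := ?_
    mem_iff := ?_
    contDiffAt := ?_
    surjective := ?_
    fderiv_smul := ?_
    eq_zero := ?_ }⟩
  · intro y c ξ
    exact LinearMap.map_smul (pW - ev (A' y)) c ξ
  · filter_upwards [hψc.eventually hmem] with y hy ξ
    exact hy ξ
  · filter_upwards [hA's] with y hy
    exact contDiffAt_const.sub (l.contDiff.contDiffAt.comp y hy)
  · exact fun y ξ ↦ hsurj _ ξ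
  · intro c w ξ
    rw [hDd, hDd, mD_smul (hAs.mdifferentiableAt (by simp)), smul_neg, map_smul]
    rfl
  · intro w hw
    refine hinj w fun ξ hξ ↦ ?_
    have h6 := hw ξ hξ
    rw [hDd, neg_eq_zero, mD_eq_complex (hAs.mdifferentiableAt (by simp))] at h6
    exact h6

-- Near `f₀` the subspaces are graphs of linear maps `A f` from that of `f₀` to a complement `W`. A
-- vector lies on the graph exactly when its `W`-component is `A f` of its other component.
omit [ContMDiffSMul 𝓘(ℂ, EG) 𝓘(ℂ, EF) ω G F] in
theorem nonempty_definingMap (f₀ : F) : Nonempty (S.DefiningMap f₀) := by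
  obtain ⟨W, hW, A, hA, hAs, hAi⟩ := S.immersion f₀
  let pS := (S.sub f₀).1.projectionOnto W hW
  let pW := W.projectionOnto (S.sub f₀).1 hW.symm
  have hpS : ∀ ξ : (S.sub f₀).1, pS ξ = ξ := Submodule.projectionOnto_apply_left hW
  have hpW : ∀ ξ : W, pW ξ = ξ := Submodule.projectionOnto_apply_left hW.symm
  have hpSW : ∀ ξ : W, pS ξ = 0 := fun ξ ↦ Submodule.projectionOnto_apply_right hW ξ
  have hpWS : ∀ ξ : (S.sub f₀).1, pW ξ = 0 := fun ξ ↦ Submodule.projectionOnto_apply_right hW.symm ξ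
  let ev : ((S.sub f₀).1 →L[ℂ] W) →ₗ[ℂ] (Fin m → ℂ) →ₗ[ℂ] W :=
    { toFun := fun T ↦ T.toLinearMap ∘ₗ pS
      map_add' := fun _ _ ↦ rfl
      map_smul' := fun _ _ ↦ rfl }
  have hev : ∀ T ξ, ev T ξ = T (pS ξ) := fun _ _ ↦ rfl
  refine nonempty_definingMap_of pW ev hAs ?_ ?_ ?_
  · filter_upwards [hA] with f hf ξ
    rw [hf, sub_eq_zero, hev]
    constructor
    · rintro ⟨σ, rfl⟩
      change pW ((σ : Fin m → ℂ) + (A f σ : Fin m → ℂ)) =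
        A f (pS ((σ : Fin m → ℂ) + (A f σ : Fin m → ℂ)))
      rw [map_add, map_add, hpS, hpW, hpSW, hpWS, zero_add, add_zero]
    · intro h
      refine ⟨pS ξ, ?_⟩
      change (pS ξ : Fin m → ℂ) + (A f (pS ξ) : Fin m → ℂ) = ξ
      rw [← h]
      exact LinearMap.congr_fun (Submodule.projection_add_projection_eq_id hW) ξ
  · intro T ξ
    -- On `W` the equation reduces to the identity, whatever the linear map.
    refine ⟨ξ, ?_⟩
    rw [hev, hpW, hpSW, map_zero, sub_zero]
  · intro w hw
    apply hAi
    refine Eq.trans ?_ (map_zero (mfderiv 𝓘(ℂ, EF) 𝓘(ℂ, (S.sub f₀).1 →L[ℂ] W) A f₀)).symm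
    refine ContinuousLinearMap.ext fun ξ ↦ ?_
    have h6 : (show (S.sub f₀).1 →L[ℂ] W from
        mfderiv 𝓘(ℂ, EF) 𝓘(ℂ, (S.sub f₀).1 →L[ℂ] W) A f₀ w) (pS ξ) = 0 := hw ξ ξ.2
    rw [hpS] at h6
    exact h6

namespace DefiningMap

variable {S} {f₀ : F} (d : S.DefiningMap f₀)

omit [ContMDiffSMul 𝓘(ℂ, EG) 𝓘(ℂ, EF) ω G F] [IsManifold 𝓘(ℂ, EF) ω F] in
theorem mem_sub_iff (ξ : Fin m → ℂ) :
    ξ ∈ (S.sub f₀).1 ↔ d.toFun (chartAt EF f₀ f₀) ξ = 0 := by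
  have h := d.mem_iff.self_of_nhds ξ
  rwa [(chartAt EF f₀).left_inv (mem_chart_source EF f₀)] at h

/-- For `ξ` in the subspace of `f₀`, the vector `g ξ` lies in that of `g • f₀`, so the local
equation at `g • f₀` vanishes on `g ξ` for `g` near the identity. The statement is the derivative of
this identity at `g = 1`. -/
theorem fderiv_infAct (η : EG) {ξ : Fin m → ℂ} (hξ : ξ ∈ (S.sub f₀).1) :
    fderiv ℝ d.toFun (chartAt EF f₀ f₀) (PrincipalBundle.infAct G f₀ f₀ η) ξ +
      d.toFun (chartAt EF f₀ f₀)
        (L.infRep η ξ) = 0 := by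
  have hψ : IsSmoothCoord 𝓘(ℝ, EF) (chartAt EF f₀) := isSmoothCoord_chartAt f₀
  have hrep : MDifferentiableAt 𝓘(ℂ, EG) 𝓘(ℂ, (Fin m → ℂ) →L[ℂ] (Fin m → ℂ)) L.rep 1 :=
    L.contMDiff_rep.mdifferentiableAt (by simp)
  have hev : MDifferentiableAt 𝓘(ℂ, (Fin m → ℂ) →L[ℂ] (Fin m → ℂ)) 𝓘(ℂ, Fin m → ℂ)
      (fun T : (Fin m → ℂ) →L[ℂ] (Fin m → ℂ) ↦ T ξ) (L.rep 1) :=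
    (ContinuousLinearMap.apply ℂ (Fin m → ℂ) ξ).differentiableAt.mdifferentiableAt
  have hk : MDifferentiableAt 𝓘(ℂ, EG) 𝓘(ℂ, Fin m → ℂ) (fun g ↦ L.rep g ξ) 1 :=
    hev.comp (1 : G) hrep
  have hkd : mfderiv 𝓘(ℂ, EG) 𝓘(ℂ, Fin m → ℂ) (fun g ↦ L.rep g ξ) 1 η =
      L.infRep η ξ := by
    have h1 := mfderiv_comp (1 : G) hev hrep
    have h2 : mfderiv 𝓘(ℂ, (Fin m → ℂ) →L[ℂ] (Fin m → ℂ)) 𝓘(ℂ, Fin m → ℂ)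
      (fun T : (Fin m → ℂ) →L[ℂ] (Fin m → ℂ) ↦ T ξ) (L.rep 1) =
        ContinuousLinearMap.apply ℂ (Fin m → ℂ) ξ := by
      rw [mfderiv_eq_fderiv]
      exact (ContinuousLinearMap.apply ℂ (Fin m → ℂ) ξ).fderiv
    rw [h2] at h1
    exact congrArg (fun T : EG →L[ℂ] (Fin m → ℂ) ↦ T η) h1
  have hsm : MDifferentiableAt 𝓘(ℝ, EG) 𝓘(ℝ, EF) (fun g : G ↦ chartAt EF f₀ (g • f₀)) 1 := by
    have h2 := (contMDiff_real_of_complex (ContMDiffSMul.contMDiff_smul (I := 𝓘(ℂ, EG))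
      (I' := 𝓘(ℂ, EF)) (n := ω) (G := G) (M := F))).mdifferentiableAt (by simp)
      (x := ((1 : G), f₀))
    have h3 : MDifferentiableAt 𝓘(ℝ, EG) 𝓘(ℝ, EF) (fun g' : G ↦ g' • f₀) 1 :=
      h2.comp (1 : G) (mdifferentiableAt_id.prodMk mdifferentiableAt_const)
    refine MDifferentiableAt.comp (1 : G) (g := chartAt EF f₀) ?_ h3
    rw [one_smul]
    exact hψ.mdifferentiableAt (mem_chart_source EF f₀)
  have hD : DifferentiableAt ℝ d.toFun (chartAt EF f₀ f₀) :=
    d.contDiffAt.self_of_nhds.differentiableAt (by simp)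
  have hkr : MDifferentiableAt 𝓘(ℝ, EG) 𝓘(ℝ, Fin m → ℂ) (fun g ↦ L.rep g ξ) 1 := by
    have h1 : ContMDiffAt 𝓘(ℂ, EG) 𝓘(ℂ, Fin m → ℂ) ω (fun g ↦ L.rep g ξ) 1 :=
      (ContinuousLinearMap.apply ℂ (Fin m → ℂ) ξ).contDiff.contMDiff.contMDiffAt.comp (1 : G)
        L.contMDiff_rep.contMDiffAt
    exact (contMDiffAt_real_of_complex h1).mdifferentiableAt (by simp)
  have hh : MDifferentiableAt (𝓘(ℝ, EF).prod 𝓘(ℝ, Fin m → ℂ)) 𝓘(ℝ, d.W)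
      (fun p : EF × (Fin m → ℂ) ↦ d.toFun p.1 p.2) (chartAt EF f₀ f₀, ξ) := by
    rw [← modelWithCornersSelf_prod, chartedSpaceSelf_prod]
    refine DifferentiableAt.mdifferentiableAt ?_
    exact (hD.comp (chartAt EF f₀ f₀, ξ) differentiableAt_fst).clm_apply differentiableAt_snd
  have h0 := mD_comp₂ (h := fun p : EF × (Fin m → ℂ) ↦ d.toFun p.1 p.2)
    (f := fun g : G ↦ chartAt EF f₀ (g • f₀)) (g := fun g ↦ L.rep g ξ) (x := 1)
    (by simp) (by simp) hh hsm hkr η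
  have hkd' : mD 𝓘(ℝ, EG) 𝓘(ℝ, Fin m → ℂ) (fun g ↦ L.rep g ξ) 1 η = _ := mD_eq_complex hk η
  rw [hkd', hkd] at h0
  have h3 : mD 𝓘(ℝ, EG) 𝓘(ℝ, d.W) (fun g : G ↦ d.toFun (chartAt EF f₀ (g • f₀)) (L.rep g ξ)) 1 =
      0 := by
    rw [← mD_const (I := 𝓘(ℝ, EG)) (I' := 𝓘(ℝ, d.W)) (0 : d.W) (1 : G)]
    apply mD_congr
    have hc : ContinuousAt (fun g : G ↦ g • f₀) 1 :=
      ((ContMDiffSMul.contMDiff_smul (I := 𝓘(ℂ, EG)) (I' := 𝓘(ℂ, EF)) (n := ω) (G := G)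
        (M := F)).continuous.comp (Continuous.prodMk_left f₀)).continuousAt
    have h4 : ∀ᶠ g : G in nhds 1, g • f₀ ∈ (chartAt EF f₀).source :=
      hc ((chartAt EF f₀).open_source.mem_nhds (by simp))
    have h5 := hsm.continuousAt.tendsto
    rw [one_smul] at h5
    filter_upwards [h4, h5.eventually d.mem_iff] with g hg hg'
    rw [← hg', (chartAt EF f₀).left_inv hg, S.sub_smul]
    exact ⟨ξ, hξ, rfl⟩
  rw [h3] at h0
  have h6 : mD 𝓘(ℝ, EF) 𝓘(ℝ, d.W) (fun y ↦ d.toFun y ξ) (chartAt EF f₀ f₀)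
      (PrincipalBundle.infAct G f₀ f₀ η) =
      fderiv ℝ d.toFun (chartAt EF f₀ f₀) (PrincipalBundle.infAct G f₀ f₀ η) ξ := by
    rw [mD_eq_fderiv, (hD.hasFDerivAt.clm_apply (hasFDerivAt_const ξ _)).fderiv]
    simp
  have h7 : ∀ ζ, mD 𝓘(ℝ, Fin m → ℂ) 𝓘(ℝ, d.W) (fun ξ ↦ d.toFun (chartAt EF f₀ f₀) ξ) ξ ζ =
      d.toFun (chartAt EF f₀ f₀) ζ := by
    intro ζ
    rw [mD_eq_fderiv]
    exact congrArg (fun T : (Fin m → ℂ) →L[ℝ] d.W ↦ T ζ) (d.toFun (chartAt EF f₀ f₀)).fderiv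
  rw [← h6, ← h7]
  exact h0.symm

include d in
/-- The infinitesimal stabilizer of a point of `F`. -/
theorem infAct_eq_zero_iff (η : EG) : PrincipalBundle.infAct G f₀ f₀ η = (0 : EF) ↔
    ∀ ξ ∈ (S.sub f₀).1,
      L.infRep η ξ ∈ (S.sub f₀).1 := by
  constructor
  · intro h ξ hξ
    have h1 := d.fderiv_infAct η hξ
    rw [h, map_zero] at h1
    rw [d.mem_sub_iff]
    exact (zero_add _).symm.trans h1
  · intro h
    -- A tangent vector of `F` along which the local equations do not vary on the subspace is zero,
    -- as `F` is immersed.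
    refine d.eq_zero _ fun ξ hξ ↦ ?_
    have h1 := d.fderiv_infAct η hξ
    rwa [(d.mem_sub_iff _).1 (h ξ hξ), add_zero] at h1

end DefiningMap

end HomogeneousSubmanifold

/-! ### The form which defines the distributions in coordinates -/

section ModelForm

variable {EM EF₁ EF₂ EG₁ EG₂ W : Type*} {m : ℕ}
  [NormedAddCommGroup EM] [NormedSpace ℝ EM]
  [NormedAddCommGroup EF₁] [NormedSpace ℂ EF₁] [NormedAddCommGroup EF₂] [NormedSpace ℂ EF₂]
  [NormedAddCommGroup EG₁] [NormedSpace ℂ EG₁] [NormedAddCommGroup EG₂] [NormedSpace ℂ EG₂]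
  [NormedAddCommGroup W] [NormedSpace ℂ W]

/-- The complexified value of a real 2-form. -/
def twoFormC {V : Type*} [AddCommGroup V] [Module ℂ V] (β : EM → EM → V) (a b c d : EM) : V :=
  (β a c - β b d) + Complex.I • (β a d + β b c)

/-- The real linear map `(Id, J, J)` for a complex scalar `J`. -/
noncomputable def modelJ (W EF₁ EF₂ : Type*) [NormedAddCommGroup W] [NormedSpace ℂ W]
    [NormedAddCommGroup EF₁] [NormedSpace ℂ EF₁] [NormedAddCommGroup EF₂] [NormedSpace ℂ EF₂]
    (ε : ℂ) : W × EF₁ × EF₂ →L[ℝ] W × EF₁ × EF₂ :=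
  ((Complex.I • ContinuousLinearMap.id ℂ W).restrictScalars ℝ).prodMap
    (((ε • ContinuousLinearMap.id ℂ EF₁).restrictScalars ℝ).prodMap
      ((ε • ContinuousLinearMap.id ℂ EF₂).restrictScalars ℝ))

theorem modelJ_apply (ε : ℂ) (k : W × EF₁ × EF₂) :
    modelJ W EF₁ EF₂ ε k = (Complex.I • k.1, ε • k.2.1, ε • k.2.2) := rfl

theorem modelJ_modelJ {ε : ℂ} (hε : ε * ε = -1) (k : W × EF₁ × EF₂) :
    modelJ W EF₁ EF₂ ε (modelJ W EF₁ EF₂ ε k) = -k := by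
  simp only [modelJ_apply, smul_smul, hε, Complex.I_mul_I, neg_smul, one_smul]
  rfl

/-- A composition of a family of linear maps with a 1-form. -/
theorem hasFDerivAt_comp_comp {E A B C X Y : Type*} [NormedAddCommGroup E] [NormedSpace ℝ E]
    [NormedAddCommGroup A] [NormedSpace ℝ A] [NormedAddCommGroup B] [NormedSpace ℝ B]
    [NormedAddCommGroup C] [NormedSpace ℝ C] [NormedAddCommGroup X] [NormedSpace ℝ X]
    [NormedAddCommGroup Y] [NormedSpace ℝ Y] {T : A → X →L[ℝ] Y} {γ : B → C →L[ℝ] X}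
    (p : E →L[ℝ] A) (q : E →L[ℝ] B) (l : E →L[ℝ] C) {y : E}
    (hT : DifferentiableAt ℝ T (p y)) (hγ : DifferentiableAt ℝ γ (q y)) :
    DifferentiableAt ℝ (fun y ↦ (T (p y)).comp ((γ (q y)).comp l)) y ∧
    ∀ v w, fderiv ℝ (fun y ↦ (T (p y)).comp ((γ (q y)).comp l)) y v w =
      fderiv ℝ T (p y) (p v) (γ (q y) (l w)) + T (p y) (fderiv ℝ γ (q y) (q v) (l w)) := by
  have h1 := hT.hasFDerivAt.comp y p.hasFDerivAt
  have h2 := (hγ.hasFDerivAt.comp y q.hasFDerivAt).clm_comp (hasFDerivAt_const l y)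
  have h3 := h1.clm_comp h2
  refine ⟨h3.differentiableAt, fun v w ↦ ?_⟩
  refine (congrArg (fun S ↦ S v w) h3.fderiv).trans ?_
  simp [add_comm]

variable (D : EF₁ → (Fin m → ℂ) →L[ℝ] W) (θ : EM → EM →L[ℝ] (Fin m → ℂ))
  (a₁ : EF₁ → EG₁ →L[ℝ] EF₁) (A₁ : EM → EM →L[ℝ] EG₁)
  (a₂ : EF₂ → EG₂ →L[ℝ] EF₂) (A₂ : EM → EM →L[ℝ] EG₂)

/-- The 1-form the kernel of whose complexification is the distribution. -/
noncomputable def modelForm (y : EM × EF₁ × EF₂) : EM × EF₁ × EF₂ →L[ℝ] W × EF₁ × EF₂ :=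
  ((D y.2.1).comp ((θ y.1).comp (ContinuousLinearMap.fst ℝ EM (EF₁ × EF₂)))).prod
    (((ContinuousLinearMap.fst ℝ EF₁ EF₂).comp (ContinuousLinearMap.snd ℝ EM (EF₁ × EF₂)) +
        (a₁ y.2.1).comp ((A₁ y.1).comp (ContinuousLinearMap.fst ℝ EM (EF₁ × EF₂)))).prod
      ((ContinuousLinearMap.snd ℝ EF₁ EF₂).comp (ContinuousLinearMap.snd ℝ EM (EF₁ × EF₂)) +
        (a₂ y.2.2).comp ((A₂ y.1).comp (ContinuousLinearMap.fst ℝ EM (EF₁ × EF₂)))))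

variable {D θ a₁ A₁ a₂ A₂}

theorem modelForm_apply (y v : EM × EF₁ × EF₂) : modelForm D θ a₁ A₁ a₂ A₂ y v =
    (D y.2.1 (θ y.1 v.1), v.2.1 + a₁ y.2.1 (A₁ y.1 v.1), v.2.2 + a₂ y.2.2 (A₂ y.1 v.1)) := rfl

theorem modelForm_ker_iff {y : EM × EF₁ × EF₂} (h₁ : A₁ y.1 = 0) (h₂ : A₂ y.1 = 0)
    (hDs : ∀ (c : ℂ) ξ, D y.2.1 (c • ξ) = c • D y.2.1 ξ) (ε : ℂ)
    (a b : EM × EF₁ × EF₂) :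
    modelForm D θ a₁ A₁ a₂ A₂ y a + modelJ W EF₁ EF₂ ε (modelForm D θ a₁ A₁ a₂ A₂ y b) = 0 ↔
      D y.2.1 (θ y.1 a.1 + Complex.I • θ y.1 b.1) = 0 ∧ a.2.1 + ε • b.2.1 = 0 ∧
        a.2.2 + ε • b.2.2 = 0 := by
  rw [modelForm_apply, modelForm_apply, modelJ_apply, h₁, h₂, map_add, hDs]
  simp only [zero_apply, map_zero, add_zero, Prod.ext_iff]
  rfl

/-- The form is surjective at a point where the complexification of `θ` is. -/
theorem modelForm_surjective {y : EM × EF₁ × EF₂} (h₁ : A₁ y.1 = 0) (h₂ : A₂ y.1 = 0)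
    (hDs : ∀ (c : ℂ) ξ, D y.2.1 (c • ξ) = c • D y.2.1 ξ)
    (hDsurj : Function.Surjective (D y.2.1))
    (hθsurj : ∀ ξ, ∃ a b, θ y.1 a + Complex.I • θ y.1 b = ξ) (ε : ℂ) (k : W × EF₁ × EF₂) :
    ∃ a b, modelForm D θ a₁ A₁ a₂ A₂ y a + modelJ W EF₁ EF₂ ε (modelForm D θ a₁ A₁ a₂ A₂ y b) =
      k := by
  obtain ⟨ξ, hξ⟩ := hDsurj k.1
  obtain ⟨a, b, hab⟩ := hθsurj ξ
  refine ⟨(a, k.2.1, k.2.2), (b, 0, 0), ?_⟩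
  rw [modelForm_apply, modelForm_apply, modelJ_apply, h₁, h₂]
  simp only [zero_apply, map_zero, add_zero, smul_zero, ← hDs]
  refine Prod.ext ?_ (Prod.ext ?_ ?_)
  · change D y.2.1 _ + D y.2.1 _ = _
    rw [← map_add, hab, hξ]
  · exact add_zero _
  · exact add_zero _

variable [FiniteDimensional ℝ EM] [FiniteDimensional ℂ EF₁] [FiniteDimensional ℂ EF₂]
  {y : EM × EF₁ × EF₂} (hD : ContDiffAt ℝ ∞ D y.2.1)
  (hθ : ContDiffAt ℝ ∞ θ y.1) (ha₁ : ContDiffAt ℝ ∞ a₁ y.2.1) (hA₁ : ContDiffAt ℝ ∞ A₁ y.1)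
  (ha₂ : ContDiffAt ℝ ∞ a₂ y.2.2) (hA₂ : ContDiffAt ℝ ∞ A₂ y.1) (h₁ : A₁ y.1 = 0) (h₂ : A₂ y.1 = 0)

include hD hθ ha₁ hA₁ ha₂ hA₂

theorem contDiffAt_modelForm : ContDiffAt ℝ ∞ (modelForm D θ a₁ A₁ a₂ A₂) y := by
  have : FiniteDimensional ℝ EF₁ := FiniteDimensional.complexToReal EF₁
  have : FiniteDimensional ℝ EF₂ := FiniteDimensional.complexToReal EF₂
  have h1 : ContDiffAt ℝ ∞ (fun y : EM × EF₁ × EF₂ ↦ y.1) y := contDiffAt_fst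
  have h2 : ContDiffAt ℝ ∞ (fun y : EM × EF₁ × EF₂ ↦ y.2.1) y := contDiffAt_snd.fst
  have h3 : ContDiffAt ℝ ∞ (fun y : EM × EF₁ × EF₂ ↦ y.2.2) y := contDiffAt_snd.snd
  refine contDiffAt_clm_of_apply fun v ↦ ?_
  simp only [modelForm_apply]
  exact ((hD.comp y h2).clm_apply ((hθ.comp y h1).clm_apply contDiffAt_const)).prodMk
    ((contDiffAt_const.add ((ha₁.comp y h2).clm_apply ((hA₁.comp y h1).clm_apply
      contDiffAt_const))).prodMk
    (contDiffAt_const.add ((ha₂.comp y h3).clm_apply ((hA₂.comp y h1).clm_apply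
      contDiffAt_const))))

-- Since `A₁` and `A₂` vanish at the point, the derivatives of `a₁` and `a₂` drop out; the
-- coordinate parts of the form are constant. Only `D` contributes a mixed term.
include h₁ h₂ in
theorem dForm_modelForm (v w : EM × EF₁ × EF₂) :
    dForm (modelForm D θ a₁ A₁ a₂ A₂) y v w =
      (D y.2.1 (dForm θ y.1 v.1 w.1) +
          (fderiv ℝ D y.2.1 v.2.1 (θ y.1 w.1) - fderiv ℝ D y.2.1 w.2.1 (θ y.1 v.1)),
        a₁ y.2.1 (dForm A₁ y.1 v.1 w.1), a₂ y.2.2 (dForm A₂ y.1 v.1 w.1)) := by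
  let p₀ := ContinuousLinearMap.fst ℝ EM (EF₁ × EF₂)
  let p₁ := (ContinuousLinearMap.fst ℝ EF₁ EF₂).comp (ContinuousLinearMap.snd ℝ EM (EF₁ × EF₂))
  let p₂ := (ContinuousLinearMap.snd ℝ EF₁ EF₂).comp (ContinuousLinearMap.snd ℝ EM (EF₁ × EF₂))
  obtain ⟨hd0, hf0⟩ := hasFDerivAt_comp_comp p₁ p₀ p₀ (y := y) (hD.differentiableAt (by simp))
    (hθ.differentiableAt (by simp))
  obtain ⟨hd1, hf1⟩ := hasFDerivAt_comp_comp p₁ p₀ p₀ (y := y) (ha₁.differentiableAt (by simp))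
    (hA₁.differentiableAt (by simp))
  obtain ⟨hd2, hf2⟩ := hasFDerivAt_comp_comp p₂ p₀ p₀ (y := y) (ha₂.differentiableAt (by simp))
    (hA₂.differentiableAt (by simp))
  have hprod : ∀ v w, fderiv ℝ (modelForm D θ a₁ A₁ a₂ A₂) y v w =
      (fderiv ℝ (fun y ↦ (D (p₁ y)).comp ((θ (p₀ y)).comp p₀)) y v w,
        fderiv ℝ (fun y ↦ (a₁ (p₁ y)).comp ((A₁ (p₀ y)).comp p₀)) y v w,
        fderiv ℝ (fun y ↦ (a₂ (p₂ y)).comp ((A₂ (p₀ y)).comp p₀)) y v w) := by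
    intro v w
    have hα : DifferentiableAt ℝ (modelForm D θ a₁ A₁ a₂ A₂) y :=
      (contDiffAt_modelForm hD hθ ha₁ hA₁ ha₂ hA₂).differentiableAt (by simp)
    have e0 := (hα.hasFDerivAt.clm_apply (hasFDerivAt_const w y))
    have e1 := (hd0.hasFDerivAt.clm_apply (hasFDerivAt_const w y)).prodMk
      (((hd1.hasFDerivAt.clm_apply (hasFDerivAt_const w y)).const_add w.2.1).prodMk
        ((hd2.hasFDerivAt.clm_apply (hasFDerivAt_const w y)).const_add w.2.2))
    have e2 := congrArg (fun S ↦ S v) (e0.unique e1)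
    simpa using e2
  have key : ∀ v w, fderiv ℝ (modelForm D θ a₁ A₁ a₂ A₂) y v w =
      (fderiv ℝ D y.2.1 v.2.1 (θ y.1 w.1) + D y.2.1 (fderiv ℝ θ y.1 v.1 w.1),
        a₁ y.2.1 (fderiv ℝ A₁ y.1 v.1 w.1), a₂ y.2.2 (fderiv ℝ A₂ y.1 v.1 w.1)) := by
    intro v w
    rw [hprod, hf0, hf1, hf2]
    have e1 : A₁ (p₀ y) = 0 := h₁
    have e2 : A₂ (p₀ y) = 0 := h₂
    rw [e1, e2]
    simp only [zero_apply, map_zero, zero_add]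
    rfl
  simp only [dForm, key, map_sub]
  refine Prod.ext ?_ rfl
  simp only [Prod.fst_sub]
  abel

variable (hDs : ∀ (c : ℂ) ξ, D y.2.1 (c • ξ) = c • D y.2.1 ξ)
  (hDd : ∀ (c : ℂ) w ξ, fderiv ℝ D y.2.1 (c • w) ξ = c • fderiv ℝ D y.2.1 w ξ)

include hD hθ ha₁ hA₁ ha₂ hA₂ h₁ h₂ hDs hDd

/-- The complexified exterior derivative for the complex structure of the distribution `𝒢`. -/
theorem closedOnKernel_modelForm_iff
    (has₁ : ∀ (c : ℂ) ξ, a₁ y.2.1 (c • ξ) = c • a₁ y.2.1 ξ)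
    (has₂ : ∀ (c : ℂ) ξ, a₂ y.2.2 (c • ξ) = c • a₂ y.2.2 ξ) :
    ClosedOnKernel (modelForm D θ a₁ A₁ a₂ A₂) (modelJ W EF₁ EF₂ Complex.I) y ↔
      ∀ a b c d : EM, D y.2.1 (θ y.1 a + Complex.I • θ y.1 b) = 0 →
        D y.2.1 (θ y.1 c + Complex.I • θ y.1 d) = 0 →
        D y.2.1 (twoFormC (dForm θ y.1) a b c d) = 0 ∧
        a₁ y.2.1 (twoFormC (dForm A₁ y.1) a b c d) = 0 ∧
        a₂ y.2.2 (twoFormC (dForm A₂ y.1) a b c d) = 0 := by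
  have key : ∀ a b c d : EM × EF₁ × EF₂, a.2.1 + Complex.I • b.2.1 = 0 →
      c.2.1 + Complex.I • d.2.1 = 0 →
      (dForm (modelForm D θ a₁ A₁ a₂ A₂) y a c - dForm (modelForm D θ a₁ A₁ a₂ A₂) y b d) +
        modelJ W EF₁ EF₂ Complex.I (dForm (modelForm D θ a₁ A₁ a₂ A₂) y a d +
          dForm (modelForm D θ a₁ A₁ a₂ A₂) y b c) =
      (D y.2.1 (twoFormC (dForm θ y.1) a.1 b.1 c.1 d.1),
        a₁ y.2.1 (twoFormC (dForm A₁ y.1) a.1 b.1 c.1 d.1),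
        a₂ y.2.2 (twoFormC (dForm A₂ y.1) a.1 b.1 c.1 d.1)) := by
    intro a b c d hab hcd
    -- The vertical parts have type `(0,1)`. As the derivative of `D` is complex linear in its
    -- direction, its complexification vanishes on them, and so the mixed terms cancel.
    have ea : a.2.1 = -(Complex.I • b.2.1) := eq_neg_of_add_eq_zero_left hab
    have ec : c.2.1 = -(Complex.I • d.2.1) := eq_neg_of_add_eq_zero_left hcd
    simp only [dForm_modelForm hD hθ ha₁ hA₁ ha₂ hA₂ h₁ h₂, modelJ_apply, twoFormC, map_add,
      map_sub, hDs, has₁, has₂, ea, ec, map_neg, neg_apply, hDd]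
    refine Prod.ext ?_ (Prod.ext ?_ ?_)
    · simp only [Prod.fst_add, Prod.fst_sub, smul_add, smul_sub, smul_neg, smul_smul,
        Complex.I_mul_I, neg_smul, one_smul]
      abel
    · simp only [Prod.fst_add, Prod.fst_sub, Prod.snd_add, Prod.snd_sub, smul_add]
    · simp only [Prod.snd_add, Prod.snd_sub, smul_add]
  constructor
  · intro h a b c d hab hcd
    -- At this point vectors with zero vertical part are horizontal, so pairs of vectors from the
    -- base already detect every condition.
    have h3 := h (a, 0, 0) (b, 0, 0) (c, 0, 0) (d, 0, 0)
      ((modelForm_ker_iff h₁ h₂ hDs _ _ _).2 ⟨hab, by simp, by simp⟩)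
      ((modelForm_ker_iff h₁ h₂ hDs _ _ _).2 ⟨hcd, by simp, by simp⟩)
    rw [key _ _ _ _ (by simp) (by simp)] at h3
    simpa [Prod.ext_iff] using h3
  · intro h a b c d hab hcd
    obtain ⟨ha, ha', -⟩ := (modelForm_ker_iff h₁ h₂ hDs _ _ _).1 hab
    obtain ⟨hc, hc', -⟩ := (modelForm_ker_iff h₁ h₂ hDs _ _ _).1 hcd
    rw [key _ _ _ _ ha' hc']
    obtain ⟨h3, h4, h5⟩ := h _ _ _ _ ha hc
    rw [h3, h4, h5]
    rfl

/-- The form is not closed for the complex structure of the distribution `𝒢'`. -/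
theorem eq_zero_of_closedOnKernel_modelForm
    (hDds : ∀ w (c : ℂ) ξ, fderiv ℝ D y.2.1 w (c • ξ) = c • fderiv ℝ D y.2.1 w ξ)
    (hθsurj : ∀ ξ, ∃ a b, θ y.1 a + Complex.I • θ y.1 b = ξ)
    (hinj : ∀ w, (∀ ξ, D y.2.1 ξ = 0 → fderiv ℝ D y.2.1 w ξ = 0) → w = 0)
    (h : ClosedOnKernel (modelForm D θ a₁ A₁ a₂ A₂) (modelJ W EF₁ EF₂ (-Complex.I)) y) (w : EF₁) :
    w = 0 := by
  refine hinj w fun ξ hξ ↦ ?_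
  obtain ⟨c, d, rfl⟩ := hθsurj ξ
  -- The vertical vector with real part `i w` and imaginary part `w` has type `(1,0)`; it is paired
  -- with a horizontal vector over `ξ`. The `W`-component of `dα` on this pair is `2 i` times the
  -- derivative of `D` along `w`, applied to `ξ`.
  have h3 := h (0, Complex.I • w, 0) (0, w, 0) (c, 0, 0) (d, 0, 0)
    ((modelForm_ker_iff h₁ h₂ hDs _ _ _).2 ⟨by simp, by simp, by simp⟩)
    ((modelForm_ker_iff h₁ h₂ hDs _ _ _).2 ⟨hξ, by simp, by simp⟩)
  simp only [dForm_modelForm hD hθ ha₁ hA₁ ha₂ hA₂ h₁ h₂, modelJ_apply, hDd, Prod.ext_iff,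
    Prod.fst_add, Prod.fst_sub, Prod.fst_zero] at h3
  have h4 := h3.1
  simp only [dForm, map_zero, zero_apply, sub_zero, zero_add, smul_add, smul_smul,
    Complex.I_mul_I, neg_smul, one_smul] at h4
  rw [map_add, hDds]
  have h5 : (2 * Complex.I) • (fderiv ℝ D y.2.1 w (θ y.1 c) +
      Complex.I • fderiv ℝ D y.2.1 w (θ y.1 d)) = 0 := by
    rw [← h4]
    simp only [smul_add, smul_smul, mul_assoc, Complex.I_mul_I]
    module
  exact (smul_eq_zero.1 h5).resolve_left (by simp)

end ModelForm

/-! ### Integrability in terms of torsion and curvature -/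

namespace HomogeneousSubmanifold.DefiningMap

variable {EG : Type*} [NormedAddCommGroup EG] [NormedSpace ℂ EG]
  {G : Type*} [TopologicalSpace G] [ChartedSpace EG G] [Group G]
  {EF : Type*} [NormedAddCommGroup EF] [NormedSpace ℂ EF]
  {F : Type*} [TopologicalSpace F] [ChartedSpace EF F] [MulAction G F]
  {m r : ℕ} {L : LieSubgroupGL m EG G} {S : HomogeneousSubmanifold EF F r L} {f₀ : F}

theorem fderiv_apply_smul (d : S.DefiningMap f₀) (w : EF) (c : ℂ) (ξ : Fin m → ℂ) :
    fderiv ℝ d.toFun (chartAt EF f₀ f₀) w (c • ξ) =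
      c • fderiv ℝ d.toFun (chartAt EF f₀ f₀) w ξ := by
  have hD : DifferentiableAt ℝ d.toFun (chartAt EF f₀ f₀) :=
    d.contDiffAt.self_of_nhds.differentiableAt (by simp)
  have h1 : ∀ ξ, HasFDerivAt (fun y ↦ d.toFun y ξ)
      ((fderiv ℝ d.toFun (chartAt EF f₀ f₀)).flip ξ) (chartAt EF f₀ f₀) := by
    intro ξ
    refine (hD.hasFDerivAt.clm_apply (hasFDerivAt_const ξ _)).congr_fderiv ?_
    ext w
    simp
  have h2 := (h1 ξ).const_smul c
  have h3 : (fun y ↦ d.toFun y (c • ξ)) = fun y ↦ c • d.toFun y ξ := funext fun y ↦ d.map_smul y c ξ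
  have h4 := h1 (c • ξ)
  rw [h3] at h4
  exact congrArg (fun T : EF →L[ℝ] d.W ↦ T w) (h4.unique h2)

end HomogeneousSubmanifold.DefiningMap

namespace PrincipalBundle

variable {EG : Type*} [NormedAddCommGroup EG] [NormedSpace ℂ EG]
  {G : Type*} [TopologicalSpace G] [ChartedSpace EG G] [Group G]
  {EF : Type*} [NormedAddCommGroup EF] [NormedSpace ℂ EF]
  {F : Type*} [TopologicalSpace F] [ChartedSpace EF F] [MulAction G F]
  [ContMDiffSMul 𝓘(ℂ, EG) 𝓘(ℂ, EF) ω G F] [IsManifold 𝓘(ℂ, EF) ω F]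

theorem infAct_smul (f₀ : F) (c : ℂ) (η : EG) :
    infAct (EF := EF) G f₀ f₀ (c • η) = c • infAct G f₀ f₀ η := by
  refine mD_smul ?_ c η
  refine MDifferentiableAt.comp (1 : G) (g := chartAt EF f₀)
    (mdifferentiableAt_chartAt_complex (by simp)) ?_
  exact ((ContMDiffSMul.contMDiff_smul (I := 𝓘(ℂ, EG)) (I' := 𝓘(ℂ, EF)) (n := ω) (G := G)
    (M := F)).comp (contMDiff_id.prodMk contMDiff_const)).mdifferentiableAt (by simp)

end PrincipalBundle

theorem map_twoFormC {E V V' : Type*} [NormedAddCommGroup E] [NormedAddCommGroup V]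
    [NormedSpace ℂ V] [NormedAddCommGroup V'] [NormedSpace ℂ V'] (T : V →L[ℂ] V')
    (β : E → E → V) (a b c d : E) :
    T (twoFormC β a b c d) = twoFormC (fun v w ↦ T (β v w)) a b c d := by
  simp only [twoFormC, map_add, map_sub, map_smul]

/-! ### Torsion, curvature and the subspace `p` at the centre of an adapted trivialization -/

section Center

variable {EM : Type*} [NormedAddCommGroup EM] [NormedSpace ℝ EM]
  {M : Type*} [TopologicalSpace M] [ChartedSpace EM M] [IsManifold 𝓘(ℝ, EM) ∞ M]
  {EP : Type*} [NormedAddCommGroup EP] [NormedSpace ℝ EP] [FiniteDimensional ℝ EP]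
  {P : Type*} [TopologicalSpace P] [ChartedSpace EP P] [IsManifold 𝓘(ℝ, EP) ∞ P]
  {EG : Type*} [NormedAddCommGroup EG] [NormedSpace ℂ EG]
  {G : Type*} [TopologicalSpace G] [ChartedSpace EG G] [Group G] {m : ℕ}
  {EF : Type*} [NormedAddCommGroup EF] [NormedSpace ℂ EF]
  {F : Type*} [TopologicalSpace F] [ChartedSpace EF F] [MulAction G F]
  {B : PrincipalBundle EM M EP P EG G} {L : LieSubgroupGL m EG G} (e : FrameInclusion B L)
  {τ : B.Triv} {x₀ : M} {r : ℕ} {S : HomogeneousSubmanifold EF F r L} {f₀ : F}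

-- A frame is an isomorphism onto the whole complexified tangent space, so the complexified
-- canonical form is onto.
omit [FiniteDimensional ℝ EP] [IsManifold 𝓘(ℝ, EP) ∞ P] in
theorem FrameInclusion.localCanon_surjective (hx : x₀ ∈ τ.base) (ξ : Fin m → ℂ) :
    ∃ a b, e.localCanon τ x₀ (chartAt EM x₀ x₀) a +
      Complex.I • e.localCanon τ x₀ (chartAt EM x₀ x₀) b = ξ := by
  have h1 : (chartAt EM x₀).symm (chartAt EM x₀ x₀) = x₀ :=
    (chartAt EM x₀).left_inv (mem_chart_source EM x₀)
  have h2 : ∀ v, mD 𝓘(ℝ, EM) 𝓘(ℝ, EM) (chartAt EM x₀).symm (chartAt EM x₀ x₀) v = v := by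
    intro v
    have := (isSmoothCoord_chartAt (E := EM) x₀).mD_symm_mD (mem_chart_source EM x₀) v
    rwa [mD_chartAt_self] at this
  refine ⟨reC EM (e.frameE (τ.sec x₀) ξ), imC EM (e.frameE (τ.sec x₀) ξ), ?_⟩
  rw [e.localCanon_apply (mem_chart_target EM x₀) (by rwa [h1]),
    e.localCanon_apply (mem_chart_target EM x₀) (by rwa [h1]), h1, h2, h2, ← map_smul, ← map_add,
    TensorProduct.smul_tmul', smul_eq_mul, mul_one, ← eq_reC_add_imC, LinearEquiv.symm_apply_apply]

omit [IsManifold 𝓘(ℝ, EM) ∞ M] [FiniteDimensional ℝ EP]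
  [IsManifold 𝓘(ℝ, EP) ∞ P] in
theorem PrincipalBundle.coord_pt_eq_one (hx : x₀ ∈ τ.base) (hpt : τ.sec x₀ = B.pt x₀) :
    τ.coord (B.pt x₀) = 1 := by
  rw [← hpt, PrincipalBundle.coord_sec τ hx]

omit [FiniteDimensional ℝ EP] [IsManifold 𝓘(ℝ, EP) ∞ P] in
theorem FrameInclusion.mem_map_frame_center_iff (d : S.DefiningMap f₀) (hx : x₀ ∈ τ.base)
    (hpt : τ.sec x₀ = B.pt x₀) (X : TangentSpaceC 𝓘(ℝ, EM) x₀) :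
    X ∈ (S.sub f₀).1.map (e.frameAt x₀).toLinearMap ↔
      d.toFun (chartAt EF f₀ f₀) (e.localCanon τ x₀ (chartAt EM x₀ x₀) (reE 𝓘(ℝ, EM) X) +
        Complex.I • e.localCanon τ x₀ (chartAt EM x₀ x₀) (imE 𝓘(ℝ, EM) X)) = 0 := by
  rw [e.mem_map_frame_iff S hx (mem_chart_source EM x₀) f₀ (mD_chartAt_self _ _)
    (mD_chartAt_self _ _), PrincipalBundle.coord_pt_eq_one hx hpt, one_smul, d.mem_sub_iff]

theorem FrameInclusion.torsion_mem_iff (d : S.DefiningMap f₀) (c : B.Connection) (hx : x₀ ∈ τ.base)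
    (hpt : τ.sec x₀ = B.pt x₀) (h0 : c.secForm τ x₀ = 0) (X Y : TangentSpaceC 𝓘(ℝ, EM) x₀) :
    e.torsion c x₀ X Y ∈ (S.sub f₀).1.map (e.frameAt x₀).toLinearMap ↔
      d.toFun (chartAt EF f₀ f₀) (twoFormC (dForm (e.localCanon τ x₀) (chartAt EM x₀ x₀))
        (reE 𝓘(ℝ, EM) X) (imE 𝓘(ℝ, EM) X) (reE 𝓘(ℝ, EM) Y) (imE 𝓘(ℝ, EM) Y)) = 0 := by
  have h1 : (fun v w : EM ↦ (e.torsionForm c (B.pt x₀) v w : Fin m → ℂ)) =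
      dForm (e.localCanon τ x₀) (chartAt EM x₀ x₀) := by
    funext v w
    exact e.torsionForm_pt c hx hpt h0 v w
  have h2 : e.torsion c x₀ X Y = e.frameAt x₀ (twoFormC
      (fun v w : EM ↦ (e.torsionForm c (B.pt x₀) v w : Fin m → ℂ))
        (reE 𝓘(ℝ, EM) X) (imE 𝓘(ℝ, EM) X) (reE 𝓘(ℝ, EM) Y) (imE 𝓘(ℝ, EM) Y)) := rfl
  rw [h2, h1, ← d.mem_sub_iff]
  refine Iff.trans (Submodule.mem_map_equiv _) ?_
  rw [LinearEquiv.symm_apply_apply]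

variable [ContMDiffSMul 𝓘(ℂ, EG) 𝓘(ℂ, EF) ω G F] [IsManifold 𝓘(ℂ, EF) ω F]

/-- At the centre the curvature is `dA` with values in the Lie algebra, and by `infAct_eq_zero_iff`
an element of the Lie algebra preserves the subspace exactly when its infinitesimal action at `f₀`
vanishes. -/
theorem curvatureAt_mem_iff (d : S.DefiningMap f₀) (c : B.Connection) (hx : x₀ ∈ τ.base)
    (hpt : τ.sec x₀ = B.pt x₀) (h0 : c.secForm τ x₀ = 0) (X Y : TangentSpaceC 𝓘(ℝ, EM) x₀) :
    (∀ ζ ∈ (S.sub f₀).1, curvatureAt L c x₀ X Y ζ ∈ (S.sub f₀).1) ↔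
      PrincipalBundle.infAct (EF := EF) G f₀ f₀
        (twoFormC (dForm (c.localForm τ x₀) (chartAt EM x₀ x₀))
        (reE 𝓘(ℝ, EM) X) (imE 𝓘(ℝ, EM) X) (reE 𝓘(ℝ, EM) Y) (imE 𝓘(ℝ, EM) Y)) = 0 := by
  have h1 : (fun v w : EM ↦ (c.curvature (B.pt x₀) v w : EG)) =
      dForm (c.localForm τ x₀) (chartAt EM x₀ x₀) := by
    funext v w
    exact c.curvature_pt hx hpt h0 v w
  have h2 : curvatureAt L c x₀ X Y = L.infRep (twoFormC
      (fun v w : EM ↦ (c.curvature (B.pt x₀) v w : EG))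
        (reE 𝓘(ℝ, EM) X) (imE 𝓘(ℝ, EM) X) (reE 𝓘(ℝ, EM) Y) (imE 𝓘(ℝ, EM) Y)) := by
    exact (map_twoFormC L.infRep (fun v w : EM ↦ (c.curvature (B.pt x₀) v w : EG)) _ _ _ _).symm
  rw [h2, h1, d.infAct_eq_zero_iff]

theorem FrameInclusion.curvature_mem_iff (d : S.DefiningMap f₀) (c : B.Connection)
    (hx : x₀ ∈ τ.base) (hpt : τ.sec x₀ = B.pt x₀) (h0 : c.secForm τ x₀ = 0)
    (X Y : TangentSpaceC 𝓘(ℝ, EM) x₀) :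
    (∀ Z ∈ (S.sub f₀).1.map (e.frameAt x₀).toLinearMap,
        e.curvature c x₀ X Y Z ∈ (S.sub f₀).1.map (e.frameAt x₀).toLinearMap) ↔
      PrincipalBundle.infAct (EF := EF) G f₀ f₀
        (twoFormC (dForm (c.localForm τ x₀) (chartAt EM x₀ x₀))
        (reE 𝓘(ℝ, EM) X) (imE 𝓘(ℝ, EM) X) (reE 𝓘(ℝ, EM) Y) (imE 𝓘(ℝ, EM) Y)) = 0 := by
  rw [← curvatureAt_mem_iff d c hx hpt h0]
  constructor
  · intro h ζ hζ
    have h1 := h _ (Submodule.mem_map_of_mem hζ)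
    rw [FrameInclusion.curvature, Submodule.mem_map_equiv, LinearEquiv.symm_apply_apply] at h1
    have h2 : (e.frameAt x₀).symm ((e.frameAt x₀).toLinearMap ζ) = ζ :=
      (e.frameAt x₀).symm_apply_apply ζ
    rwa [h2] at h1
  · rintro h _ ⟨ζ, hζ, rfl⟩
    rw [FrameInclusion.curvature, Submodule.mem_map_equiv, LinearEquiv.symm_apply_apply]
    have h2 : (e.frameAt x₀).symm ((e.frameAt x₀).toLinearMap ζ) = ζ :=
      (e.frameAt x₀).symm_apply_apply ζ
    rw [h2]
    exact h ζ hζ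

end Center

/-! ### Integrability of the distributions on `Q` -/

namespace TwistorBundle

variable {EM : Type*} [NormedAddCommGroup EM] [NormedSpace ℝ EM] [FiniteDimensional ℝ EM]
  {M : Type*} [TopologicalSpace M] [ChartedSpace EM M] [IsManifold 𝓘(ℝ, EM) ∞ M]
  {EP₁ : Type*} [NormedAddCommGroup EP₁] [NormedSpace ℝ EP₁] [FiniteDimensional ℝ EP₁]
  {P₁ : Type*} [TopologicalSpace P₁] [ChartedSpace EP₁ P₁] [IsManifold 𝓘(ℝ, EP₁) ∞ P₁]
  {EG₁ : Type*} [NormedAddCommGroup EG₁] [NormedSpace ℂ EG₁]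
  {G₁ : Type*} [TopologicalSpace G₁] [ChartedSpace EG₁ G₁] [Group G₁] [LieGroup 𝓘(ℂ, EG₁) ω G₁]
  {EF₁ : Type*} [NormedAddCommGroup EF₁] [NormedSpace ℂ EF₁] [FiniteDimensional ℂ EF₁]
  {F₁ : Type*} [TopologicalSpace F₁] [ChartedSpace EF₁ F₁] [MulAction G₁ F₁]
  [ContMDiffSMul 𝓘(ℂ, EG₁) 𝓘(ℂ, EF₁) ω G₁ F₁]
  {EP₂ : Type*} [NormedAddCommGroup EP₂] [NormedSpace ℝ EP₂] [FiniteDimensional ℝ EP₂]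
  {P₂ : Type*} [TopologicalSpace P₂] [ChartedSpace EP₂ P₂] [IsManifold 𝓘(ℝ, EP₂) ∞ P₂]
  {EG₂ : Type*} [NormedAddCommGroup EG₂] [NormedSpace ℂ EG₂]
  {G₂ : Type*} [TopologicalSpace G₂] [ChartedSpace EG₂ G₂] [Group G₂] [LieGroup 𝓘(ℂ, EG₂) ω G₂]
  {EF₂ : Type*} [NormedAddCommGroup EF₂] [NormedSpace ℂ EF₂] [FiniteDimensional ℂ EF₂]
  {F₂ : Type*} [TopologicalSpace F₂] [ChartedSpace EF₂ F₂] [MulAction G₂ F₂]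
  [ContMDiffSMul 𝓘(ℂ, EG₂) 𝓘(ℂ, EF₂) ω G₂ F₂]
  {m₁ r₁ m₂ r₂ : ℕ}
  {B₁ : PrincipalBundle EM M EP₁ P₁ EG₁ G₁} {B₂ : PrincipalBundle EM M EP₂ P₂ EG₂ G₂}
  {L₁ : LieSubgroupGL m₁ EG₁ G₁} {L₂ : LieSubgroupGL m₂ EG₂ G₂}
  [IsManifold 𝓘(ℂ, EF₁) ω F₁] [IsManifold 𝓘(ℂ, EF₂) ω F₂]
  (c₁ : B₁.Connection) (c₂ : B₂.Connection) (e : FrameInclusion B₁ L₁)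
  {S₁ : HomogeneousSubmanifold EF₁ F₁ r₁ L₁} {S₂ : HomogeneousSubmanifold EF₂ F₂ r₂ L₂}
  {τ₁ : B₁.Triv} {τ₂ : B₂.Triv} {x₀ : M} {f₁ : F₁} {f₂ : F₂}

variable (τ₁ τ₂ x₀ f₂) in
/-- The form which defines the distributions in the coordinates on `Q`. -/
noncomputable def distForm (d : S₁.DefiningMap f₁) :
    EM × EF₁ × EF₂ → EM × EF₁ × EF₂ →L[ℝ] d.W × EF₁ × EF₂ :=
  modelForm d.toFun (e.localCanon τ₁ x₀)
    (fun y ↦ PrincipalBundle.infAct G₁ f₁ ((chartAt EF₁ f₁).symm y)) (c₁.localForm τ₁ x₀)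
    (fun y ↦ PrincipalBundle.infAct G₂ f₂ ((chartAt EF₂ f₂).symm y)) (c₂.localForm τ₂ x₀)

/-- The coordinates are shrunk until the local equations of `F₁` are valid and smooth throughout;
the condition on `z₀` says that it sits at the centre of these equations, and so survives. One
coordinate system and one form serve both distributions, the type entering only through `ε`. -/
theorem exists_isSmoothCoord_distForm (d : S₁.DefiningMap f₁)
    {z₀ : TwistorBundle EF₁ F₁ EF₂ F₂ B₁ B₂} (hz₀ : z₀ ∈ (coord τ₁ τ₂ x₀ f₁ f₂).source)
    (hz₁ : z₀.fib₁ τ₁ = f₁) :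
    ∃ Φ : OpenPartialHomeomorph (TwistorBundle EF₁ F₁ EF₂ F₂ B₁ B₂) (EM × EF₁ × EF₂),
      IsSmoothCoord (modelQ EM EF₁ EF₂) Φ ∧ z₀ ∈ Φ.source ∧ Φ z₀ = coord τ₁ τ₂ x₀ f₁ f₂ z₀ ∧
      ContDiffOn ℝ ∞ (distForm c₁ c₂ e τ₁ τ₂ x₀ f₂ d) Φ.target ∧
      ∀ (D : Submodule ℂ (ℂ ⊗[ℝ] (EF₁ × EF₂))) (ε : ℂ),
        (∀ ζ, ζ ∈ D ↔ reC _ ζ + ε • imC _ ζ = 0) → ∀ z ∈ Φ.source,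
        ∀ X : TangentSpaceC (modelQ EM EF₁ EF₂) z, X ∈ z.G0 c₁ c₂ e S₁ ⊔ D.map z.verticalMap ↔
          distForm c₁ c₂ e τ₁ τ₂ x₀ f₂ d (Φ z) (mD (modelQ EM EF₁ EF₂) 𝓘(ℝ, EM × EF₁ × EF₂) Φ z
            (reE (modelQ EM EF₁ EF₂) X)) +
          modelJ d.W EF₁ EF₂ ε (distForm c₁ c₂ e τ₁ τ₂ x₀ f₂ d (Φ z)
            (mD (modelQ EM EF₁ EF₂) 𝓘(ℝ, EM × EF₁ × EF₂) Φ z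
              (imE (modelQ EM EF₁ EF₂) X))) = 0 := by
  obtain ⟨O, hO, hOo, hOf⟩ := eventually_nhds_iff.1 (d.mem_iff.and d.contDiffAt)
  let Φ₀ := coord (EF₁ := EF₁) (EF₂ := EF₂) τ₁ τ₂ x₀ f₁ f₂
  have hs : IsOpen (Φ₀.source ∩ Φ₀ ⁻¹' {y | y.2.1 ∈ O}) :=
    Φ₀.isOpen_inter_preimage (hOo.preimage (continuous_fst.comp continuous_snd))
  have hsrc : ∀ z, z ∈ (Φ₀.restr (Φ₀.source ∩ Φ₀ ⁻¹' {y | y.2.1 ∈ O})).source ↔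
      z ∈ Φ₀.source ∧ chartAt EF₁ f₁ (z.fib₁ τ₁) ∈ O := by
    intro z
    rw [OpenPartialHomeomorph.restr_source' _ _ hs, ← inter_assoc, inter_self]
    rfl
  refine ⟨Φ₀.restr (Φ₀.source ∩ Φ₀ ⁻¹' {y | y.2.1 ∈ O}), isSmoothCoord_coord.restr _,
    (hsrc z₀).2 ⟨hz₀, by rwa [hz₁]⟩, rfl, ?_, ?_⟩
  · intro y hy
    refine ContDiffAt.contDiffWithinAt ?_
    -- Every point of the target comes from a point `z` of `Q`, where the conditions defining the
    -- domain can be read off.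
    have hy' := (Φ₀.restr (Φ₀.source ∩ Φ₀ ⁻¹' {y | y.2.1 ∈ O})).map_target hy
    rw [← (Φ₀.restr (Φ₀.source ∩ Φ₀ ⁻¹' {y | y.2.1 ∈ O})).right_inv hy]
    generalize (Φ₀.restr (Φ₀.source ∩ Φ₀ ⁻¹' {y | y.2.1 ∈ O})).symm y = z at hy'
    obtain ⟨hz, hzO⟩ := (hsrc z).1 hy'
    obtain ⟨hx, hxφ, hf₁, hf₂⟩ := (mem_coord_source z).1 hz
    change ContDiffAt ℝ ∞ _ (chartAt EM x₀ z.proj, chartAt EF₁ f₁ (z.fib₁ τ₁),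
      chartAt EF₂ f₂ (z.fib₂ τ₂))
    have hi : (chartAt EM x₀).symm (chartAt EM x₀ z.proj) = z.proj := (chartAt EM x₀).left_inv hxφ
    have ht := (chartAt EM x₀).map_source hxφ
    exact contDiffAt_modelForm (hO _ hzO).2 (e.contDiffAt_localCanon ht (by rw [hi]; exact hx.1))
      (PrincipalBundle.contDiffAt_infAct f₁ ((chartAt EF₁ f₁).map_source hf₁))
      (c₁.contDiffAt_localForm ht (by rw [hi]; exact hx.1))
      (PrincipalBundle.contDiffAt_infAct f₂ ((chartAt EF₂ f₂).map_source hf₂))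
      (c₂.contDiffAt_localForm ht (by rw [hi]; exact hx.2))
  · intro D ε hD z hz X
    obtain ⟨hz, hzO⟩ := (hsrc z).1 hz
    obtain ⟨hx, hxφ, hf₁, hf₂⟩ := (mem_coord_source z).1 hz
    have h1 : (chartAt EF₁ f₁).symm (chartAt EF₁ f₁ (z.fib₁ τ₁)) = z.fib₁ τ₁ :=
      (chartAt EF₁ f₁).left_inv hf₁
    have h2 : (chartAt EF₂ f₂).symm (chartAt EF₂ f₂ (z.fib₂ τ₂)) = z.fib₂ τ₂ :=
      (chartAt EF₂ f₂).left_inv hf₂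
    have h3 := (hO _ hzO).1
    rw [h1] at h3
    rw [mem_sup_map_verticalMap_iff c₁ c₂ e S₁ hz hD X rfl rfl, h3, map_add, d.map_smul]
    simp only [vert₁_apply, vert₂_apply]
    change _ ↔ modelForm _ _ _ _ _ _ (chartAt EM x₀ z.proj, chartAt EF₁ f₁ (z.fib₁ τ₁),
      chartAt EF₂ f₂ (z.fib₂ τ₂)) (mD (modelQ EM EF₁ EF₂) 𝓘(ℝ, EM × EF₁ × EF₂) Φ₀ z
        (reE (modelQ EM EF₁ EF₂) X)) + modelJ d.W EF₁ EF₂ ε (modelForm _ _ _ _ _ _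
      (chartAt EM x₀ z.proj, chartAt EF₁ f₁ (z.fib₁ τ₁),
      chartAt EF₂ f₂ (z.fib₂ τ₂)) (mD (modelQ EM EF₁ EF₂) 𝓘(ℝ, EM × EF₁ × EF₂) Φ₀ z
        (imE (modelQ EM EF₁ EF₂) X))) = 0
    rw [modelForm_apply, modelForm_apply, modelJ_apply]
    simp only [h1, h2, Prod.mk_add_mk, Prod.mk_eq_zero]
    rfl

end TwistorBundle

/-! ### The closedness condition at a point of `Q`, in adapted coordinates -/

namespace TwistorBundle

variable {EM : Type*} [NormedAddCommGroup EM] [NormedSpace ℝ EM] [FiniteDimensional ℝ EM]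
  {M : Type*} [TopologicalSpace M] [ChartedSpace EM M] [IsManifold 𝓘(ℝ, EM) ∞ M]
  {EP₁ : Type*} [NormedAddCommGroup EP₁] [NormedSpace ℝ EP₁] [FiniteDimensional ℝ EP₁]
  {P₁ : Type*} [TopologicalSpace P₁] [ChartedSpace EP₁ P₁] [IsManifold 𝓘(ℝ, EP₁) ∞ P₁]
  {EG₁ : Type*} [NormedAddCommGroup EG₁] [NormedSpace ℂ EG₁]
  {G₁ : Type*} [TopologicalSpace G₁] [ChartedSpace EG₁ G₁] [Group G₁] [LieGroup 𝓘(ℂ, EG₁) ω G₁]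
  {EF₁ : Type*} [NormedAddCommGroup EF₁] [NormedSpace ℂ EF₁] [FiniteDimensional ℂ EF₁]
  {F₁ : Type*} [TopologicalSpace F₁] [ChartedSpace EF₁ F₁] [MulAction G₁ F₁]
  [ContMDiffSMul 𝓘(ℂ, EG₁) 𝓘(ℂ, EF₁) ω G₁ F₁]
  {EP₂ : Type*} [NormedAddCommGroup EP₂] [NormedSpace ℝ EP₂] [FiniteDimensional ℝ EP₂]
  {P₂ : Type*} [TopologicalSpace P₂] [ChartedSpace EP₂ P₂] [IsManifold 𝓘(ℝ, EP₂) ∞ P₂]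
  {EG₂ : Type*} [NormedAddCommGroup EG₂] [NormedSpace ℂ EG₂]
  {G₂ : Type*} [TopologicalSpace G₂] [ChartedSpace EG₂ G₂] [Group G₂] [LieGroup 𝓘(ℂ, EG₂) ω G₂]
  {EF₂ : Type*} [NormedAddCommGroup EF₂] [NormedSpace ℂ EF₂] [FiniteDimensional ℂ EF₂]
  {F₂ : Type*} [TopologicalSpace F₂] [ChartedSpace EF₂ F₂] [MulAction G₂ F₂]
  [ContMDiffSMul 𝓘(ℂ, EG₂) 𝓘(ℂ, EF₂) ω G₂ F₂]
  {m₁ r₁ m₂ r₂ : ℕ}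
  {B₁ : PrincipalBundle EM M EP₁ P₁ EG₁ G₁} {B₂ : PrincipalBundle EM M EP₂ P₂ EG₂ G₂}
  {L₁ : LieSubgroupGL m₁ EG₁ G₁} {L₂ : LieSubgroupGL m₂ EG₂ G₂}
  [IsManifold 𝓘(ℂ, EF₁) ω F₁] [IsManifold 𝓘(ℂ, EF₂) ω F₂]
  (c₁ : B₁.Connection) (c₂ : B₂.Connection) (e : FrameInclusion B₁ L₁)
  {S₁ : HomogeneousSubmanifold EF₁ F₁ r₁ L₁} {S₂ : HomogeneousSubmanifold EF₂ F₂ r₂ L₂}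
  {τ₁ : B₁.Triv} {τ₂ : B₂.Triv} (z : TwistorBundle EF₁ F₁ EF₂ F₂ B₁ B₂)


/-- A local trivialization which is adapted to a connection at a point of `M`. -/
structure _root_.PrincipalBundle.Connection.IsAdapted {B : PrincipalBundle EM M EP₁ P₁ EG₁ G₁}
    (c : B.Connection) (τ : B.Triv) (x : M) : Prop where
  mem_base : x ∈ τ.base
  sec_eq : τ.sec x = B.pt x
  secForm_eq : c.secForm τ x = 0

variable {c₁ c₂ z}

omit [FiniteDimensional ℝ EM] [IsManifold 𝓘(ℝ, EM) ∞ M] [FiniteDimensional ℝ EP₁]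
  [FiniteDimensional ℝ EP₂] [LieGroup 𝓘(ℂ, EG₁) ω G₁] [LieGroup 𝓘(ℂ, EG₂) ω G₂]
  [FiniteDimensional ℂ EF₁] [FiniteDimensional ℂ EF₂] [IsManifold 𝓘(ℂ, EF₁) ω F₁]
  [IsManifold 𝓘(ℂ, EF₂) ω F₂] in
theorem mem_coord_source_of_isAdapted (h₁ : c₁.IsAdapted τ₁ z.proj) (h₂ : c₂.IsAdapted τ₂ z.proj) :
    z ∈ (coord (EF₁ := EF₁) (EF₂ := EF₂) τ₁ τ₂ z.proj z.fibrePoint.1 z.fibrePoint.2).source := by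
  refine (mem_coord_source z).2 ⟨⟨h₁.mem_base, h₂.mem_base⟩, mem_chart_source _ _, ?_, ?_⟩
  · rw [fib₁, PrincipalBundle.coord_pt_eq_one h₁.mem_base h₁.sec_eq, one_smul]
    exact mem_chart_source _ _
  · rw [fib₂, PrincipalBundle.coord_pt_eq_one h₂.mem_base h₂.sec_eq, one_smul]
    exact mem_chart_source _ _

omit [FiniteDimensional ℝ EM] [IsManifold 𝓘(ℝ, EM) ∞ M] [FiniteDimensional ℝ EP₁]
  [FiniteDimensional ℝ EP₂] [LieGroup 𝓘(ℂ, EG₁) ω G₁] [LieGroup 𝓘(ℂ, EG₂) ω G₂]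
  [FiniteDimensional ℂ EF₁] [FiniteDimensional ℂ EF₂] [IsManifold 𝓘(ℂ, EF₁) ω F₁]
  [IsManifold 𝓘(ℂ, EF₂) ω F₂] in
theorem coord_apply_of_isAdapted (h₁ : c₁.IsAdapted τ₁ z.proj) (h₂ : c₂.IsAdapted τ₂ z.proj) :
    coord τ₁ τ₂ z.proj z.fibrePoint.1 z.fibrePoint.2 z = (chartAt EM z.proj z.proj,
      chartAt EF₁ z.fibrePoint.1 z.fibrePoint.1, chartAt EF₂ z.fibrePoint.2 z.fibrePoint.2) := by
  rw [coord_apply, fib₁, fib₂, PrincipalBundle.coord_pt_eq_one h₁.mem_base h₁.sec_eq,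
    PrincipalBundle.coord_pt_eq_one h₂.mem_base h₂.sec_eq, one_smul, one_smul]

variable (h₁ : c₁.IsAdapted τ₁ z.proj) (h₂ : c₂.IsAdapted τ₂ z.proj)
  (d₁ : S₁.DefiningMap z.fibrePoint.1) (d₂ : S₂.DefiningMap z.fibrePoint.2)

include h₁ h₂

omit [FiniteDimensional ℝ EM] [FiniteDimensional ℝ EP₁]
  [FiniteDimensional ℝ EP₂] [LieGroup 𝓘(ℂ, EG₁) ω G₁] [LieGroup 𝓘(ℂ, EG₂) ω G₂]
  [FiniteDimensional ℂ EF₁] [FiniteDimensional ℂ EF₂] [IsManifold 𝓘(ℂ, EF₁) ω F₁]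
  [IsManifold 𝓘(ℂ, EF₂) ω F₂] in
theorem distForm_surjective {ε : ℂ} (k : d₁.W × EF₁ × EF₂) : ∃ a b,
    distForm c₁ c₂ e τ₁ τ₂ z.proj z.fibrePoint.2 d₁
        (coord τ₁ τ₂ z.proj z.fibrePoint.1 z.fibrePoint.2 z) a +
      modelJ d₁.W EF₁ EF₂ ε (distForm c₁ c₂ e τ₁ τ₂ z.proj z.fibrePoint.2 d₁
        (coord τ₁ τ₂ z.proj z.fibrePoint.1 z.fibrePoint.2 z) b) = k := by
  rw [coord_apply_of_isAdapted h₁ h₂]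
  exact modelForm_surjective (c₁.localForm_eq_zero h₁.mem_base h₁.secForm_eq)
    (c₂.localForm_eq_zero h₂.mem_base h₂.secForm_eq) (d₁.map_smul _) (d₁.surjective _)
    (e.localCanon_surjective h₁.mem_base) ε k

theorem eq_zero_of_closedOnKernel_distForm
    (h : ClosedOnKernel (distForm c₁ c₂ e τ₁ τ₂ z.proj z.fibrePoint.2 d₁)
      (modelJ d₁.W EF₁ EF₂ (-Complex.I))
      (coord τ₁ τ₂ z.proj z.fibrePoint.1 z.fibrePoint.2 z)) (w : EF₁) : w = 0 := by
  rw [coord_apply_of_isAdapted h₁ h₂] at h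
  have ht := mem_chart_target EM z.proj
  have hi : (chartAt EM z.proj).symm (chartAt EM z.proj z.proj) = z.proj :=
    (chartAt EM z.proj).left_inv (mem_chart_source _ _)
  refine eq_zero_of_closedOnKernel_modelForm (y := (chartAt EM z.proj z.proj,
    chartAt EF₁ z.fibrePoint.1 z.fibrePoint.1, chartAt EF₂ z.fibrePoint.2 z.fibrePoint.2))
    d₁.contDiffAt.self_of_nhds (e.contDiffAt_localCanon ht (by rw [hi]; exact h₁.mem_base))
    (PrincipalBundle.contDiffAt_infAct _ (mem_chart_target _ _))
    (c₁.contDiffAt_localForm ht (by rw [hi]; exact h₁.mem_base))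
    (PrincipalBundle.contDiffAt_infAct _ (mem_chart_target _ _))
    (c₂.contDiffAt_localForm ht (by rw [hi]; exact h₂.mem_base))
    (c₁.localForm_eq_zero h₁.mem_base h₁.secForm_eq)
    (c₂.localForm_eq_zero h₂.mem_base h₂.secForm_eq) (d₁.map_smul _) d₁.fderiv_smul
    d₁.fderiv_apply_smul (e.localCanon_surjective h₁.mem_base) ?_ h w
  intro w hw
  exact d₁.eq_zero w fun ξ hξ ↦ hw ξ ((d₁.mem_sub_iff ξ).1 hξ)

include d₂ in
theorem closedOnKernel_distForm_iff :
    ClosedOnKernel (distForm c₁ c₂ e τ₁ τ₂ z.proj z.fibrePoint.2 d₁)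
      (modelJ d₁.W EF₁ EF₂ Complex.I)
      (coord τ₁ τ₂ z.proj z.fibrePoint.1 z.fibrePoint.2 z) ↔
        (∀ X ∈ z.p e S₁, ∀ Y ∈ z.p e S₁, e.torsion c₁ z.proj X Y ∈ z.p e S₁) ∧
        (∀ X ∈ z.p e S₁, ∀ Y ∈ z.p e S₁, ∀ Z ∈ z.p e S₁,
          e.curvature c₁ z.proj X Y Z ∈ z.p e S₁) ∧
        (∀ X ∈ z.p e S₁, ∀ Y ∈ z.p e S₁, ∀ ζ ∈ z.q S₂,
          curvatureAt L₂ c₂ z.proj X Y ζ ∈ z.q S₂) := by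
  have ht := mem_chart_target EM z.proj
  have hi : (chartAt EM z.proj).symm (chartAt EM z.proj z.proj) = z.proj :=
    (chartAt EM z.proj).left_inv (mem_chart_source _ _)
  have hi₁ : (chartAt EF₁ z.fibrePoint.1).symm (chartAt EF₁ z.fibrePoint.1 z.fibrePoint.1) =
    z.fibrePoint.1 := (chartAt EF₁ z.fibrePoint.1).left_inv (mem_chart_source _ _)
  have hi₂ : (chartAt EF₂ z.fibrePoint.2).symm (chartAt EF₂ z.fibrePoint.2 z.fibrePoint.2) =
    z.fibrePoint.2 := (chartAt EF₂ z.fibrePoint.2).left_inv (mem_chart_source _ _)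
  rw [coord_apply_of_isAdapted h₁ h₂, distForm, closedOnKernel_modelForm_iff
    (y := (chartAt EM z.proj z.proj,
      chartAt EF₁ z.fibrePoint.1 z.fibrePoint.1, chartAt EF₂ z.fibrePoint.2 z.fibrePoint.2))
    d₁.contDiffAt.self_of_nhds (e.contDiffAt_localCanon ht (by rw [hi]; exact h₁.mem_base))
    (PrincipalBundle.contDiffAt_infAct _ (mem_chart_target _ _))
    (c₁.contDiffAt_localForm ht (by rw [hi]; exact h₁.mem_base))
    (PrincipalBundle.contDiffAt_infAct _ (mem_chart_target _ _))
    (c₂.contDiffAt_localForm ht (by rw [hi]; exact h₂.mem_base))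
    (c₁.localForm_eq_zero h₁.mem_base h₁.secForm_eq)
    (c₂.localForm_eq_zero h₂.mem_base h₂.secForm_eq) (d₁.map_smul _) d₁.fderiv_smul
    (by simp only [hi₁]; exact PrincipalBundle.infAct_smul _)
    (by simp only [hi₂]; exact PrincipalBundle.infAct_smul _)]
  simp only [hi₁, hi₂]
  have hp : ∀ X : TangentSpaceC 𝓘(ℝ, EM) z.proj, X ∈ z.p e S₁ ↔ _ :=
    e.mem_map_frame_center_iff d₁ h₁.mem_base h₁.sec_eq
  have hT : ∀ X Y : TangentSpaceC 𝓘(ℝ, EM) z.proj, e.torsion c₁ z.proj X Y ∈ z.p e S₁ ↔ _ :=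
    e.torsion_mem_iff d₁ c₁ h₁.mem_base h₁.sec_eq h₁.secForm_eq
  have hR₁ : ∀ X Y : TangentSpaceC 𝓘(ℝ, EM) z.proj,
      (∀ Z ∈ z.p e S₁, e.curvature c₁ z.proj X Y Z ∈ z.p e S₁) ↔ _ :=
    e.curvature_mem_iff d₁ c₁ h₁.mem_base h₁.sec_eq h₁.secForm_eq
  have hR₂ : ∀ X Y : TangentSpaceC 𝓘(ℝ, EM) z.proj,
      (∀ ζ ∈ z.q S₂, curvatureAt L₂ c₂ z.proj X Y ζ ∈ z.q S₂) ↔ _ :=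
    curvatureAt_mem_iff d₂ c₂ h₂.mem_base h₂.sec_eq h₂.secForm_eq
  constructor
  · intro h
    have h' : ∀ X ∈ z.p e S₁, ∀ Y ∈ z.p e S₁, _ := fun X hX Y hY ↦
      h _ _ _ _ ((hp X).1 hX) ((hp Y).1 hY)
    exact ⟨fun X hX Y hY ↦ (hT X Y).2 (h' X hX Y hY).1,
      fun X hX Y hY ↦ (hR₁ X Y).2 (h' X hX Y hY).2.1,
      fun X hX Y hY ↦ (hR₂ X Y).2 (h' X hX Y hY).2.2⟩
  · rintro ⟨h3, h4, h5⟩ a b c d hab hcd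
    -- Pairs of real vectors satisfying the kernel condition are exactly the real and imaginary
    -- parts of elements of `p`.
    have hX : mkE 𝓘(ℝ, EM) z.proj a b ∈ z.p e S₁ := by
      rw [hp, reE_mkE, imE_mkE]
      exact hab
    have hY : mkE 𝓘(ℝ, EM) z.proj c d ∈ z.p e S₁ := by
      rw [hp, reE_mkE, imE_mkE]
      exact hcd
    have h6 := (hT _ _).1 (h3 _ hX _ hY)
    have h7 := (hR₁ _ _).1 (h4 _ hX _ hY)
    have h8 := (hR₂ _ _).1 (h5 _ hX _ hY)
    rw [reE_mkE, imE_mkE, reE_mkE, imE_mkE] at h6 h7 h8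
    exact ⟨h6, h7, h8⟩

end TwistorBundle

/-! ### The theorem -/

theorem theorem1p1
    -- the manifold `M`
    {EM : Type*} [NormedAddCommGroup EM] [NormedSpace ℝ EM] [FiniteDimensional ℝ EM]
    {M : Type*} [TopologicalSpace M] [ChartedSpace EM M] [IsManifold 𝓘(ℝ, EM) ∞ M]
    [T2Space M] [SecondCountableTopology M] [ConnectedSpace M]
    -- the complex Lie groups `G₁` and `G₂`
    {m₁ m₂ r₁ r₂ : ℕ}
    {EG₁ : Type*} [NormedAddCommGroup EG₁] [NormedSpace ℂ EG₁] [FiniteDimensional ℂ EG₁]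
    {G₁ : Type*} [TopologicalSpace G₁] [ChartedSpace EG₁ G₁] [Group G₁]
    [LieGroup 𝓘(ℂ, EG₁) ω G₁] [T2Space G₁] [SecondCountableTopology G₁]
    {EG₂ : Type*} [NormedAddCommGroup EG₂] [NormedSpace ℂ EG₂] [FiniteDimensional ℂ EG₂]
    {G₂ : Type*} [TopologicalSpace G₂] [ChartedSpace EG₂ G₂] [Group G₂]
    [LieGroup 𝓘(ℂ, EG₂) ω G₂] [T2Space G₂] [SecondCountableTopology G₂]
    (L₁ : LieSubgroupGL m₁ EG₁ G₁) (L₂ : LieSubgroupGL m₂ EG₂ G₂)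
    -- the complex manifolds `F₁` and `F₂`
    {EF₁ : Type*} [NormedAddCommGroup EF₁] [NormedSpace ℂ EF₁] [FiniteDimensional ℂ EF₁]
    {F₁ : Type*} [TopologicalSpace F₁] [ChartedSpace EF₁ F₁] [IsManifold 𝓘(ℂ, EF₁) ω F₁]
    [T2Space F₁] [SecondCountableTopology F₁] [Nonempty F₁]
    [MulAction G₁ F₁] [ContMDiffSMul 𝓘(ℂ, EG₁) 𝓘(ℂ, EF₁) ω G₁ F₁]
    {EF₂ : Type*} [NormedAddCommGroup EF₂] [NormedSpace ℂ EF₂] [FiniteDimensional ℂ EF₂]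
    {F₂ : Type*} [TopologicalSpace F₂] [ChartedSpace EF₂ F₂] [IsManifold 𝓘(ℂ, EF₂) ω F₂]
    [T2Space F₂] [SecondCountableTopology F₂] [Nonempty F₂]
    [MulAction G₂ F₂] [ContMDiffSMul 𝓘(ℂ, EG₂) 𝓘(ℂ, EF₂) ω G₂ F₂]
    (S₁ : HomogeneousSubmanifold EF₁ F₁ r₁ L₁) (S₂ : HomogeneousSubmanifold EF₂ F₂ r₂ L₂)
    -- the principal bundles and their connections
    {EP₁ : Type*} [NormedAddCommGroup EP₁] [NormedSpace ℝ EP₁] [FiniteDimensional ℝ EP₁]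
    {P₁ : Type*} [TopologicalSpace P₁] [ChartedSpace EP₁ P₁] [IsManifold 𝓘(ℝ, EP₁) ∞ P₁]
    {EP₂ : Type*} [NormedAddCommGroup EP₂] [NormedSpace ℝ EP₂] [FiniteDimensional ℝ EP₂]
    {P₂ : Type*} [TopologicalSpace P₂] [ChartedSpace EP₂ P₂] [IsManifold 𝓘(ℝ, EP₂) ∞ P₂]
    (B₁ : PrincipalBundle EM M EP₁ P₁ EG₁ G₁) (B₂ : PrincipalBundle EM M EP₂ P₂ EG₂ G₂)
    (e : FrameInclusion B₁ L₁) (c₁ : B₁.Connection) (c₂ : B₂.Connection) :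
    (1 ≤ Module.finrank ℂ EF₁ →
      ¬ IsIntegrableDistribution (modelQ EM EF₁ EF₂)
        (fun z : TwistorBundle EF₁ F₁ EF₂ F₂ B₁ B₂ ↦ z.distG' c₁ c₂ e S₁)) ∧
    (IsIntegrableDistribution (modelQ EM EF₁ EF₂)
        (fun z : TwistorBundle EF₁ F₁ EF₂ F₂ B₁ B₂ ↦ z.distG c₁ c₂ e S₁) ↔
      ∀ z : TwistorBundle EF₁ F₁ EF₂ F₂ B₁ B₂,
        (∀ X ∈ z.p e S₁, ∀ Y ∈ z.p e S₁, e.torsion c₁ z.proj X Y ∈ z.p e S₁) ∧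
        (∀ X ∈ z.p e S₁, ∀ Y ∈ z.p e S₁, ∀ Z ∈ z.p e S₁,
          e.curvature c₁ z.proj X Y Z ∈ z.p e S₁) ∧
        (∀ X ∈ z.p e S₁, ∀ Y ∈ z.p e S₁, ∀ ζ ∈ z.q S₂,
          curvatureAt L₂ c₂ z.proj X Y ζ ∈ z.q S₂)) := by
  have : FiniteDimensional ℝ EF₁ := FiniteDimensional.complexToReal EF₁
  have : FiniteDimensional ℝ EF₂ := FiniteDimensional.complexToReal EF₂
  have had₁ : ∀ x : M, ∃ τ : B₁.Triv, c₁.IsAdapted τ x := fun x ↦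
    let ⟨τ, h, h', h''⟩ := c₁.exists_triv_horizontal x
    ⟨τ, h, h', h''⟩
  have had₂ : ∀ x : M, ∃ τ : B₂.Triv, c₂.IsAdapted τ x := fun x ↦
    let ⟨τ, h, h', h''⟩ := c₂.exists_triv_horizontal x
    ⟨τ, h, h', h''⟩
  have hI : Complex.I * Complex.I = -1 := Complex.I_mul_I
  have hI' : -Complex.I * -Complex.I = -1 := by rw [neg_mul_neg, Complex.I_mul_I]
  have h10 : ∀ ζ : ℂ ⊗[ℝ] (EF₁ × EF₂), ζ ∈ vectors10 (EF₁ × EF₂) ↔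
      reC _ ζ + (-Complex.I) • imC _ ζ = 0 := fun ζ ↦ by
    rw [mem_vectors10_iff, neg_smul, sub_eq_add_neg]
  -- Integrability yields closedness at every point, for both types at once: the two distributions
  -- correspond to the square roots `ε = i` and `ε = -i` of `-1`.
  have hclosed : ∀ (D : Submodule ℂ (ℂ ⊗[ℝ] (EF₁ × EF₂))) (ε : ℂ),
      (∀ ζ, ζ ∈ D ↔ reC _ ζ + ε • imC _ ζ = 0) → ε * ε = -1 →
      IsIntegrableDistribution (modelQ EM EF₁ EF₂)
        (fun z : TwistorBundle EF₁ F₁ EF₂ F₂ B₁ B₂ ↦ z.G0 c₁ c₂ e S₁ ⊔ D.map z.verticalMap) →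
      ∀ (z : TwistorBundle EF₁ F₁ EF₂ F₂ B₁ B₂) (τ₁ : B₁.Triv) (τ₂ : B₂.Triv)
        (d₁ : S₁.DefiningMap z.fibrePoint.1), c₁.IsAdapted τ₁ z.proj → c₂.IsAdapted τ₂ z.proj →
        ClosedOnKernel (TwistorBundle.distForm c₁ c₂ e τ₁ τ₂ z.proj z.fibrePoint.2 d₁)
          (modelJ d₁.W EF₁ EF₂ ε)
          (TwistorBundle.coord τ₁ τ₂ z.proj z.fibrePoint.1 z.fibrePoint.2 z) := by
    intro D ε hD hε hint z τ₁ τ₂ d₁ h₁ h₂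
    have : FiniteDimensional ℝ d₁.W := FiniteDimensional.complexToReal d₁.W
    obtain ⟨Φ, hΦ, hzΦ, hΦz, hα, hΦD⟩ := TwistorBundle.exists_isSmoothCoord_distForm c₁ c₂ e d₁
      (TwistorBundle.mem_coord_source_of_isAdapted h₁ h₂)
      (by rw [TwistorBundle.fib₁, PrincipalBundle.coord_pt_eq_one h₁.mem_base h₁.sec_eq, one_smul])
    rw [← hΦz]
    refine closedOnKernel_of_isIntegrable hΦ (modelJ_modelJ hε) hα (hΦD D ε hD) hzΦ ?_ hint
    rw [hΦz]
    exact TwistorBundle.distForm_surjective e h₁ h₂ d₁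
  refine ⟨fun hF hint ↦ ?_, fun hint z ↦ ?_, fun h W hW X Y hX hY hXD hYD z hz ↦ ?_⟩
  · obtain ⟨x⟩ : Nonempty M := inferInstance
    obtain ⟨f₁⟩ : Nonempty F₁ := inferInstance
    obtain ⟨f₂⟩ : Nonempty F₂ := inferInstance
    let z : TwistorBundle EF₁ F₁ EF₂ F₂ B₁ B₂ := ⟨x, (f₁, f₂)⟩
    obtain ⟨τ₁, h₁⟩ := had₁ z.proj
    obtain ⟨τ₂, h₂⟩ := had₂ z.proj
    obtain ⟨d₁⟩ := S₁.nonempty_definingMap z.fibrePoint.1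
    have h0 := TwistorBundle.eq_zero_of_closedOnKernel_distForm e h₁ h₂ d₁
      (hclosed _ _ h10 hI' hint z τ₁ τ₂ d₁ h₁ h₂)
    -- Integrability of `𝒢'` at a single point of `Q` already kills every tangent vector of `F₁`.
    have : Subsingleton EF₁ := subsingleton_of_forall_eq 0 h0
    rw [Module.finrank_zero_of_subsingleton] at hF
    omega
  · obtain ⟨τ₁, h₁⟩ := had₁ z.proj
    obtain ⟨τ₂, h₂⟩ := had₂ z.proj
    obtain ⟨d₁⟩ := S₁.nonempty_definingMap z.fibrePoint.1
    obtain ⟨d₂⟩ := S₂.nonempty_definingMap z.fibrePoint.2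
    exact (TwistorBundle.closedOnKernel_distForm_iff e h₁ h₂ d₁ d₂).1
      (hclosed _ _ mem_vectors01_iff hI hint z τ₁ τ₂ d₁ h₁ h₂)
  · obtain ⟨τ₁, h₁⟩ := had₁ z.proj
    obtain ⟨τ₂, h₂⟩ := had₂ z.proj
    obtain ⟨d₁⟩ := S₁.nonempty_definingMap z.fibrePoint.1
    obtain ⟨d₂⟩ := S₂.nonempty_definingMap z.fibrePoint.2
    obtain ⟨Φ, hΦ, hzΦ, hΦz, hα, hΦD⟩ := TwistorBundle.exists_isSmoothCoord_distForm c₁ c₂ e d₁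
      (TwistorBundle.mem_coord_source_of_isAdapted h₁ h₂)
      (by rw [TwistorBundle.fib₁, PrincipalBundle.coord_pt_eq_one h₁.mem_base h₁.sec_eq, one_smul])
    -- Coordinates centred at the given point suffice, since membership of the bracket is a
    -- condition at that point alone.
    refine lieBracketC_mem_of_closedOnKernel hΦ (modelJ_modelJ hI) hα
      (hΦD _ _ mem_vectors01_iff) hW hX hY hXD hYD hz hzΦ ?_
    rw [hΦz]
    exact (TwistorBundle.closedOnKernel_distForm_iff e h₁ h₂ d₁ d₂).2 (h z)
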